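/- Let $(D,h)$ be a connected, real analytic, flat Riemannian 3-manifold which admits a Gaussian orthonormal frame $E_1,E_2,E_3$, i.e. an analytic $h$-orthonormal frame of pairwise commuting vector fields (locally $E_i=\partial/\partial x^i$ for coordinates in which $h=\delta_{ij}\,dx^i dx^j$). Let $\hat c$ be a real analytic symmetric bilinear form on $D$ that is diagonal in this frame, and put $\hat c_i=\hat c(E_i,E_i)$. An analytic signature-changing spacetime $(M,g)$ with change surface $(D,h)$ consists of an open neighbourhood $M$ of $\{0\}\times D$ in $\mathbb R\times D$ that meets every line $\mathbb R\times\{x\}$ in an interval, and of $$g=-\eta\,dt^2+g_{ij}(t,x)\,dx^i dx^j,\qquad \eta=1 \text{ for } t>0,\quad \eta=-1\text{ for } t<0,$$ where $g_{ij}(t,\cdot)\,dx^idx^j$ is positive definite and real analytic in $(t,x)$, and $g_{ij}(0,\cdot)\,dx^idx^j=h$. It is a vacuum spacetime if $\mathrm{Ric}(g)=0$ on $M\setminus(\{0\}\times D)$, and flat if its Riemann tensor vanishes there. Then an analytic signature-changing vacuum spacetime with change surface $(D,h)$ and $\partial_t g_{ij}|_{t=0}=\hat c_{ij}$ exists if and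 only if $$\hat c_1\hat c_2+\hat c_2\hat c_3+\hat c_3\hat c_1=0\quad\text{on } D$$ and at least one of the following holds: (i) $\hat c_1,\hat c_2,\hat c_3$ are constant on $D$; (ii) there is an $i\in\{1,2,3\}$ such that, for both $j\ne i$, $\hat c_j$ vanishes identically and $E_j\hat c_i=0$ on $D$ (so $\hat c$ depends locally on the one coordinate $x^i$ only). Moreover, every such vacuum spacetime (one with $\partial_t g_{ij}|_{t=0}=\hat c_{ij}$) is flat if and only if two of the functions $\hat c_1,\hat c_2,\hat c_3$ vanish identically on $D$. -/

import Mathlib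

open scoped Manifold ContDiff Bundle
open Bundle

/-! ## Curvature in a commuting frame

`P` is the set of points, `∂ a f` the derivative of the function `f` along the `a`-th field of a
frame whose fields commute, and `G p` the Gram matrix of the metric in this frame at `p`.  As the
frame fields commute, they are locally the coordinate fields of a chart, and the usual coordinate
formulas give the components of the Levi-Civita connection and of its curvature. -/

section Curvature

variable {P ι : Type*} [Fintype ι] [DecidableEq ι]

/-- Christoffel symbols
`Γ^c_{ab} = ½ g^{cd} (∂_a g_{bd} + ∂_b g_{ad} - ∂_d g_{ab})`. -/
noncomputable def christoffel (dir : ι → (P → ℝ) → P → ℝ) (G : P → Matrix ι ι ℝ)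
    (c a b : ι) (p : P) : ℝ :=
  1 / 2 * ∑ d, (G p)⁻¹ c d *
    (dir a (fun q => G q b d) p + dir b (fun q => G q a d) p - dir d (fun q => G q a b) p)

/-- Riemann curvature
`R^d_{cab} = ∂_a Γ^d_{bc} - ∂_b Γ^d_{ac} + Γ^d_{ae} Γ^e_{bc} - Γ^d_{be} Γ^e_{ac}`. -/
noncomputable def riemannTensor (dir : ι → (P → ℝ) → P → ℝ) (G : P → Matrix ι ι ℝ)
    (d c a b : ι) (p : P) : ℝ :=
  dir a (christoffel dir G d b c) p - dir b (christoffel dir G d a c) p +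
    ∑ e, (christoffel dir G d a e p * christoffel dir G e b c p -
      christoffel dir G d b e p * christoffel dir G e a c p)

/-- Ricci curvature `Ric_{cb} = R^a_{cab}`. -/
noncomputable def ricciTensor (dir : ι → (P → ℝ) → P → ℝ) (G : P → Matrix ι ι ℝ)
    (c b : ι) (p : P) : ℝ :=
  ∑ a, riemannTensor dir G a c a b p

end Curvature

/-! ## Riemannian three-manifolds, tensor fields and frames -/

/-- The model space of three-manifolds. -/
abbrev Model3 : Type := EuclideanSpace ℝ (Fin 3)

section Surface

variable (D : Type*) [TopologicalSpace D] [ChartedSpace Model3 D] [IsManifold 𝓘(ℝ, Model3) ω D]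

/-- A bilinear form on each tangent space of `D`, without regularity in the base point. -/
abbrev BilinField : Type _ :=
  (x : D) → TangentSpace 𝓘(ℝ, Model3) x →L[ℝ] TangentSpace 𝓘(ℝ, Model3) x →L[ℝ] ℝ

/-- Real analytic Riemannian metrics on `D`. -/
abbrev AnalyticMetric : Type _ :=
  ContMDiffRiemannianMetric 𝓘(ℝ, Model3) ω Model3 (fun x : D => TangentSpace 𝓘(ℝ, Model3) x)

variable {D}

/-- The field of bilinear forms `c` is real analytic, as a section of `T*D ⊗ T*D`. -/
def BilinField.IsAnalytic (c : BilinField D) : Prop :=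
  ContMDiff 𝓘(ℝ, Model3) (𝓘(ℝ, Model3).prod 𝓘(ℝ, Model3 →L[ℝ] Model3 →L[ℝ] ℝ)) ω
    (fun x : D => (TotalSpace.mk' (Model3 →L[ℝ] Model3 →L[ℝ] ℝ) x (c x) :
      TotalSpace (Model3 →L[ℝ] Model3 →L[ℝ] ℝ)
        (fun x : D => TangentSpace 𝓘(ℝ, Model3) x →L[ℝ] TangentSpace 𝓘(ℝ, Model3) x →L[ℝ] ℝ)))

/-- A Gaussian orthonormal frame of `(D, h)`: an analytic orthonormal frame of commuting vector
fields, that is, one which around every point is the coordinate frame `∂/∂x¹, ∂/∂x², ∂/∂x³` of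
coordinates in which `h` is the Euclidean metric. -/
structure GaussianFrame (h : AnalyticMetric D) where
  /-- the frame fields -/
  field : Fin 3 → (x : D) → TangentSpace 𝓘(ℝ, Model3) x
  analytic : ∀ i, ContMDiff 𝓘(ℝ, Model3) 𝓘(ℝ, Model3).tangent ω
    (fun x => (⟨x, field i x⟩ : TangentBundle 𝓘(ℝ, Model3) D))
  commute : ∀ i j x, VectorField.mlieBracket 𝓘(ℝ, Model3) (field i) (field j) x = 0
  orthonormal : ∀ i j x, h.inner x (field i x) (field j x) = if i = j then 1 else 0

namespace GaussianFrame

variable {h : AnalyticMetric D} (E : GaussianFrame h)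

/-- Derivative of a function on `D` along the `i`-th frame field. -/
noncomputable def dir (i : Fin 3) (f : D → ℝ) (x : D) : ℝ :=
  mfderiv 𝓘(ℝ, Model3) 𝓘(ℝ, ℝ) f x (E.field i x)

/-- Component `c_{ij} = c(E_i, E_j)` of a field of bilinear forms. -/
noncomputable def comp (c : BilinField D) (i j : Fin 3) (x : D) : ℝ :=
  c x (E.field i x) (E.field j x)

/-- `(D, h)` is flat: its Riemann tensor vanishes. -/
def SurfaceIsFlat : Prop :=
  ∀ d c a b x, riemannTensor E.dir (fun y => Matrix.of fun i j => E.comp h.inner i j y) d c a b x = 0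

end GaussianFrame

/-! ## Signature changing spacetimes -/

/-- A four-dimensional spacetime `(M, g)` with discontinuous signature change at the hypersurface
`(D, h)`, with `g = -η dt² + g_{ij}(t, x) dxⁱ dxʲ` and `g_{ij}(t, x)` real analytic in `(t, x)`.

Every point of `M` is given by its signed distance `t` from the hypersurface and by the foot `x` in
`D` of the geodesic normal to the hypersurface through that point.  So `M` is an open neighbourhood
of `{0} × D` in `ℝ × D`, whose intersection with each normal line `ℝ × {x}` is an interval. -/
structure SignatureChangingSpacetime (h : AnalyticMetric D) where
  /-- the set of points of `M` -/
  carrier : Set (ℝ × D)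
  isOpen_carrier : IsOpen carrier
  zero_mem : ∀ x, (0, x) ∈ carrier
  ordConnected_fiber : ∀ x, Set.OrdConnected {t : ℝ | (t, x) ∈ carrier}
  /-- the one-parameter family of metrics `g_{ij}(t, ·) dxⁱ dxʲ` -/
  spatial : ℝ → BilinField D
  spatial_symm : ∀ t x, (t, x) ∈ carrier → ∀ u v, spatial t x u v = spatial t x v u
  spatial_pos : ∀ t x, (t, x) ∈ carrier → ∀ u, u ≠ 0 → 0 < spatial t x u u
  spatial_analytic :
    ContMDiffOn (𝓘(ℝ, ℝ).prod 𝓘(ℝ, Model3))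
      (𝓘(ℝ, Model3).prod 𝓘(ℝ, Model3 →L[ℝ] Model3 →L[ℝ] ℝ)) ω
      (fun p : ℝ × D => (TotalSpace.mk' (Model3 →L[ℝ] Model3 →L[ℝ] ℝ) p.2 (spatial p.1 p.2) :
        TotalSpace (Model3 →L[ℝ] Model3 →L[ℝ] ℝ)
          (fun x : D => TangentSpace 𝓘(ℝ, Model3) x →L[ℝ] TangentSpace 𝓘(ℝ, Model3) x →L[ℝ] ℝ)))
      carrier
  spatial_zero : ∀ x, spatial 0 x = h.inner x

/-- The sign `η`: `1` in the Lorentzian region `t > 0`, `-1` in the Riemannian region `t < 0`. -/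
noncomputable def signatureSign (t : ℝ) : ℝ := if 0 < t then 1 else -1

namespace SignatureChangingSpacetime

variable {h : AnalyticMetric D} (M : SignatureChangingSpacetime h)

/-- The spacetime metric `g = -η dt² + g_{ij} dxⁱ dxʲ` on tangent vectors
`u = u.1 ∂_t + u.2` at `p = (t, x)`; it plays a role only for `t ≠ 0`. -/
noncomputable def metric (p : ℝ × D) (u v : ℝ × TangentSpace 𝓘(ℝ, Model3) p.2) : ℝ :=
  -signatureSign p.1 * (u.1 * v.1) + M.spatial p.1 p.2 u.2 v.2

/-- The frame `∂_t, E_1, E_2, E_3` of the spacetime. -/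
noncomputable def frameVec (E : GaussianFrame h) (a : Fin 4) (p : ℝ × D) :
    ℝ × TangentSpace 𝓘(ℝ, Model3) p.2 :=
  Fin.cases (1, 0) (fun i => (0, E.field i p.2)) a

/-- Derivatives of functions along `∂_t, E_1, E_2, E_3`. -/
noncomputable def frameDir (E : GaussianFrame h) (a : Fin 4) (f : ℝ × D → ℝ) (p : ℝ × D) : ℝ :=
  Fin.cases (deriv (fun t => f (t, p.2)) p.1) (fun i => E.dir i (fun x => f (p.1, x)) p.2) a

/-- Gram matrix of the spacetime metric in the frame `∂_t, E_1, E_2, E_3`. -/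
noncomputable def gram (E : GaussianFrame h) (p : ℝ × D) : Matrix (Fin 4) (Fin 4) ℝ :=
  Matrix.of fun a b => M.metric p (frameVec E a p) (frameVec E b p)

/-- `(M, g)` is a vacuum spacetime: `Ric = 0` off the hypersurface of signature change. -/
def IsVacuum (E : GaussianFrame h) : Prop :=
  ∀ p ∈ M.carrier, p.1 ≠ 0 → ∀ a b, ricciTensor (frameDir E) (M.gram E) a b p = 0

/-- `(M, g)` is flat: the Riemann tensor vanishes off the hypersurface of signature change. -/
def IsFlat (E : GaussianFrame h) : Prop :=
  ∀ p ∈ M.carrier, p.1 ≠ 0 → ∀ d c a b, riemannTensor (frameDir E) (M.gram E) d c a b p = 0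

/-- The derivative of `g_{ij}(t, x)` with respect to `t` at `t = 0` is `c`. -/
def HasVelocity (c : BilinField D) : Prop :=
  ∀ x u v, HasDerivAt (fun t => M.spatial t x u v) (c x u v) 0

end SignatureChangingSpacetime

end Surface

/-! The vacuum equations with sign `1` (for `t > 0`) and with sign `-1` (for `t < 0`) concern one
and the same family of slice metrics `γ(t)`, which is analytic across `t = 0`. By the identity
theorem on the normal lines, each system therefore holds on all of `M`. In the spatial Ricci
components (`BlockMetric.ricci_succ_succ`) the sign multiplies only the terms that contain time
derivatives. So the intrinsic Ricci tensor of every slice and the evolution terms vanish separately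
(`IsVacuum.spatial_and_evolution`).

For the Weingarten map `W = ½ γ⁻¹ γ'` the evolution terms give `W' = -(tr W) W`, which integrates to
`(1 + K t) W = ½ c` with `K = ½ tr c` (`IsVacuum.weingarten_eq`). As `c` is diagonal, `γ` stays
diagonal, `γᵢᵢ = exp (2 φᵢ)`, with `(1 + K t) ∂_t φᵢ = κᵢ = ½ cᵢ` (`IsVacuum.exists_slicesData`).

A Ricci flat metric in dimension three is flat. The curvature of the slices, expanded to order `t²`
at the hypersurface, together with the Hamiltonian and momentum constraints yields a differential
system for the `κᵢ` alone (`SlicesData.isChangeSurface`). Algebraic elimination gives `Eᵢ κⱼ = 0`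
for `i ≠ j` (`IsChangeSurface.dir_offdiag_eq_zero`). If moreover every `Eᵢ κᵢ` vanishes, the `κᵢ`
are constant on the connected `D`. If some `Eᵢ κᵢ` is nonzero at a point, the derivative of `κ₁κ₂ +
κ₂κ₃ + κ₃κ₁ = 0` forces the other two eigenvalues to vanish near this point, hence everywhere
(`IsChangeSurface.const_or_vanish`).

Conversely, constant `κᵢ` are realised by the Kasner slices `∑ (1 + K t) ^ (2 κᵢ / K) (dxⁱ)²`, and a
single eigenvalue depending on `xⁱ` by the flat metric with the coefficient `(1 + κᵢ t)²` at
`(dxⁱ)²`.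

Flatness forces the Riccati equations `φᵢ'' + (φᵢ')² = 0`, that is `κᵢ² = K κᵢ`; with the
Hamiltonian constraint all products `κᵢ κⱼ`, `i ≠ j`, vanish. If two eigenvalues vanish, the
evolution equation turns any vacuum solution into the flat planar metric.

Curvature is computed in an abstract algebra of functions with commuting derivations
(`FrameCalculus`), so that the same rules serve `M` and `D`. -/

open scoped Topology
open Set Filter

/-! ### Frame fields of `D` in a chart -/

section ChartCalculus

variable {D : Type*} [TopologicalSpace D] [ChartedSpace Model3 D] [IsManifold 𝓘(ℝ, Model3) ω D]
  {h : AnalyticMetric D}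

namespace GaussianFrame

/-- The `i`-th frame field read in the preferred chart around `x₀`. -/
noncomputable def chartField (E : GaussianFrame h) (x₀ : D) (i : Fin 3) : Model3 → Model3 :=
  VectorField.mpullbackWithin 𝓘(ℝ, Model3) 𝓘(ℝ, Model3) (extChartAt 𝓘(ℝ, Model3) x₀).symm
    (E.field i) (range 𝓘(ℝ, Model3))

theorem contDiffAt_chartField (E : GaussianFrame h) (x₀ : D) (i : Fin 3) :
    ContDiffAt ℝ ω (E.chartField x₀ i) (extChartAt 𝓘(ℝ, Model3) x₀ x₀) := by
  have h1 := VectorField.contMDiffWithinAt_mpullbackWithin_extChartAt_symm (I := 𝓘(ℝ, Model3)) (n := ω)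
    (m := ω) (s := univ) (x := x₀) (E.analytic i x₀).contMDiffWithinAt uniqueMDiffOn_univ
    (mem_univ _) le_top
  have h2 : ContMDiffAt 𝓘(ℝ, Model3) 𝓘(ℝ, Model3).tangent ω
      (fun y => (⟨y, E.chartField x₀ i y⟩ : TangentBundle 𝓘(ℝ, Model3) Model3))
      (extChartAt 𝓘(ℝ, Model3) x₀ x₀) := by
    refine h1.contMDiffAt ?_
    simpa using extChartAt_target_mem_nhds (I := 𝓘(ℝ, Model3)) x₀
  have h3 := (contMDiff_snd_tangentBundle_modelSpace Model3 𝓘(ℝ, Model3) (n := ω)).contMDiffAt.comp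
    _ h2
  exact h3.contDiffAt

/-- At the centre of the chart the manifold bracket is the pullback of the bracket in the chart
under the differential of the chart. That differential is invertible, so vanishing passes to the
chart. -/
theorem lieBracket_chartField (E : GaussianFrame h) (x₀ : D) (i j : Fin 3) :
    VectorField.lieBracket ℝ (E.chartField x₀ i) (E.chartField x₀ j)
      (extChartAt 𝓘(ℝ, Model3) x₀ x₀) = 0 := by
  have h1 := E.commute i j x₀
  rw [← VectorField.mlieBracketWithin_univ, VectorField.mlieBracketWithin_apply] at h1
  have h2 := (isInvertible_mfderiv_extChartAt (I := 𝓘(ℝ, Model3))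
    (mem_extChartAt_source (I := 𝓘(ℝ, Model3)) x₀))
  obtain ⟨e, he⟩ := h2
  rw [← he, ContinuousLinearMap.inverse_equiv] at h1
  have h3 := e.symm.injective (h1.trans (map_zero e.symm).symm)
  rw [← VectorField.lieBracketWithin_univ]
  simp only [mfld_simps] at h3
  simp only [chartField, mfld_simps]
  exact h3

/-- The chain rule for `f` composed with the inverse chart. The point `z` ranges over the whole
chart domain, while the chart stays that of `x₀`, so that the identity can be differentiated again.
-/
theorem dir_eq_fderiv (E : GaussianFrame h) (x₀ : D) (i : Fin 3) (f : D → ℝ) {z : D}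
    (hz : z ∈ (extChartAt 𝓘(ℝ, Model3) x₀).source)
    (hf : MDifferentiableAt 𝓘(ℝ, Model3) 𝓘(ℝ, ℝ) f z) :
    E.dir i f z = fderiv ℝ (fun y => f ((extChartAt 𝓘(ℝ, Model3) x₀).symm y))
      (extChartAt 𝓘(ℝ, Model3) x₀ z) (E.chartField x₀ i (extChartAt 𝓘(ℝ, Model3) x₀ z)) := by
  set ξ := extChartAt 𝓘(ℝ, Model3) x₀ with hξ
  have hinv := isInvertible_mfderivWithin_extChartAt_symm (I := 𝓘(ℝ, Model3))
    (ξ.map_source hz)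
  have hl : ξ.symm (ξ z) = z := ξ.left_inv hz
  have hd := mdifferentiableWithinAt_extChartAt_symm (I := 𝓘(ℝ, Model3)) (ξ.map_source hz)
  have hf' : MDifferentiableAt 𝓘(ℝ, Model3) 𝓘(ℝ, ℝ) f (ξ.symm (ξ z)) := by rwa [hl]
  have hcomp := mfderiv_comp_mfderivWithin (I := 𝓘(ℝ, Model3)) (I' := 𝓘(ℝ, Model3))
    (I'' := 𝓘(ℝ, ℝ)) (g := f) (f := ξ.symm) (x := ξ z) hf' hd
    (by simpa using uniqueMDiffWithinAt_univ 𝓘(ℝ, Model3))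
  have key : E.field i (ξ.symm (ξ z)) = (mfderivWithin 𝓘(ℝ, Model3) 𝓘(ℝ, Model3) ξ.symm
      (range 𝓘(ℝ, Model3)) (ξ z)) (E.chartField x₀ i (ξ z)) := by
    rw [chartField, VectorField.mpullbackWithin_apply]
    obtain ⟨e, he⟩ := hinv
    rw [← he, ContinuousLinearMap.inverse_equiv]
    exact (e.apply_symm_apply _).symm
  have h4 : E.dir i f z = mfderiv 𝓘(ℝ, Model3) 𝓘(ℝ, ℝ) f (ξ.symm (ξ z))
      (E.field i (ξ.symm (ξ z))) := by
    rw [hl]; rfl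
  rw [h4, key]
  have h5 := congrArg (fun L => L (E.chartField x₀ i (ξ z))) hcomp
  refine h5.symm.trans ?_
  simp [Function.comp_def]
  rfl

end GaussianFrame
end ChartCalculus

/-! ### Frame derivatives on `ℝ × D` in a chart -/

section SpacetimeCalculus

variable {D : Type*} [TopologicalSpace D] [ChartedSpace Model3 D] [IsManifold 𝓘(ℝ, Model3) ω D]
  {h : AnalyticMetric D}

/-- A function on `ℝ × D` read in the preferred chart of `D` around `x₀`. -/
noncomputable def chartRead (x₀ : D) (f : ℝ × D → ℝ) (q : ℝ × Model3) : ℝ :=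
  f (q.1, (extChartAt 𝓘(ℝ, Model3) x₀).symm q.2)

theorem ContMDiffAt.contDiffAt_chartRead {f : ℝ × D → ℝ} {t : ℝ} {x₀ z : D}
    (hz : z ∈ (extChartAt 𝓘(ℝ, Model3) x₀).source)
    (hf : ContMDiffAt (𝓘(ℝ, ℝ).prod 𝓘(ℝ, Model3)) 𝓘(ℝ, ℝ) ω f (t, z)) :
    ContDiffAt ℝ ω (chartRead x₀ f) (t, extChartAt 𝓘(ℝ, Model3) x₀ z) := by
  set ξ := extChartAt 𝓘(ℝ, Model3) x₀ with hξ
  have h1 : ContMDiffAt 𝓘(ℝ, Model3) 𝓘(ℝ, Model3) ω ξ.symm (ξ z) :=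
    (contMDiffOn_extChartAt_symm (I := 𝓘(ℝ, Model3)) x₀).contMDiffAt
      ((isOpen_extChartAt_target x₀).mem_nhds (ξ.map_source hz))
  have h2 : ContMDiffAt 𝓘(ℝ, ℝ × Model3) (𝓘(ℝ, ℝ).prod 𝓘(ℝ, Model3)) ω
      (fun q : ℝ × Model3 => (q.1, ξ.symm q.2)) (t, ξ z) := by
    refine ContMDiffAt.prodMk contDiffAt_fst.contMDiffAt ?_
    exact ContMDiffAt.comp (t, ξ z) (g := ξ.symm) (f := Prod.snd) h1
      contDiffAt_snd.contMDiffAt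
  have h3 : ContMDiffAt 𝓘(ℝ, ℝ × Model3) 𝓘(ℝ, ℝ) ω (chartRead x₀ f) (t, ξ z) := by
    refine ContMDiffAt.comp (t, ξ z) (g := f) (f := fun q : ℝ × Model3 => (q.1, ξ.symm q.2)) ?_ h2
    simpa [ξ.left_inv hz] using hf
  exact h3.contDiffAt

theorem ContDiffAt.contMDiffAt_of_chart {f : ℝ × D → ℝ} {G : ℝ × Model3 → ℝ} {t : ℝ} {x₀ z : D}
    (hz : z ∈ (extChartAt 𝓘(ℝ, Model3) x₀).source)
    (hG : ContDiffAt ℝ ω G (t, extChartAt 𝓘(ℝ, Model3) x₀ z))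
    (hfG : ∀ᶠ p in 𝓝 (t, z), f p = G (p.1, extChartAt 𝓘(ℝ, Model3) x₀ p.2)) :
    ContMDiffAt (𝓘(ℝ, ℝ).prod 𝓘(ℝ, Model3)) 𝓘(ℝ, ℝ) ω f (t, z) := by
  set ξ := extChartAt 𝓘(ℝ, Model3) x₀ with hξ
  have h1 : ContMDiffAt 𝓘(ℝ, Model3) 𝓘(ℝ, Model3) ω ξ z :=
    contMDiffAt_extChartAt' (by simpa [hξ] using hz)
  have h2 : ContMDiffAt (𝓘(ℝ, ℝ).prod 𝓘(ℝ, Model3)) 𝓘(ℝ, ℝ × Model3) ω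
      (fun p : ℝ × D => (p.1, ξ p.2)) (t, z) := by
    refine ContMDiffAt.prodMk_space contMDiffAt_fst ?_
    exact ContMDiffAt.comp (t, z) (g := ξ) (f := Prod.snd) h1 contMDiffAt_snd
  have h3 := ContMDiffAt.comp (t, z) (g := G) (f := fun p : ℝ × D => (p.1, ξ p.2))
    hG.contMDiffAt h2
  exact h3.congr_of_eventuallyEq hfG

namespace SignatureChangingSpacetime

/-- The fields `∂_t, E_1, E_2, E_3` read in the preferred chart of `D` around `x₀`. -/
noncomputable def chartFrame (E : GaussianFrame h) (x₀ : D) (a : Fin 4) (q : ℝ × Model3) :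
    ℝ × Model3 :=
  Fin.cases (1, 0) (fun i => (0, E.chartField x₀ i q.2)) a

theorem contDiffAt_chartFrame (E : GaussianFrame h) (x₀ : D) (a : Fin 4) (t : ℝ) :
    ContDiffAt ℝ ω (chartFrame E x₀ a) (t, extChartAt 𝓘(ℝ, Model3) x₀ x₀) := by
  refine Fin.cases ?_ (fun i => ?_) a
  · exact contDiffAt_const
  · exact contDiffAt_const.prodMk
      (ContDiffAt.comp (t, extChartAt 𝓘(ℝ, Model3) x₀ x₀) (g := E.chartField x₀ i)
        (f := Prod.snd) (E.contDiffAt_chartField x₀ i) contDiffAt_snd)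

/-- Both `∂_t` and the `Eᵢ` are defined through partial functions; joint differentiability makes
them directional derivatives of one function on `ℝ × Model3`. -/
theorem frameDir_eq_fderiv (E : GaussianFrame h) (x₀ : D) (a : Fin 4) {f : ℝ × D → ℝ} {t : ℝ}
    {z : D} (hz : z ∈ (extChartAt 𝓘(ℝ, Model3) x₀).source)
    (hf : ContMDiffAt (𝓘(ℝ, ℝ).prod 𝓘(ℝ, Model3)) 𝓘(ℝ, ℝ) ω f (t, z)) :
    frameDir E a f (t, z) = fderiv ℝ (chartRead x₀ f) (t, extChartAt 𝓘(ℝ, Model3) x₀ z)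
      (chartFrame E x₀ a (t, extChartAt 𝓘(ℝ, Model3) x₀ z)) := by
  set ξ := extChartAt 𝓘(ℝ, Model3) x₀ with hξ
  have hF := hf.contDiffAt_chartRead hz
  have hd : DifferentiableAt ℝ (chartRead x₀ f) (t, ξ z) := hF.differentiableAt (by simp)
  refine Fin.cases ?_ (fun i => ?_) a
  · have h1 : HasDerivAt (fun s : ℝ => (s, ξ z)) ((1 : ℝ), (0 : Model3)) t :=
      (hasDerivAt_id t).prodMk (hasDerivAt_const t _)
    have h2 := hd.hasFDerivAt.comp_hasDerivAt t h1
    have h3 : (chartRead x₀ f ∘ fun s : ℝ => (s, ξ z)) = fun s => f (s, z) := by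
      funext s
      change f (s, ξ.symm (ξ z)) = _
      rw [ξ.left_inv hz]
    rw [h3] at h2
    exact h2.deriv
  · have h1 : HasFDerivAt (fun y : Model3 => (t, y)) (ContinuousLinearMap.inr ℝ ℝ Model3) (ξ z) :=
      hasFDerivAt_prodMk_right t (ξ z)
    have h2 := (hd.hasFDerivAt.comp (ξ z) h1).fderiv
    have h3 : MDifferentiableAt 𝓘(ℝ, Model3) 𝓘(ℝ, ℝ) (fun x => f (t, x)) z := by
      have h4 : ContMDiffAt 𝓘(ℝ, Model3) 𝓘(ℝ, ℝ) ω (fun x => f (t, x)) z :=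
        ContMDiffAt.comp z (g := f) (f := fun x => (t, x)) hf
          (contMDiffAt_const.prodMk contMDiffAt_id)
      exact h4.mdifferentiableAt (by simp)
    have h5 := E.dir_eq_fderiv x₀ i (fun x => f (t, x)) hz h3
    refine h5.trans ?_
    have h6 := congrArg (fun L => L (E.chartField x₀ i (ξ z))) h2
    refine (Eq.trans ?_ h6).trans ?_
    · rfl
    · simp [chartFrame]

end SignatureChangingSpacetime
end SpacetimeCalculus

/-- The operators `d a` are commuting derivations, on the open set `Ω`, of an algebra of functions
that is stable under composition with analytic functions of one variable. -/
structure FrameCalculus {P ι : Type*} (Ω : Set P) (S : (P → ℝ) → Prop)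
    (d : ι → (P → ℝ) → P → ℝ) : Prop where
  const : ∀ r : ℝ, S (fun _ => r)
  add : ∀ {f g}, S f → S g → S (fun p => f p + g p)
  mul : ∀ {f g}, S f → S g → S (fun p => f p * g p)
  comp : ∀ {φ : ℝ → ℝ} {f}, S f → (∀ p ∈ Ω, AnalyticAt ℝ φ (f p)) → S (fun p => φ (f p))
  congr : ∀ {f g}, S f → (∀ p ∈ Ω, g p = f p) → S g
  dir : ∀ a {f}, S f → S (d a f)
  dir_congr : ∀ a {f g}, (∀ p ∈ Ω, f p = g p) → ∀ p ∈ Ω, d a f p = d a g p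
  dir_const : ∀ a (r : ℝ), ∀ p ∈ Ω, d a (fun _ => r) p = 0
  dir_add : ∀ a {f g}, S f → S g → ∀ p ∈ Ω, d a (fun q => f q + g q) p = d a f p + d a g p
  dir_mul : ∀ a {f g}, S f → S g → ∀ p ∈ Ω,
    d a (fun q => f q * g q) p = d a f p * g p + f p * d a g p
  dir_comp : ∀ a {φ : ℝ → ℝ} {f}, S f → ∀ p ∈ Ω, AnalyticAt ℝ φ (f p) →
    d a (fun q => φ (f q)) p = deriv φ (f p) * d a f p
  dir_comm : ∀ a b {f}, S f → ∀ p ∈ Ω, d a (d b f) p = d b (d a f) p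

/-! ### The frame derivatives are commuting derivations of the analytic functions -/

section SpacetimeCalculus

variable {D : Type*} [TopologicalSpace D] [ChartedSpace Model3 D] [IsManifold 𝓘(ℝ, Model3) ω D]
  {h : AnalyticMetric D}

/-- Real analytic functions on a set `Ω` of points of `ℝ × D`. -/
def AnalyticOnSet (Ω : Set (ℝ × D)) (f : ℝ × D → ℝ) : Prop :=
  ∀ p ∈ Ω, ContMDiffAt (𝓘(ℝ, ℝ).prod 𝓘(ℝ, Model3)) 𝓘(ℝ, ℝ) ω f p

namespace SignatureChangingSpacetime

theorem frameDir_congr_of_eventuallyEq (E : GaussianFrame h) (a : Fin 4) {f g : ℝ × D → ℝ}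
    {p : ℝ × D} (hfg : f =ᶠ[𝓝 p] g) : frameDir E a f p = frameDir E a g p := by
  obtain ⟨t, x⟩ := p
  refine Fin.cases ?_ (fun i => ?_) a
  · have h1 : Tendsto (fun s : ℝ => (s, x)) (𝓝 t) (𝓝 (t, x)) :=
      (Continuous.prodMk_left x).tendsto t
    exact Filter.EventuallyEq.deriv_eq (h1.eventually hfg)
  · have h1 : Tendsto (fun y : D => (t, y)) (𝓝 x) (𝓝 (t, x)) :=
      (Continuous.prodMk_right t).tendsto x
    have h2 : (fun y => f (t, y)) =ᶠ[𝓝 x] fun y => g (t, y) := h1.eventually hfg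
    have h3 : mfderiv 𝓘(ℝ, Model3) 𝓘(ℝ, ℝ) (fun y => f (t, y)) x =
        mfderiv 𝓘(ℝ, Model3) 𝓘(ℝ, ℝ) (fun y => g (t, y)) x := h2.mfderiv_eq
    exact congrArg (fun L => L (E.field i x)) h3

theorem eventually_frameDir_eq_fderiv (E : GaussianFrame h) (a : Fin 4) {f : ℝ × D → ℝ} {t : ℝ}
    {x : D} (hf : ContMDiffAt (𝓘(ℝ, ℝ).prod 𝓘(ℝ, Model3)) 𝓘(ℝ, ℝ) ω f (t, x)) :
    ∀ᶠ p in 𝓝 (t, x), frameDir E a f p =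
      (fun q => fderiv ℝ (chartRead x f) q (chartFrame E x a q))
        (p.1, extChartAt 𝓘(ℝ, Model3) x p.2) := by
  have h1 : ∀ᶠ p in 𝓝 (t, x), ContMDiffAt (𝓘(ℝ, ℝ).prod 𝓘(ℝ, Model3)) 𝓘(ℝ, ℝ) ω f p :=
    (contMDiffAt_iff_contMDiffAt_nhds (by simp)).1 hf
  have h2 : ∀ᶠ p : ℝ × D in 𝓝 (t, x), p.2 ∈ (extChartAt 𝓘(ℝ, Model3) x).source :=
    continuous_snd.continuousAt.eventually (extChartAt_source_mem_nhds (I := 𝓘(ℝ, Model3)) x)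
  filter_upwards [h1, h2] with p hp1 hp2
  exact frameDir_eq_fderiv E x a (t := p.1) (z := p.2) hp2 hp1

theorem contDiffAt_fderiv_chartFrame (E : GaussianFrame h) (a : Fin 4) {f : ℝ × D → ℝ} {t : ℝ}
    {x : D} (hf : ContMDiffAt (𝓘(ℝ, ℝ).prod 𝓘(ℝ, Model3)) 𝓘(ℝ, ℝ) ω f (t, x)) :
    ContDiffAt ℝ ω (fun q => fderiv ℝ (chartRead x f) q (chartFrame E x a q))
      (t, extChartAt 𝓘(ℝ, Model3) x x) := by
  have hF := hf.contDiffAt_chartRead (mem_extChartAt_source (I := 𝓘(ℝ, Model3)) x)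
  exact (hF.fderiv_right (m := ω) (by simp)).clm_apply (contDiffAt_chartFrame E x a t)

theorem contMDiffAt_frameDir (E : GaussianFrame h) (a : Fin 4) {f : ℝ × D → ℝ} {p : ℝ × D}
    (hf : ContMDiffAt (𝓘(ℝ, ℝ).prod 𝓘(ℝ, Model3)) 𝓘(ℝ, ℝ) ω f p) :
    ContMDiffAt (𝓘(ℝ, ℝ).prod 𝓘(ℝ, Model3)) 𝓘(ℝ, ℝ) ω (frameDir E a f) p :=
  (contDiffAt_fderiv_chartFrame E a (t := p.1) (x := p.2) hf).contMDiffAt_of_chart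
    (mem_extChartAt_source (I := 𝓘(ℝ, Model3)) p.2)
    (eventually_frameDir_eq_fderiv E a (t := p.1) (x := p.2) hf)

theorem chartRead_frameDir_eventuallyEq (E : GaussianFrame h) (a : Fin 4) {f : ℝ × D → ℝ} {t : ℝ}
    {x : D} (hf : ContMDiffAt (𝓘(ℝ, ℝ).prod 𝓘(ℝ, Model3)) 𝓘(ℝ, ℝ) ω f (t, x)) :
    chartRead x (frameDir E a f) =ᶠ[𝓝 (t, extChartAt 𝓘(ℝ, Model3) x x)]
      fun q => fderiv ℝ (chartRead x f) q (chartFrame E x a q) := by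
  have h1 := eventually_frameDir_eq_fderiv E a hf
  have h2 : Tendsto (fun q : ℝ × Model3 => (q.1, (extChartAt 𝓘(ℝ, Model3) x).symm q.2))
      (𝓝 (t, extChartAt 𝓘(ℝ, Model3) x x)) (𝓝 (t, x)) := by
    have h3 := continuousAt_extChartAt_symm (I := 𝓘(ℝ, Model3)) x
    have h4 : ContinuousAt (fun q : ℝ × Model3 => (q.1, (extChartAt 𝓘(ℝ, Model3) x).symm q.2))
        (t, extChartAt 𝓘(ℝ, Model3) x x) :=
      continuousAt_fst.prodMk (ContinuousAt.comp (g := (extChartAt 𝓘(ℝ, Model3) x).symm)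
        (f := Prod.snd) h3 continuousAt_snd)
    have h5 := h4.tendsto
    rwa [extChartAt_to_inv] at h5
  have h6 : ∀ᶠ q : ℝ × Model3 in 𝓝 (t, extChartAt 𝓘(ℝ, Model3) x x),
      q.2 ∈ (extChartAt 𝓘(ℝ, Model3) x).target :=
    continuous_snd.continuousAt.eventually (extChartAt_target_mem_nhds (I := 𝓘(ℝ, Model3)) x)
  filter_upwards [h2.eventually h1, h6] with q hq1 hq2
  have h7 := (extChartAt 𝓘(ℝ, Model3) x).right_inv hq2
  simp only [h7] at hq1
  exact hq1

/-- The field `∂_t` is constant in the chart, the `Eᵢ` do not depend on `t`, and the brackets of the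
`Eᵢ` vanish by `lieBracket_chartField`. -/
theorem fderiv_chartFrame_comm (E : GaussianFrame h) (x : D) (t : ℝ) (a b : Fin 4) :
    fderiv ℝ (chartFrame E x a) (t, extChartAt 𝓘(ℝ, Model3) x x)
        (chartFrame E x b (t, extChartAt 𝓘(ℝ, Model3) x x)) =
      fderiv ℝ (chartFrame E x b) (t, extChartAt 𝓘(ℝ, Model3) x x)
        (chartFrame E x a (t, extChartAt 𝓘(ℝ, Model3) x x)) := by
  set y := extChartAt 𝓘(ℝ, Model3) x x with hy
  have h0 : fderiv ℝ (chartFrame E x 0) (t, y) = 0 :=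
    (hasFDerivAt_const ((1 : ℝ), (0 : Model3)) (t, y)).fderiv
  have hs : ∀ i : Fin 3, ∀ v : ℝ × Model3, fderiv ℝ (chartFrame E x i.succ) (t, y) v =
      (0, fderiv ℝ (E.chartField x i) y v.2) := by
    intro i v
    have h1 : HasFDerivAt (E.chartField x i) (fderiv ℝ (E.chartField x i) y) (t, y).2 :=
      ((E.contDiffAt_chartField x i).differentiableAt (by simp)).hasFDerivAt
    have h2 := (hasFDerivAt_const (0 : ℝ) (t, y)).prodMk (h1.comp (t, y) hasFDerivAt_snd)
    have h3 : fderiv ℝ (chartFrame E x i.succ) (t, y) = _ := h2.fderiv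
    rw [h3]; rfl
  refine Fin.cases ?_ (fun i => ?_) a <;> refine Fin.cases ?_ (fun j => ?_) b
  · rfl
  · rw [h0, hs]; simp [chartFrame]; rfl
  · rw [h0, hs]; simp [chartFrame]
  · have h4 := E.lieBracket_chartField x i j
    rw [VectorField.lieBracket, sub_eq_zero] at h4
    rw [hs, hs]
    exact congrArg (Prod.mk (0 : ℝ)) h4.symm

/-- In the chart a second frame derivative is the Hessian of `f` on the two fields plus `df` applied
to the derivative of one field along the other. The Hessian is symmetric and the fields commute, so
neither term depends on the order. -/
theorem frameDir_comm (E : GaussianFrame h) (a b : Fin 4) {f : ℝ × D → ℝ} {p : ℝ × D}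
    (hf : ContMDiffAt (𝓘(ℝ, ℝ).prod 𝓘(ℝ, Model3)) 𝓘(ℝ, ℝ) ω f p) :
    frameDir E a (frameDir E b f) p = frameDir E b (frameDir E a f) p := by
  obtain ⟨t, x⟩ := p
  set y := extChartAt 𝓘(ℝ, Model3) x x with hy
  have hF := hf.contDiffAt_chartRead (mem_extChartAt_source (I := 𝓘(ℝ, Model3)) x)
  have hF2 : DifferentiableAt ℝ (fderiv ℝ (chartRead x f)) (t, y) :=
    (hF.fderiv_right (m := ω) (by simp)).differentiableAt (by simp)
  have key : ∀ a b, frameDir E a (frameDir E b f) (t, x) =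
      fderiv ℝ (fderiv ℝ (chartRead x f)) (t, y) (chartFrame E x a (t, y))
          (chartFrame E x b (t, y)) +
        fderiv ℝ (chartRead x f) (t, y)
          (fderiv ℝ (chartFrame E x b) (t, y) (chartFrame E x a (t, y))) := by
    intro a b
    rw [frameDir_eq_fderiv E x a (mem_extChartAt_source (I := 𝓘(ℝ, Model3)) x)
      (contMDiffAt_frameDir E b hf), (chartRead_frameDir_eventuallyEq E b hf).fderiv_eq]
    have hW : DifferentiableAt ℝ (chartFrame E x b) (t, y) :=
      (contDiffAt_chartFrame E x b t).differentiableAt (by simp)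
    rw [(hF2.hasFDerivAt.clm_apply hW.hasFDerivAt).fderiv]
    simp [add_comm]
    rfl
  have hsym : IsSymmSndFDerivAt ℝ (chartRead x f) (t, y) := hF.isSymmSndFDerivAt (by simp)
  rw [key, key, hsym.eq, fderiv_chartFrame_comm]

theorem frameCalculus (E : GaussianFrame h) {Ω : Set (ℝ × D)} (hΩ : IsOpen Ω) :
    FrameCalculus Ω (AnalyticOnSet Ω) (frameDir E) := by
  have hdiff : ∀ {f : ℝ × D → ℝ} {t : ℝ} {x : D},
      ContMDiffAt (𝓘(ℝ, ℝ).prod 𝓘(ℝ, Model3)) 𝓘(ℝ, ℝ) ω f (t, x) →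
      DifferentiableAt ℝ (chartRead x f) (t, extChartAt 𝓘(ℝ, Model3) x x) := fun hf =>
    (hf.contDiffAt_chartRead (mem_extChartAt_source (I := 𝓘(ℝ, Model3)) _)).differentiableAt
      (by simp)
  have hmem := fun x : D => mem_extChartAt_source (I := 𝓘(ℝ, Model3)) x
  have hcomp : ∀ {φ : ℝ → ℝ} {f : ℝ × D → ℝ} {p : ℝ × D},
      ContMDiffAt (𝓘(ℝ, ℝ).prod 𝓘(ℝ, Model3)) 𝓘(ℝ, ℝ) ω f p → AnalyticAt ℝ φ (f p) →
      ContMDiffAt (𝓘(ℝ, ℝ).prod 𝓘(ℝ, Model3)) 𝓘(ℝ, ℝ) ω (fun p => φ (f p)) p := by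
    intro φ f p hf hφ
    exact ContMDiffAt.comp p (g := φ) hφ.contDiffAt.contMDiffAt hf
  exact
  { const := fun r p _ => contMDiffAt_const
    add := fun hf hg p hp => (hf p hp).add (hg p hp)
    mul := fun hf hg p hp => (hf p hp).mul (hg p hp)
    comp := fun hf hφ p hp => hcomp (hf p hp) (hφ p hp)
    congr := fun hf hfg p hp =>
      (hf p hp).congr_of_eventuallyEq (by filter_upwards [hΩ.mem_nhds hp] with q hq using hfg q hq)
    dir := fun a f hf p hp => contMDiffAt_frameDir E a (hf p hp)
    dir_congr := fun a f g hfg p hp => frameDir_congr_of_eventuallyEq E a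
      (by filter_upwards [hΩ.mem_nhds hp] with q hq using hfg q hq)
    dir_const := by
      rintro a r ⟨t, x⟩ hp
      rw [frameDir_eq_fderiv E x a (hmem x) contMDiffAt_const]
      have : chartRead x (fun _ : ℝ × D => r) = fun _ => r := rfl
      rw [this]; simp
    dir_add := by
      rintro a f g hf hg ⟨t, x⟩ hp
      rw [frameDir_eq_fderiv E x a (f := fun q => f q + g q) (hmem x) ((hf _ hp).add (hg _ hp)),
        frameDir_eq_fderiv E x a (hmem x) (hf _ hp),
        frameDir_eq_fderiv E x a (hmem x) (hg _ hp)]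
      have h1 := ((hdiff (hf _ hp)).hasFDerivAt.add (hdiff (hg _ hp)).hasFDerivAt).fderiv
      exact congrArg (fun L : (ℝ × Model3) →L[ℝ] ℝ =>
        L (chartFrame E x a (t, extChartAt 𝓘(ℝ, Model3) x x))) h1
    dir_mul := by
      rintro a f g hf hg ⟨t, x⟩ hp
      rw [frameDir_eq_fderiv E x a (f := fun q => f q * g q) (hmem x) ((hf _ hp).mul (hg _ hp)),
        frameDir_eq_fderiv E x a (hmem x) (hf _ hp),
        frameDir_eq_fderiv E x a (hmem x) (hg _ hp)]
      have h1 := ((hdiff (hf _ hp)).hasFDerivAt.mul (hdiff (hg _ hp)).hasFDerivAt).fderiv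
      refine (congrArg (fun L : (ℝ × Model3) →L[ℝ] ℝ =>
        L (chartFrame E x a (t, extChartAt 𝓘(ℝ, Model3) x x))) h1).trans ?_
      simp [chartRead]
      ring
    dir_comp := by
      rintro a φ f hf ⟨t, x⟩ hp hφ
      rw [frameDir_eq_fderiv E x a (hmem x) (hcomp (hf _ hp) hφ),
        frameDir_eq_fderiv E x a (hmem x) (hf _ hp)]
      have h0 : chartRead x f (t, extChartAt 𝓘(ℝ, Model3) x x) = f (t, x) := by
        rw [chartRead, extChartAt_to_inv]
      have h1 := (HasDerivAt.comp_hasFDerivAt (t, extChartAt 𝓘(ℝ, Model3) x x)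
        (h₂ := φ) (h₂' := deriv φ (f (t, x)))
        (by rw [h0]; exact hφ.differentiableAt.hasDerivAt) (hdiff (hf _ hp)).hasFDerivAt).fderiv
      exact congrArg (fun L : (ℝ × Model3) →L[ℝ] ℝ =>
        L (chartFrame E x a (t, extChartAt 𝓘(ℝ, Model3) x x))) h1
    dir_comm := fun a b f hf p hp => frameDir_comm E a b (hf p hp) }

end SignatureChangingSpacetime
end SpacetimeCalculus

/-! ### Rules of calculation in a frame calculus -/

namespace FrameCalculus

variable {P ι : Type*} {Ω : Set P} {S : (P → ℝ) → Prop} {d : ι → (P → ℝ) → P → ℝ}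
  (C : FrameCalculus Ω S d)
include C

theorem const_mul (r : ℝ) {f : P → ℝ} (hf : S f) : S (fun p => r * f p) := C.mul (C.const r) hf

theorem neg {f : P → ℝ} (hf : S f) : S (fun p => -f p) :=
  C.congr (C.const_mul (-1) hf) fun p _ => by ring

theorem sub {f g : P → ℝ} (hf : S f) (hg : S g) : S (fun p => f p - g p) :=
  C.congr (C.add hf (C.neg hg)) fun p _ => by ring

theorem sum {κ : Type*} (s : Finset κ) {f : κ → P → ℝ} (hf : ∀ i ∈ s, S (f i)) :
    S (fun p => ∑ i ∈ s, f i p) := by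
  classical
  induction s using Finset.induction_on with
  | empty => simpa using C.const 0
  | insert a s ha ih =>
    refine C.congr (C.add (hf a (Finset.mem_insert_self a s))
      (ih fun i hi => hf i (Finset.mem_insert_of_mem hi))) fun p _ => ?_
    rw [Finset.sum_insert ha]

theorem prod {κ : Type*} (s : Finset κ) {f : κ → P → ℝ} (hf : ∀ i ∈ s, S (f i)) :
    S (fun p => ∏ i ∈ s, f i p) := by
  classical
  induction s using Finset.induction_on with
  | empty => simpa using C.const 1
  | insert a s ha ih =>
    refine C.congr (C.mul (hf a (Finset.mem_insert_self a s))
      (ih fun i hi => hf i (Finset.mem_insert_of_mem hi))) fun p _ => ?_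
    rw [Finset.prod_insert ha]

theorem inv {f : P → ℝ} (hf : S f) (h0 : ∀ p ∈ Ω, f p ≠ 0) : S (fun p => (f p)⁻¹) :=
  C.comp hf fun p hp => analyticAt_inv (h0 p hp)

theorem exp {f : P → ℝ} (hf : S f) : S (fun p => Real.exp (f p)) :=
  C.comp hf fun _ _ => analyticAt_rexp

theorem log {f : P → ℝ} (hf : S f) (h0 : ∀ p ∈ Ω, 0 < f p) : S (fun p => Real.log (f p)) :=
  C.comp hf fun p hp => analyticAt_log (h0 p hp)

theorem det {n : Type*} [Fintype n] [DecidableEq n] {A : P → Matrix n n ℝ}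
    (hA : ∀ i j, S (fun p => A p i j)) : S (fun p => (A p).det) := by
  simp only [Matrix.det_apply']
  exact C.sum _ fun σ _ => C.const_mul _ (C.prod _ fun i _ => hA _ _)

/-- Cramer's rule: an entry of the inverse is a quotient of determinants, and determinants are
polynomials in the entries. -/
theorem matrix_inv {n : Type*} [Fintype n] [DecidableEq n] {A : P → Matrix n n ℝ}
    (hA : ∀ i j, S (fun p => A p i j)) (h0 : ∀ p ∈ Ω, (A p).det ≠ 0) (i j : n) :
    S (fun p => (A p)⁻¹ i j) := by
  have h1 : ∀ p, (A p)⁻¹ i j = ((A p).det)⁻¹ * ((A p).updateRow j (Pi.single i 1)).det := by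
    intro p
    rw [Matrix.inv_def, Matrix.smul_apply, Matrix.adjugate_apply, Ring.inverse_eq_inv', smul_eq_mul]
  simp only [h1]
  refine C.mul (C.inv (C.det hA) h0) (C.det fun k l => ?_)
  by_cases hk : k = j
  · subst hk
    simpa using C.const _
  · simpa [Matrix.updateRow_ne hk] using hA k l

theorem dir_const_mul (a : ι) (r : ℝ) {f : P → ℝ} (hf : S f) {p : P} (hp : p ∈ Ω) :
    d a (fun q => r * f q) p = r * d a f p := by
  rw [C.dir_mul a (C.const r) hf p hp, C.dir_const a r p hp]; ring

theorem dir_neg (a : ι) {f : P → ℝ} (hf : S f) {p : P} (hp : p ∈ Ω) :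
    d a (fun q => -f q) p = -d a f p := by
  have h1 := C.dir_const_mul a (-1) hf hp
  simpa using h1

theorem dir_sub (a : ι) {f g : P → ℝ} (hf : S f) (hg : S g) {p : P} (hp : p ∈ Ω) :
    d a (fun q => f q - g q) p = d a f p - d a g p := by
  simp only [sub_eq_add_neg]
  rw [C.dir_add a hf (C.neg hg) p hp, C.dir_neg a hg hp]

theorem dir_sum (a : ι) {κ : Type*} (s : Finset κ) {f : κ → P → ℝ} (hf : ∀ i ∈ s, S (f i))
    {p : P} (hp : p ∈ Ω) : d a (fun q => ∑ i ∈ s, f i q) p = ∑ i ∈ s, d a (f i) p := by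
  classical
  induction s using Finset.induction_on with
  | empty => simpa using C.dir_const a 0 p hp
  | insert b s hb ih =>
    have h1 := C.dir_add a (hf b (Finset.mem_insert_self b s))
      (C.sum s fun i hi => hf i (Finset.mem_insert_of_mem hi)) p hp
    simp only [Finset.sum_insert hb]
    rw [h1, ih fun i hi => hf i (Finset.mem_insert_of_mem hi)]

theorem dir_eq_zero (a : ι) {f : P → ℝ} {r : ℝ} (hf : ∀ p ∈ Ω, f p = r) {p : P} (hp : p ∈ Ω) :
    d a f p = 0 := by
  rw [C.dir_congr a (g := fun _ => r) hf p hp, C.dir_const a r p hp]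

theorem dir_exp (a : ι) {f : P → ℝ} (hf : S f) {p : P} (hp : p ∈ Ω) :
    d a (fun q => Real.exp (f q)) p = Real.exp (f p) * d a f p := by
  rw [C.dir_comp a hf p hp analyticAt_rexp, Real.deriv_exp]

theorem dir_log (a : ι) {f : P → ℝ} (hf : S f) {p : P} (hp : p ∈ Ω) (h0 : 0 < f p) :
    d a (fun q => Real.log (f q)) p = (f p)⁻¹ * d a f p := by
  rw [C.dir_comp a hf p hp (analyticAt_log h0), Real.deriv_log]

theorem reindex {κ : Type*} (e : κ → ι) : FrameCalculus Ω S (fun k => d (e k)) :=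
  { const := C.const, add := C.add, mul := C.mul, comp := C.comp, congr := C.congr
    dir := fun a => C.dir (e a), dir_congr := fun a => C.dir_congr (e a)
    dir_const := fun a => C.dir_const (e a), dir_add := fun a => C.dir_add (e a)
    dir_mul := fun a => C.dir_mul (e a), dir_comp := fun a => C.dir_comp (e a)
    dir_comm := fun a b => C.dir_comm (e a) (e b) }

end FrameCalculus

/-! ### Curvature in a frame calculus -/

section Curvature

variable {P ι : Type*} [Fintype ι] [DecidableEq ι] {Ω : Set P} {S : (P → ℝ) → Prop}
  {d : ι → (P → ℝ) → P → ℝ}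

namespace FrameCalculus

variable (C : FrameCalculus Ω S d)
include C

theorem christoffel_mem {G : P → Matrix ι ι ℝ} (hG : ∀ i j, S (fun p => G p i j))
    (h0 : ∀ p ∈ Ω, (G p).det ≠ 0) (c a b : ι) : S (christoffel d G c a b) := by
  refine C.const_mul _ (C.sum _ fun e _ => C.mul (C.matrix_inv hG h0 c e) ?_)
  exact C.sub (C.add (C.dir a (hG _ _)) (C.dir b (hG _ _))) (C.dir e (hG _ _))

theorem riemannTensor_mem {G : P → Matrix ι ι ℝ} (hG : ∀ i j, S (fun p => G p i j))
    (h0 : ∀ p ∈ Ω, (G p).det ≠ 0) (e c a b : ι) : S (riemannTensor d G e c a b) := by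
  have h := C.christoffel_mem hG h0
  exact C.add (C.sub (C.dir _ (h _ _ _)) (C.dir _ (h _ _ _)))
    (C.sum _ fun f _ => C.sub (C.mul (h _ _ _) (h _ _ _)) (C.mul (h _ _ _) (h _ _ _)))

theorem ricciTensor_mem {G : P → Matrix ι ι ℝ} (hG : ∀ i j, S (fun p => G p i j))
    (h0 : ∀ p ∈ Ω, (G p).det ≠ 0) (c b : ι) : S (ricciTensor d G c b) :=
  C.sum _ fun _ _ => C.riemannTensor_mem hG h0 _ _ _ _

theorem christoffel_congr {G G' : P → Matrix ι ι ℝ} (hG : ∀ p ∈ Ω, G p = G' p) (c a b : ι)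
    {p : P} (hp : p ∈ Ω) : christoffel d G c a b p = christoffel d G' c a b p := by
  have h : ∀ a i j, d a (fun q => G q i j) p = d a (fun q => G' q i j) p := fun a i j =>
    C.dir_congr a (fun q hq => by rw [hG q hq]) p hp
  simp only [christoffel, h, hG p hp]

/-- On `Ω` the derivations see only the values on `Ω`, so any formula for the Christoffel symbols
that is valid there can be differentiated. -/
theorem riemannTensor_eq_of_christoffel {G : P → Matrix ι ι ℝ} {Γ : ι → ι → ι → P → ℝ}
    (hG : ∀ c a b, ∀ p ∈ Ω, christoffel d G c a b p = Γ c a b p) (e c a b : ι)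
    {p : P} (hp : p ∈ Ω) : riemannTensor d G e c a b p =
      d a (Γ e b c) p - d b (Γ e a c) p +
        ∑ f, (Γ e a f p * Γ f b c p - Γ e b f p * Γ f a c p) := by
  have h : ∀ a e b c, d a (christoffel d G e b c) p = d a (Γ e b c) p := fun a e b c =>
    C.dir_congr a (hG e b c) p hp
  simp only [riemannTensor, h, hG _ _ _ p hp]

theorem riemannTensor_congr {G G' : P → Matrix ι ι ℝ} (hG : ∀ p ∈ Ω, G p = G' p) (e c a b : ι)
    {p : P} (hp : p ∈ Ω) : riemannTensor d G e c a b p = riemannTensor d G' e c a b p :=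
  C.riemannTensor_eq_of_christoffel (fun c a b _ hq => C.christoffel_congr hG c a b hq) e c a b hp

theorem ricciTensor_congr {G G' : P → Matrix ι ι ℝ} (hG : ∀ p ∈ Ω, G p = G' p) (c b : ι)
    {p : P} (hp : p ∈ Ω) : ricciTensor d G c b p = ricciTensor d G' c b p :=
  Finset.sum_congr rfl fun _ _ => C.riemannTensor_congr hG _ _ _ _ hp

end FrameCalculus

theorem riemannTensor_swap (d : ι → (P → ℝ) → P → ℝ) (G : P → Matrix ι ι ℝ) (e c a b : ι) (p : P) :
    riemannTensor d G e c a b p = -riemannTensor d G e c b a p := by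
  simp only [riemannTensor, Finset.sum_sub_distrib]; ring

end Curvature

/-! ### Christoffel symbols of `-ε dt² + γ` -/

section Block

variable {P : Type*}

/-- Gram matrix of `-ε dt² + γ_{ij} dxⁱ dxʲ`. -/
def blockGram (ε : ℝ) (γ : P → Matrix (Fin 3) (Fin 3) ℝ) (p : P) : Matrix (Fin 4) (Fin 4) ℝ :=
  Matrix.of fun a b => Fin.cases (Fin.cases (-ε) (fun _ => 0) b)
    (fun i => Fin.cases 0 (fun j => γ p i j) b) a

/-- The Weingarten map `½ γ^{ik} ∂_t γ_{kj}` of the slices of constant time. -/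
noncomputable def weingarten (d : Fin 4 → (P → ℝ) → P → ℝ) (γ : P → Matrix (Fin 3) (Fin 3) ℝ)
    (i j : Fin 3) (p : P) : ℝ :=
  1 / 2 * ∑ k, (γ p)⁻¹ i k * d 0 (fun q => γ q k j) p

/-- As `ε² = 1`, the time entry `-ε` is its own inverse, and the inverse again has block form with
the same `ε`. -/
theorem blockGram_inv {ε : ℝ} (hε : ε * ε = 1) (γ : P → Matrix (Fin 3) (Fin 3) ℝ) {p : P}
    (h0 : (γ p).det ≠ 0) : (blockGram ε γ p)⁻¹ = blockGram ε (fun q => (γ q)⁻¹) p := by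
  apply Matrix.inv_eq_right_inv
  have h1 : γ p * (γ p)⁻¹ = 1 := Matrix.mul_nonsing_inv _ (isUnit_iff_ne_zero.2 h0)
  have h2 : ∀ i j, ∑ k, γ p i k * (γ p)⁻¹ k j = (1 : Matrix (Fin 3) (Fin 3) ℝ) i j := by
    intro i j; rw [← h1, Matrix.mul_apply]
  ext a b
  rw [Matrix.mul_apply, Fin.sum_univ_succ]
  refine Fin.cases ?_ (fun i => ?_) a <;> refine Fin.cases ?_ (fun j => ?_) b
  · simp [blockGram, hε]
  · simp [blockGram, (Fin.succ_ne_zero j).symm]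
  · simp [blockGram]
  · simp [blockGram, Matrix.one_apply, h2]

/-- Christoffel symbols of `-ε dt² + γ_{ij} dxⁱ dxʲ`. -/
noncomputable def blockChristoffel (d : Fin 4 → (P → ℝ) → P → ℝ) (ε : ℝ)
    (γ : P → Matrix (Fin 3) (Fin 3) ℝ) (c a b : Fin 4) : P → ℝ :=
  Fin.cases
    (Fin.cases (fun _ => 0) (fun i =>
      Fin.cases (fun _ => 0) (fun j => fun p => ε / 2 * d 0 (fun q => γ q i j) p) b) a)
    (fun k => Fin.cases
      (Fin.cases (fun _ => 0) (fun j => weingarten d γ k j) b)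
      (fun i => Fin.cases (weingarten d γ k i)
        (fun j => christoffel (fun l : Fin 3 => d l.succ) γ k i j) b) a) c

variable {Ω : Set P} {S : (P → ℝ) → Prop} {d : Fin 4 → (P → ℝ) → P → ℝ}

theorem FrameCalculus.christoffel_blockGram (C : FrameCalculus Ω S d) {ε : ℝ} (hε : ε * ε = 1)
    {γ : P → Matrix (Fin 3) (Fin 3) ℝ} (hsymm : ∀ i j, ∀ p ∈ Ω, γ p i j = γ p j i)
    (h0 : ∀ p ∈ Ω, (γ p).det ≠ 0) (c a b : Fin 4) :
    ∀ p ∈ Ω, christoffel d (blockGram ε γ) c a b p = blockChristoffel d ε γ c a b p := by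
  intro p hp
  have e00 : ∀ a, d a (fun q => blockGram ε γ q 0 0) p = 0 := fun a => C.dir_const a _ p hp
  have e0s : ∀ a (j : Fin 3), d a (fun q => blockGram ε γ q 0 j.succ) p = 0 := fun a j =>
    C.dir_const a _ p hp
  have es0 : ∀ a (j : Fin 3), d a (fun q => blockGram ε γ q j.succ 0) p = 0 := fun a j =>
    C.dir_const a _ p hp
  have ess : ∀ i j : Fin 3, (fun q => blockGram ε γ q i.succ j.succ) = fun q => γ q i j :=
    fun i j => rfl
  have hs : ∀ a i j, d a (fun q => γ q i j) p = d a (fun q => γ q j i) p := fun a i j =>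
    C.dir_congr a (hsymm i j) p hp
  rw [christoffel, blockGram_inv hε γ (h0 p hp), Fin.sum_univ_succ]
  refine Fin.cases ?_ (fun k => ?_) c <;> refine Fin.cases ?_ (fun i => ?_) a <;>
    refine Fin.cases ?_ (fun j => ?_) b <;> simp only [e00, e0s, es0, ess]
  · simp [blockGram, blockChristoffel]
  · simp [blockGram, blockChristoffel]
  · simp [blockGram, blockChristoffel]
  · simp [blockGram, blockChristoffel]
    ring
  · simp [blockGram, blockChristoffel]
  · simp [blockGram, blockChristoffel, weingarten, hs 0 j]
  · simp [blockGram, blockChristoffel, weingarten, hs 0 i]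
  · simp [blockGram, blockChristoffel, christoffel]

end Block

/-! ### Gauss–Codazzi equations and Ricci tensor of `-ε dt² + γ` -/

section Block

variable {P : Type*} {Ω : Set P} {S : (P → ℝ) → Prop} {d : Fin 4 → (P → ℝ) → P → ℝ}

/-- The data of a metric `-ε dt² + γ_{ij} dxⁱ dxʲ` whose coefficients belong to the algebra `S`. -/
structure BlockMetric (Ω : Set P) (S : (P → ℝ) → Prop) (d : Fin 4 → (P → ℝ) → P → ℝ)
    (ε : ℝ) (γ : P → Matrix (Fin 3) (Fin 3) ℝ) : Prop where
  calculus : FrameCalculus Ω S d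
  sign : ε * ε = 1
  mem : ∀ i j, S (fun p => γ p i j)
  symm : ∀ i j, ∀ p ∈ Ω, γ p i j = γ p j i
  det_ne : ∀ p ∈ Ω, (γ p).det ≠ 0

namespace BlockMetric

variable {ε : ℝ} {γ : P → Matrix (Fin 3) (Fin 3) ℝ} (B : BlockMetric Ω S d ε γ)
include B

theorem weingarten_mem (i j : Fin 3) : S (weingarten d γ i j) :=
  B.calculus.const_mul _ (B.calculus.sum _ fun k _ =>
    B.calculus.mul (B.calculus.matrix_inv B.mem B.det_ne i k) (B.calculus.dir 0 (B.mem k j)))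

theorem spatial_calc : FrameCalculus Ω S (fun i : Fin 3 => d i.succ) := B.calculus.reindex Fin.succ

theorem riemann_eq (e c a b : Fin 4) {p : P} (hp : p ∈ Ω) :
    riemannTensor d (blockGram ε γ) e c a b p =
      d a (blockChristoffel d ε γ e b c) p - d b (blockChristoffel d ε γ e a c) p +
        ((blockChristoffel d ε γ e a 0 p * blockChristoffel d ε γ 0 b c p -
          blockChristoffel d ε γ e b 0 p * blockChristoffel d ε γ 0 a c p) +
        ∑ f : Fin 3, (blockChristoffel d ε γ e a f.succ p * blockChristoffel d ε γ f.succ b c p -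
          blockChristoffel d ε γ e b f.succ p * blockChristoffel d ε γ f.succ a c p)) := by
  rw [B.calculus.riemannTensor_eq_of_christoffel
    (B.calculus.christoffel_blockGram B.sign B.symm B.det_ne) e c a b hp, Fin.sum_univ_succ]

/-- The Gauss equation. Only the Christoffel symbols with upper time index carry `ε`, and they enter
once in each quadratic extrinsic term. -/
theorem riemann_spatial (l k i j : Fin 3) {p : P} (hp : p ∈ Ω) :
    riemannTensor d (blockGram ε γ) l.succ k.succ i.succ j.succ p =
      riemannTensor (fun i : Fin 3 => d i.succ) γ l k i j p +
        ε / 2 * (weingarten d γ l i p * d 0 (fun q => γ q j k) p -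
          weingarten d γ l j p * d 0 (fun q => γ q i k) p) := by
  rw [B.riemann_eq _ _ _ _ hp]
  simp only [blockChristoffel, Fin.cases_succ, Fin.cases_zero, riemannTensor]
  ring

theorem riemann_zero_spatial (k i j : Fin 3) {p : P} (hp : p ∈ Ω) :
    riemannTensor d (blockGram ε γ) 0 k.succ i.succ j.succ p =
      ε / 2 * (d i.succ (d 0 (fun q => γ q j k)) p - d j.succ (d 0 (fun q => γ q i k)) p +
        ∑ m, (d 0 (fun q => γ q i m) p * christoffel (fun i : Fin 3 => d i.succ) γ m j k p -
          d 0 (fun q => γ q j m) p * christoffel (fun i : Fin 3 => d i.succ) γ m i k p)) := by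
  rw [B.riemann_eq _ _ _ _ hp]
  simp only [blockChristoffel, Fin.cases_succ, Fin.cases_zero]
  rw [B.calculus.dir_const_mul _ _ (B.calculus.dir 0 (B.mem _ _)) hp,
    B.calculus.dir_const_mul _ _ (B.calculus.dir 0 (B.mem _ _)) hp, mul_add, Finset.mul_sum]
  simp only [zero_mul, sub_zero, zero_add]
  rw [← mul_sub]
  congr 1
  exact Finset.sum_congr rfl fun m _ => by ring

/-- The Codazzi equation; its trace is the momentum constraint `ricci_zero_succ`. -/
theorem riemann_spatial_zero (l i j : Fin 3) {p : P} (hp : p ∈ Ω) :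
    riemannTensor d (blockGram ε γ) l.succ 0 i.succ j.succ p =
      d i.succ (weingarten d γ l j) p - d j.succ (weingarten d γ l i) p +
        ∑ m, (christoffel (fun i : Fin 3 => d i.succ) γ l i m p * weingarten d γ m j p -
          christoffel (fun i : Fin 3 => d i.succ) γ l j m p * weingarten d γ m i p) := by
  rw [B.riemann_eq _ _ _ _ hp]
  simp only [blockChristoffel, Fin.cases_succ, Fin.cases_zero]
  ring

theorem riemann_zero_zero (i j : Fin 3) {p : P} (hp : p ∈ Ω) :
    riemannTensor d (blockGram ε γ) 0 0 i.succ j.succ p =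
      ε / 2 * ∑ m, (d 0 (fun q => γ q i m) p * weingarten d γ m j p -
          d 0 (fun q => γ q j m) p * weingarten d γ m i p) := by
  rw [B.riemann_eq _ _ _ _ hp]
  simp only [blockChristoffel, Fin.cases_succ, Fin.cases_zero]
  rw [B.calculus.dir_const _ _ p hp, B.calculus.dir_const _ _ p hp, Finset.mul_sum]
  simp only [mul_zero, sub_zero, zero_add]
  exact Finset.sum_congr rfl fun m _ => by ring

theorem riemann_spatial_time (l k j : Fin 3) {p : P} (hp : p ∈ Ω) :
    riemannTensor d (blockGram ε γ) l.succ k.succ 0 j.succ p =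
      d 0 (christoffel (fun i : Fin 3 => d i.succ) γ l j k) p - d j.succ (weingarten d γ l k) p +
        ∑ m, (weingarten d γ l m p * christoffel (fun i : Fin 3 => d i.succ) γ m j k p -
          christoffel (fun i : Fin 3 => d i.succ) γ l j m p * weingarten d γ m k p) := by
  rw [B.riemann_eq _ _ _ _ hp]
  simp only [blockChristoffel, Fin.cases_succ, Fin.cases_zero]
  ring

theorem riemann_zero_time (k j : Fin 3) {p : P} (hp : p ∈ Ω) :
    riemannTensor d (blockGram ε γ) 0 k.succ 0 j.succ p =
      ε / 2 * (d 0 (d 0 (fun q => γ q j k)) p -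
        ∑ m, d 0 (fun q => γ q j m) p * weingarten d γ m k p) := by
  rw [B.riemann_eq _ _ _ _ hp]
  simp only [blockChristoffel, Fin.cases_succ, Fin.cases_zero]
  rw [B.calculus.dir_const_mul _ _ (B.calculus.dir 0 (B.mem _ _)) hp, B.calculus.dir_const _ _ p hp,
    mul_sub, Finset.mul_sum]
  simp only [zero_mul, mul_zero, sub_zero, zero_add, zero_sub, Finset.sum_neg_distrib, mul_assoc]
  ring

theorem riemann_spatial_zero_time (l j : Fin 3) {p : P} (hp : p ∈ Ω) :
    riemannTensor d (blockGram ε γ) l.succ 0 0 j.succ p =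
      d 0 (weingarten d γ l j) p + ∑ m, weingarten d γ l m p * weingarten d γ m j p := by
  rw [B.riemann_eq _ _ _ _ hp]
  simp only [blockChristoffel, Fin.cases_succ, Fin.cases_zero]
  rw [B.calculus.dir_const _ _ p hp]
  simp

theorem riemann_zero_zero_time (j : Fin 3) {p : P} (hp : p ∈ Ω) :
    riemannTensor d (blockGram ε γ) 0 0 0 j.succ p = 0 := by
  rw [B.riemann_eq _ _ _ _ hp]
  simp only [blockChristoffel, Fin.cases_succ, Fin.cases_zero]
  rw [B.calculus.dir_const _ _ p hp, B.calculus.dir_const _ _ p hp]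
  simp

omit B in
theorem riemann_self (e c a : Fin 4) (p : P) :
    riemannTensor d (blockGram ε γ) e c a a p = 0 := by
  simp [riemannTensor]

theorem ricci_zero_zero {p : P} (hp : p ∈ Ω) :
    ricciTensor d (blockGram ε γ) 0 0 p =
      -∑ i, (d 0 (weingarten d γ i i) p + ∑ m, weingarten d γ i m p * weingarten d γ m i p) := by
  rw [ricciTensor, Fin.sum_univ_succ, riemann_self, zero_add, ← Finset.sum_neg_distrib]
  refine Finset.sum_congr rfl fun i _ => ?_
  rw [riemannTensor_swap, B.riemann_spatial_zero_time i i hp]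

theorem ricci_zero_succ (j : Fin 3) {p : P} (hp : p ∈ Ω) :
    ricciTensor d (blockGram ε γ) 0 j.succ p =
      ∑ l, (d l.succ (weingarten d γ l j) p - d j.succ (weingarten d γ l l) p +
        ∑ m, (christoffel (fun i : Fin 3 => d i.succ) γ l l m p * weingarten d γ m j p -
          christoffel (fun i : Fin 3 => d i.succ) γ l j m p * weingarten d γ m l p)) := by
  rw [ricciTensor, Fin.sum_univ_succ, B.riemann_zero_zero_time j hp, zero_add]
  exact Finset.sum_congr rfl fun l _ => B.riemann_spatial_zero l l j hp

theorem ricci_succ_zero (i : Fin 3) {p : P} (hp : p ∈ Ω) :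
    ricciTensor d (blockGram ε γ) i.succ 0 p =
      -∑ l, (d 0 (christoffel (fun i : Fin 3 => d i.succ) γ l l i) p -
        d l.succ (weingarten d γ l i) p +
        ∑ m, (weingarten d γ l m p * christoffel (fun i : Fin 3 => d i.succ) γ m l i p -
          christoffel (fun i : Fin 3 => d i.succ) γ l l m p * weingarten d γ m i p)) := by
  rw [ricciTensor, Fin.sum_univ_succ, riemann_self, zero_add, ← Finset.sum_neg_distrib]
  refine Finset.sum_congr rfl fun l _ => ?_
  rw [riemannTensor_swap, B.riemann_spatial_time l i l hp]

/-- The equation that makes the signature change effective: `ε` multiplies the terms with time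
derivatives and nothing else, so the validity for both signs separates the two parts. -/
theorem ricci_succ_succ (i j : Fin 3) {p : P} (hp : p ∈ Ω) :
    ricciTensor d (blockGram ε γ) i.succ j.succ p =
      ricciTensor (fun i : Fin 3 => d i.succ) γ i j p +
        ε / 2 * (d 0 (d 0 (fun q => γ q j i)) p +
          (∑ l, weingarten d γ l l p) * d 0 (fun q => γ q j i) p -
          ∑ m, d 0 (fun q => γ q j m) p * weingarten d γ m i p -
          ∑ l, weingarten d γ l j p * d 0 (fun q => γ q l i) p) := by
  rw [ricciTensor, Fin.sum_univ_succ, B.riemann_zero_time i j hp]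
  simp only [B.riemann_spatial _ _ _ _ hp]
  rw [Finset.sum_add_distrib, ← Finset.mul_sum, Finset.sum_sub_distrib, ← Finset.sum_mul]
  simp only [ricciTensor]
  ring

end BlockMetric
end Block

/-! ### Curvature of diagonal metrics -/

section Diagonal

variable {P : Type*} {Ω : Set P} {S : (P → ℝ) → Prop}

/-- The diagonal metric `∑ exp (2 φᵢ) (dxⁱ)²`. -/
noncomputable def diagGram (φ : Fin 3 → P → ℝ) (p : P) : Matrix (Fin 3) (Fin 3) ℝ :=
  Matrix.diagonal fun i => Real.exp (2 * φ i p)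

theorem diagGram_inv (φ : Fin 3 → P → ℝ) (p : P) :
    (diagGram φ p)⁻¹ = Matrix.diagonal fun i => Real.exp (-(2 * φ i p)) := by
  apply Matrix.inv_eq_right_inv
  rw [diagGram, Matrix.diagonal_mul_diagonal, ← Matrix.diagonal_one]
  congr 1
  funext i
  rw [← Real.exp_add]
  simp

theorem diagGram_det_ne (φ : Fin 3 → P → ℝ) (p : P) : (diagGram φ p).det ≠ 0 := by
  rw [diagGram, Matrix.det_diagonal]
  exact Finset.prod_ne_zero_iff.2 fun i _ => (Real.exp_pos _).ne'

/-- Christoffel symbols of `∑ exp (2 φᵢ) (dxⁱ)²`. -/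
noncomputable def diagChristoffel (d : Fin 3 → (P → ℝ) → P → ℝ) (φ : Fin 3 → P → ℝ)
    (c a b : Fin 3) (p : P) : ℝ :=
  (if b = c then d a (φ c) p else 0) + (if a = c then d b (φ c) p else 0) -
    (if a = b then Real.exp (2 * φ a p - 2 * φ c p) * d c (φ a) p else 0)

namespace FrameCalculus

theorem diagGram_mem {ι : Type*} {d : ι → (P → ℝ) → P → ℝ} (C : FrameCalculus Ω S d)
    {φ : Fin 3 → P → ℝ} (hφ : ∀ i, S (φ i)) (i j : Fin 3) : S (fun p => diagGram φ p i j) := by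
  by_cases hij : i = j
  · subst hij
    simpa [diagGram] using C.exp (C.const_mul 2 (hφ i))
  · simpa [diagGram, hij] using C.const 0

theorem dir_diagGram {ι : Type*} {d : ι → (P → ℝ) → P → ℝ} (C : FrameCalculus Ω S d)
    {φ : Fin 3 → P → ℝ} (hφ : ∀ i, S (φ i)) (a : ι) (i j : Fin 3) {p : P} (hp : p ∈ Ω) :
    d a (fun q => diagGram φ q i j) p =
      if i = j then Real.exp (2 * φ i p) * (2 * d a (φ i) p) else 0 := by
  by_cases hij : i = j
  · subst hij
    simp only [diagGram, Matrix.diagonal_apply_eq, if_true]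
    rw [C.dir_exp a (C.const_mul 2 (hφ i)) hp, C.dir_const_mul a 2 (hφ i) hp]
  · simp only [diagGram, Matrix.diagonal_apply_ne _ hij, hij, if_false]
    exact C.dir_const a 0 p hp

variable {d : Fin 3 → (P → ℝ) → P → ℝ} (C : FrameCalculus Ω S d)
  {φ : Fin 3 → P → ℝ} (hφ : ∀ i, S (φ i))
include C hφ

theorem christoffel_diagGram (c a b : Fin 3) :
    ∀ p ∈ Ω, christoffel d (diagGram φ) c a b p = diagChristoffel d φ c a b p := by
  intro p hp
  rw [christoffel, diagGram_inv, Finset.sum_eq_single c]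
  · simp only [C.dir_diagGram hφ _ _ _ hp, Matrix.diagonal_apply_eq, diagChristoffel]
    have h1 : Real.exp (-(2 * φ c p)) * Real.exp (2 * φ c p) = 1 := by
      rw [← Real.exp_add]; simp
    have h2 : Real.exp (2 * φ a p - 2 * φ c p) =
        Real.exp (-(2 * φ c p)) * Real.exp (2 * φ a p) := by
      rw [← Real.exp_add]; ring_nf
    have e1 : Real.exp (-(2 * φ c p)) *
        (if b = c then Real.exp (2 * φ b p) * (2 * d a (φ b) p) else 0) =
        2 * (if b = c then d a (φ c) p else 0) := by
      split_ifs with hb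
      · subst hb; linear_combination (2 * d a (φ b) p) * h1
      · ring
    have e2 : Real.exp (-(2 * φ c p)) *
        (if a = c then Real.exp (2 * φ a p) * (2 * d b (φ a) p) else 0) =
        2 * (if a = c then d b (φ c) p else 0) := by
      split_ifs with hb
      · subst hb; linear_combination (2 * d b (φ a) p) * h1
      · ring
    have e3 : Real.exp (-(2 * φ c p)) *
        (if a = b then Real.exp (2 * φ a p) * (2 * d c (φ a) p) else 0) =
        2 * (if a = b then Real.exp (2 * φ a p - 2 * φ c p) * d c (φ a) p else 0) := by
      rw [h2]; split_ifs <;> ring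
    linear_combination (e1 + e2 - e3) / 2
  · intro e _ he
    rw [Matrix.diagonal_apply_ne _ he.symm, zero_mul]
  · simp

theorem dir_weight_mul (e a c b : Fin 3) {p : P} (hp : p ∈ Ω) :
    d e (fun q => Real.exp (2 * φ a q - 2 * φ c q) * d b (φ a) q) p =
      Real.exp (2 * φ a p - 2 * φ c p) *
        (d e (d b (φ a)) p + 2 * (d e (φ a) p - d e (φ c) p) * d b (φ a) p) := by
  have h1 := C.const_mul 2 (hφ a)
  have h2 := C.const_mul 2 (hφ c)
  rw [C.dir_mul e (C.exp (C.sub h1 h2)) (C.dir b (hφ a)) p hp, C.dir_exp e (C.sub h1 h2) hp,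
    C.dir_sub e h1 h2 hp, C.dir_const_mul e 2 (hφ a) hp, C.dir_const_mul e 2 (hφ c) hp]
  ring

theorem riemannTensor_diagGram (e c a b : Fin 3) {p : P} (hp : p ∈ Ω) :
    riemannTensor d (diagGram φ) e c a b p =
      d a (diagChristoffel d φ e b c) p - d b (diagChristoffel d φ e a c) p +
        ∑ f, (diagChristoffel d φ e a f p * diagChristoffel d φ f b c p -
          diagChristoffel d φ e b f p * diagChristoffel d φ f a c p) :=
  C.riemannTensor_eq_of_christoffel (C.christoffel_diagGram hφ) e c a b hp

-- Lets `i, j, k` be any arrangement of the three indices, so that each curvature formula below is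
-- proved once for all of them.
omit C hφ in
theorem sum_fin_three {i j k : Fin 3} (hij : i ≠ j) (hjk : j ≠ k) (hik : i ≠ k) (f : Fin 3 → ℝ) :
    ∑ e, f e = f i + f j + f k := by
  have h : (Finset.univ : Finset (Fin 3)) = {i, j, k} := by
    symm
    apply Finset.eq_univ_of_card
    rw [Finset.card_insert_of_notMem (by simp [hij, hik]),
      Finset.card_insert_of_notMem (by simp [hjk])]
    simp
  rw [h, Finset.sum_insert (by simp [hij, hik]), Finset.sum_insert (by simp [hjk]),
    Finset.sum_singleton, add_assoc]

theorem riemannTensor_diagGram_offdiag {i j k : Fin 3} (hij : i ≠ j) (hjk : j ≠ k) (hik : i ≠ k)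
    {p : P} (hp : p ∈ Ω) : riemannTensor d (diagGram φ) i j i k p =
      -(d k (d j (φ i)) p + d k (φ i) p * d j (φ i) p - d j (φ i) p * d k (φ j) p -
        d k (φ i) p * d j (φ k) p) := by
  rw [C.riemannTensor_diagGram hφ _ _ _ _ hp, sum_fin_three hij hjk hik]
  have h1 : diagChristoffel d φ i k j = fun _ => 0 := by
    funext q; simp [diagChristoffel, hij.symm, hik.symm, hjk.symm]
  have h2 : diagChristoffel d φ i i j = d j (φ i) := by
    funext q; simp [diagChristoffel, hij, hij.symm]
  rw [h1, h2, C.dir_const i 0 p hp]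
  simp [diagChristoffel, hij, hik, hjk, hik.symm, hjk.symm]
  ring

/-- With the first index lowered, the component is skew in its equal first two indices. In
coordinates the second derivatives cancel by commutation, and the quadratic terms because the two
exponential weights are inverse to each other. -/
theorem riemannTensor_diagGram_trivial {i j k : Fin 3} (hij : i ≠ j) (hjk : j ≠ k) (hik : i ≠ k)
    {p : P} (hp : p ∈ Ω) : riemannTensor d (diagGram φ) j j j k p = 0 := by
  rw [C.riemannTensor_diagGram hφ _ _ _ _ hp, sum_fin_three hij hjk hik]
  have h1 : diagChristoffel d φ j k j = d k (φ j) := by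
    funext q; simp [diagChristoffel, hjk.symm]
  have h2 : diagChristoffel d φ j j j = d j (φ j) := by
    funext q; simp [diagChristoffel]
  have h3 : Real.exp (2 * φ k p - 2 * φ j p) * Real.exp (2 * φ j p - 2 * φ k p) = 1 := by
    rw [← Real.exp_add]; simp
  rw [h1, h2, C.dir_comm j k (hφ j) p hp]
  simp [diagChristoffel, hij, hjk, hij.symm, hjk.symm, hik.symm]
  linear_combination (-d j (φ k) p * d k (φ j) p) * h3

theorem riemannTensor_diagGram_sectional {i j k : Fin 3} (hij : i ≠ j) (hjk : j ≠ k) (hik : i ≠ k)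
    {p : P} (hp : p ∈ Ω) : riemannTensor d (diagGram φ) j i j i p =
      -(Real.exp (2 * φ i p - 2 * φ j p) *
          (d j (d j (φ i)) p + (d j (φ i) p - d j (φ j) p) * d j (φ i) p) +
        (d i (d i (φ j)) p + (d i (φ j) p - d i (φ i) p) * d i (φ j) p) +
        Real.exp (2 * φ i p - 2 * φ k p) * (d k (φ i) p * d k (φ j) p)) := by
  rw [C.riemannTensor_diagGram hφ _ _ _ _ hp, sum_fin_three hij hjk hik]
  have h1 : diagChristoffel d φ j i i =
      fun q => -(Real.exp (2 * φ i q - 2 * φ j q) * d j (φ i) q) := by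
    funext q; simp [diagChristoffel, hij]
  have h2 : diagChristoffel d φ j j i = d i (φ j) := by
    funext q; simp [diagChristoffel, hij, hij.symm]
  have h3 : S (fun q => Real.exp (2 * φ i q - 2 * φ j q) * d j (φ i) q) :=
    C.mul (C.exp (C.sub (C.const_mul 2 (hφ i)) (C.const_mul 2 (hφ j)))) (C.dir j (hφ i))
  rw [h1, h2, C.dir_neg j h3 hp, C.dir_weight_mul hφ _ _ _ _ hp]
  simp [diagChristoffel, hij, hik, hjk, hij.symm, hjk.symm]
  ring

theorem ricciTensor_diagGram_offdiag {i j k : Fin 3} (hij : i ≠ j) (hjk : j ≠ k) (hik : i ≠ k)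
    {p : P} (hp : p ∈ Ω) : ricciTensor d (diagGram φ) j k p =
      -(d k (d j (φ i)) p + d k (φ i) p * d j (φ i) p - d j (φ i) p * d k (φ j) p -
        d k (φ i) p * d j (φ k) p) := by
  rw [ricciTensor, sum_fin_three hij hjk hik, C.riemannTensor_diagGram_offdiag hφ hij hjk hik hp,
    C.riemannTensor_diagGram_trivial hφ hij hjk hik hp]
  simp [riemannTensor]

omit C hφ in
theorem ricciTensor_diagGram_diag {i j k : Fin 3} (hij : i ≠ j) (hjk : j ≠ k) (hik : i ≠ k)
    (p : P) : ricciTensor d (diagGram φ) i i p =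
      riemannTensor d (diagGram φ) j i j i p + riemannTensor d (diagGram φ) k i k i p := by
  rw [ricciTensor, sum_fin_three hij hjk hik]
  simp [riemannTensor]

end FrameCalculus

/-- Sectional curvature, up to sign, of the `i`-`j` plane for `∑ exp (2 φᵢ) (dxⁱ)²`. -/
noncomputable def diagSectional (d : Fin 3 → (P → ℝ) → P → ℝ) (φ : Fin 3 → P → ℝ) (i j k : Fin 3)
    (p : P) : ℝ :=
  Real.exp (-(2 * φ j p)) * (d j (d j (φ i)) p + (d j (φ i) p - d j (φ j) p) * d j (φ i) p) +
    Real.exp (-(2 * φ i p)) * (d i (d i (φ j)) p + (d i (φ j) p - d i (φ i) p) * d i (φ j) p) +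
    Real.exp (-(2 * φ k p)) * (d k (φ i) p * d k (φ j) p)

/-- In dimension three the Ricci tensor determines the curvature. The diagonal Ricci equations say
that the two sectional curvatures of planes containing the `i`-th direction add up to zero; for the
three values of `i` this is an invertible linear system for the three sectional curvatures. -/
theorem FrameCalculus.diagSectional_eq_zero {d : Fin 3 → (P → ℝ) → P → ℝ}
    (C : FrameCalculus Ω S d) {φ : Fin 3 → P → ℝ} (hφ : ∀ i, S (φ i)) {i j k : Fin 3}
    (hij : i ≠ j) (hjk : j ≠ k) (hik : i ≠ k) {p : P} (hp : p ∈ Ω)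
    (hric : ∀ i, ricciTensor d (diagGram φ) i i p = 0) : diagSectional d φ i j k p = 0 := by
  have key : ∀ {i j k : Fin 3}, i ≠ j → j ≠ k → i ≠ k →
      riemannTensor d (diagGram φ) j i j i p =
        -(Real.exp (2 * φ i p) * diagSectional d φ i j k p) := by
    intro i j k hij hjk hik
    have e1 : Real.exp (2 * φ i p - 2 * φ j p) =
        Real.exp (2 * φ i p) * Real.exp (-(2 * φ j p)) := by rw [← Real.exp_add]; ring_nf
    have e2 : Real.exp (2 * φ i p - 2 * φ k p) =
        Real.exp (2 * φ i p) * Real.exp (-(2 * φ k p)) := by rw [← Real.exp_add]; ring_nf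
    have e3 : Real.exp (2 * φ i p) * Real.exp (-(2 * φ i p)) = 1 := by rw [← Real.exp_add]; simp
    rw [C.riemannTensor_diagGram_sectional hφ hij hjk hik hp, e1, e2, diagSectional]
    linear_combination (d i (d i (φ j)) p + (d i (φ j) p - d i (φ i) p) * d i (φ j) p) * e3
  have hs : ∀ i j k, diagSectional d φ i j k p = diagSectional d φ j i k p := by
    intro i j k; simp only [diagSectional]; ring
  have hsum : ∀ {i j k : Fin 3}, i ≠ j → j ≠ k → i ≠ k →
      diagSectional d φ i j k p + diagSectional d φ i k j p = 0 := by
    intro i j k hij hjk hik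
    have h1 := hric i
    rw [ricciTensor_diagGram_diag hij hjk hik, key hij hjk hik, key hik hjk.symm hij] at h1
    have h2 : Real.exp (2 * φ i p) *
        (diagSectional d φ i j k p + diagSectional d φ i k j p) = 0 := by linear_combination -h1
    exact (mul_eq_zero.1 h2).resolve_left (Real.exp_pos _).ne'
  have h1 := hsum hij hjk hik
  have h2 := hsum hij.symm hik hjk
  have h3 := hsum hik.symm hij hjk.symm
  rw [hs j i k] at h2
  rw [hs k i j, hs k j i] at h3
  linear_combination (h1 + h2 - h3) / 2

theorem weingarten_diagGram {d : Fin 4 → (P → ℝ) → P → ℝ} (C : FrameCalculus Ω S d)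
    {φ : Fin 3 → P → ℝ} (hφ : ∀ i, S (φ i)) (i j : Fin 3) :
    ∀ p ∈ Ω, weingarten d (diagGram φ) i j p = if i = j then d 0 (φ i) p else 0 := by
  intro p hp
  rw [weingarten, diagGram_inv, Finset.sum_eq_single i]
  · rw [C.dir_diagGram hφ _ _ _ hp, Matrix.diagonal_apply_eq]
    have h1 : Real.exp (-(2 * φ i p)) * Real.exp (2 * φ i p) = 1 := by
      rw [← Real.exp_add]; simp
    split_ifs
    · linear_combination d 0 (φ i) p * h1
    · ring
  · intro e _ he
    rw [Matrix.diagonal_apply_ne _ he.symm, zero_mul]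
  · simp

theorem blockMetric_diagGram {d : Fin 4 → (P → ℝ) → P → ℝ} (C : FrameCalculus Ω S d)
    {φ : Fin 3 → P → ℝ} (hφ : ∀ i, S (φ i)) {ε : ℝ} (hε : ε * ε = 1) :
    BlockMetric Ω S d ε (diagGram φ) where
  calculus := C
  sign := hε
  mem := C.diagGram_mem hφ
  symm := fun i j p _ => by
    by_cases hij : i = j
    · rw [hij]
    · simp [diagGram, hij, Ne.symm hij]
  det_ne := fun p _ => diagGram_det_ne φ p

end Diagonal

/-! ### Kasner metrics, planar flat metrics and the Riccati equation -/

section VacuumExamples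

variable {P : Type*} {Ω : Set P} {S : (P → ℝ) → Prop} {d : Fin 4 → (P → ℝ) → P → ℝ}
  (C : FrameCalculus Ω S d) {φ : Fin 3 → P → ℝ} (hφ : ∀ i, S (φ i))
include C hφ

theorem dir_weingarten_diagGram (a : Fin 4) (i j : Fin 3) {p : P} (hp : p ∈ Ω) :
    d a (weingarten d (diagGram φ) i j) p = if i = j then d a (d 0 (φ i)) p else 0 := by
  rw [C.dir_congr a (weingarten_diagGram C hφ i j) p hp]
  split_ifs with hij
  · rfl
  · exact C.dir_const a 0 p hp

theorem dir_dir_diagGram (i j : Fin 3) {p : P} (hp : p ∈ Ω) :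
    d 0 (d 0 (fun q => diagGram φ q i j)) p =
      if i = j then Real.exp (2 * φ i p) * (2 * d 0 (d 0 (φ i)) p + 4 * d 0 (φ i) p ^ 2) else 0 := by
  have h1 : d 0 (d 0 (fun q => diagGram φ q i j)) p = d 0 (fun q =>
      if i = j then Real.exp (2 * φ i q) * (2 * d 0 (φ i) q) else 0) p :=
    C.dir_congr 0 (fun q hq => C.dir_diagGram hφ 0 i j hq) p hp
  rw [h1]
  split_ifs with hij
  · rw [C.dir_mul 0 (C.exp (C.const_mul 2 (hφ i))) (C.const_mul 2 (C.dir 0 (hφ i))) p hp,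
      C.dir_exp 0 (C.const_mul 2 (hφ i)) hp, C.dir_const_mul 0 2 (hφ i) hp,
      C.dir_const_mul 0 2 (C.dir 0 (hφ i)) hp]
    ring
  · exact C.dir_const 0 0 p hp

/-- Kasner metrics: a homogeneous diagonal metric with `∂_t² φᵢ = -(∑ ∂_t φⱼ) ∂_t φᵢ` and
`∑ (∂_t φᵢ)² = (∑ ∂_t φᵢ)²` is Ricci flat. -/
theorem ricciTensor_kasner {ε : ℝ} (hε : ε * ε = 1)
    (hhom : ∀ i j : Fin 3, ∀ p ∈ Ω, d j.succ (φ i) p = 0)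
    (hode : ∀ i, ∀ p ∈ Ω, d 0 (d 0 (φ i)) p = -(∑ j, d 0 (φ j) p) * d 0 (φ i) p)
    (hsq : ∀ p ∈ Ω, ∑ i, d 0 (φ i) p ^ 2 = (∑ i, d 0 (φ i) p) ^ 2) (a b : Fin 4) {p : P}
    (hp : p ∈ Ω) : ricciTensor d (blockGram ε (diagGram φ)) a b p = 0 := by
  have B := blockMetric_diagGram C hφ hε
  -- By homogeneity the slices have no Christoffel symbols, so only the time derivatives contribute.
  have hΓ : ∀ c a b, ∀ q ∈ Ω,
      christoffel (fun i : Fin 3 => d i.succ) (diagGram φ) c a b q = 0 := by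
    intro c a b q hq
    rw [B.spatial_calc.christoffel_diagGram hφ c a b q hq]
    simp [diagChristoffel, hhom _ _ q hq]
  have hW := fun i j => weingarten_diagGram C hφ i j p hp
  have hdW := fun (i j k : Fin 3) => dir_weingarten_diagGram C hφ i.succ j k hp
  have hcomm : ∀ i j : Fin 3, d i.succ (d 0 (φ j)) p = 0 := by
    intro i j
    rw [C.dir_comm _ _ (hφ j) p hp]
    exact C.dir_eq_zero 0 (hhom j i) hp
  refine Fin.cases ?_ (fun i => ?_) a <;> refine Fin.cases ?_ (fun j => ?_) b
  · rw [B.ricci_zero_zero hp]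
    simp only [dir_weingarten_diagGram C hφ _ _ _ hp, hW, if_true, hode _ p hp]
    have h1 := hsq p hp
    simp [Fin.sum_univ_three] at h1 ⊢
    linear_combination -h1
  · rw [B.ricci_zero_succ j hp]
    simp [hdW, hcomm, hΓ _ _ _ p hp]
  · rw [B.ricci_succ_zero i hp]
    simp [hdW, hcomm, hΓ _ _ _ p hp, C.dir_eq_zero 0 (hΓ _ _ _) hp]
  · rw [B.ricci_succ_succ i j hp]
    have h3 : ricciTensor (fun i : Fin 3 => d i.succ) (diagGram φ) i j p = 0 := by
      refine Finset.sum_eq_zero fun l _ => ?_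
      rw [B.spatial_calc.riemannTensor_eq_of_christoffel hΓ _ _ _ _ hp]
      simp [C.dir_const _ _ p hp]
    simp only [h3, dir_dir_diagGram C hφ _ _ hp, C.dir_diagGram hφ _ _ _ hp, hW, if_true]
    by_cases hij : j = i
    · subst hij
      simp [hode j p hp]
      ring_nf
      simp
    · simp [hij, Ne.symm hij]

-- The Kronecker factor turns the dependence on the single variable `x^{i₀}` into an algebraic
-- identity that `ring` can use.
omit C hφ in
theorem dir_of_dependsOn {i₀ : Fin 3} {g : P → ℝ} (hg : ∀ j ≠ i₀, ∀ p ∈ Ω, d j.succ g p = 0)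
    (i : Fin 3) {p : P} (hp : p ∈ Ω) :
    d i.succ g p = (if i = i₀ then 1 else 0) * d i₀.succ g p := by
  split_ifs with hi
  · rw [hi, one_mul]
  · rw [hg i hi p hp, zero_mul]

-- The algebra behind the Christoffel symbols of a metric in which only the coefficient at `i₀`
-- varies, and only along `i₀`: each term with an index other than `i₀` contains a vanishing factor
-- or cancels.
omit C hφ in
theorem planar_christoffel_aux {ι : Type*} [DecidableEq ι] (i₀ : ι) (ψ : ι → ℝ) (w : ι → ι → ℝ)
    (hψ : ∀ a ≠ i₀, ψ a = 0) (hw : w i₀ i₀ = 1) (c a b : ι) :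
    (if b = c then (if c = i₀ then 1 else 0) * ψ a else 0) +
      (if a = c then (if c = i₀ then 1 else 0) * ψ b else 0) -
      (if a = b then w a c * ((if a = i₀ then 1 else 0) * ψ c) else 0) =
    (if c = i₀ then 1 else 0) * (if a = i₀ then 1 else 0) * (if b = i₀ then 1 else 0) * ψ i₀ := by
  by_cases hc : c = i₀
  · subst hc
    by_cases ha : a = c
    · subst ha
      by_cases hb : b = a
      · subst hb; simp [hw]
      · simp [hb, Ne.symm hb, hψ b hb]
    · by_cases hb : b = c
      · subst hb; simp [ha, hψ a ha]
      · simp [ha, hb]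
  · simp [hc, hψ c hc]

/-- A metric `-ε dt² + e^{2φ} dx² + dy² + dz²` with `φ = φ (t, x)` and `∂_t² e^φ = 0` is flat. -/
theorem riemannTensor_planar {ε : ℝ} (hε : ε * ε = 1) (i₀ : Fin 3)
    (hzero : ∀ i ≠ i₀, ∀ p ∈ Ω, φ i p = 0)
    (hdep : ∀ j ≠ i₀, ∀ p ∈ Ω, d j.succ (φ i₀) p = 0)
    (hode : ∀ p ∈ Ω, d 0 (d 0 (φ i₀)) p + d 0 (φ i₀) p ^ 2 = 0) (e c a b : Fin 4) {p : P}
    (hp : p ∈ Ω) : riemannTensor d (blockGram ε (diagGram φ)) e c a b p = 0 := by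
  have B := blockMetric_diagGram C hφ hε
  -- All spatial tensors of this metric are supported on the index `i₀`, hence are products of `δ`'s
  -- with a scalar. The antisymmetric combinations in the curvature then cancel formally; only `htt`
  -- and `h0t` need the equation `hode`.
  set δ : Fin 3 → ℝ := fun i => if i = i₀ then 1 else 0 with hδ
  have hδ0 : ∀ i, i ≠ i₀ → δ i = 0 := fun i hi => by simp [hδ, hi]
  have hδ1 : δ i₀ = 1 := by simp [hδ]
  have hδδ : ∀ i, δ i * δ i = δ i := fun i => by simp [hδ]
  have hδij : ∀ i j, i ≠ j → δ i * δ j = 0 := by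
    intro i j hij
    by_cases hi : i = i₀
    · rw [hδ0 j fun hj => hij (hi.trans hj.symm), mul_zero]
    · rw [hδ0 i hi, zero_mul]
  set θ := d 0 (φ i₀) with hθ
  set ψ := d i₀.succ (φ i₀) with hψ
  set H := d 0 (fun q => diagGram φ q i₀ i₀) with hH
  have hθS : S θ := C.dir _ (hφ _)
  have hψS : S ψ := C.dir _ (hφ _)
  have hHS : S H := C.dir _ (C.diagGram_mem hφ _ _)
  have hdφ : ∀ a i, ∀ q ∈ Ω, d a (φ i) q = δ i * d a (φ i₀) q := by
    intro a i q hq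
    by_cases hi : i = i₀
    · subst hi; rw [hδ1, one_mul]
    · rw [hδ0 i hi, zero_mul]; exact C.dir_eq_zero a (hzero i hi) hq
  have hdep' : ∀ a, ∀ j ≠ i₀, ∀ q ∈ Ω, d j.succ (d a (φ i₀)) q = 0 := by
    intro a j hj q hq
    rw [C.dir_comm _ _ (hφ i₀) q hq]
    exact C.dir_eq_zero a (hdep j hj) hq
  have hHdep : ∀ j ≠ i₀, ∀ q ∈ Ω, d j.succ H q = 0 := by
    intro j hj q hq
    rw [hH, C.dir_comm _ _ (C.diagGram_mem hφ _ _) q hq]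
    refine C.dir_eq_zero 0 (r := 0) (fun r hr => ?_) hq
    rw [C.dir_diagGram hφ _ _ _ hr, hdep j hj r hr]
    simp
  have hΓ : ∀ c a b, ∀ q ∈ Ω, christoffel (fun i : Fin 3 => d i.succ) (diagGram φ) c a b q =
      δ c * δ a * δ b * ψ q := by
    intro c a b q hq
    rw [B.spatial_calc.christoffel_diagGram hφ c a b q hq]
    simp only [diagChristoffel]
    rw [hdφ a.succ c q hq, hdφ b.succ c q hq, hdφ c.succ a q hq]
    exact planar_christoffel_aux i₀ (fun a => d a.succ (φ i₀) q)
      (fun a c => Real.exp (2 * φ a q - 2 * φ c q)) (fun a ha => hdep a ha q hq)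
      (by simp) c a b
  have hW : ∀ i j, ∀ q ∈ Ω, weingarten d (diagGram φ) i j q = δ i * δ j * θ q := by
    intro i j q hq
    rw [weingarten_diagGram C hφ i j q hq, hdφ 0 i q hq]
    by_cases hij : i = j
    · subst hij
      rw [if_pos rfl, hδδ]
    · rw [if_neg hij, hδij i j hij, zero_mul]
  have hγ : ∀ i j, ∀ q ∈ Ω, d 0 (fun q => diagGram φ q i j) q = δ i * δ j * H q := by
    intro i j q hq
    rw [hH, C.dir_diagGram hφ _ _ _ hq, C.dir_diagGram hφ _ _ _ hq, hdφ 0 i q hq]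
    by_cases hij : i = j
    · subst hij
      rw [if_pos rfl, if_pos rfl, hδδ]
      by_cases hi : i = i₀
      · rw [hi, hδ1]; ring
      · rw [hδ0 i hi]; ring
    · rw [if_neg hij, hδij i j hij, zero_mul]
  have hdΓ : ∀ a c i j, d a (christoffel (fun i : Fin 3 => d i.succ) (diagGram φ) c i j) p =
      δ c * δ i * δ j * d a ψ p := fun a c i j => by
    rw [C.dir_congr a (hΓ c i j) p hp, C.dir_const_mul a _ hψS hp]
  have hdW : ∀ a i j, d a (weingarten d (diagGram φ) i j) p = δ i * δ j * d a θ p :=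
    fun a i j => by rw [C.dir_congr a (hW i j) p hp, C.dir_const_mul a _ hθS hp]
  have hdγ : ∀ a i j, d a (d 0 (fun q => diagGram φ q i j)) p = δ i * δ j * d a H p :=
    fun a i j => by rw [C.dir_congr a (hγ i j) p hp, C.dir_const_mul a _ hHS hp]
  have hψ' := fun i : Fin 3 => dir_of_dependsOn (hdep' i₀.succ) i hp
  have hθ' := fun i : Fin 3 => dir_of_dependsOn (hdep' 0) i hp
  have hH' := fun i : Fin 3 => dir_of_dependsOn hHdep i hp
  have hsum : ∀ r : ℝ, ∑ m, δ m * δ m * r = r := fun r => by simp [hδ]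
  -- The two mixed derivatives of `φ i₀` agree; they are the terms that cancel in `hst`.
  have hψθ : d 0 ψ p = d i₀.succ θ p := C.dir_comm _ _ (hφ i₀) p hp
  have htt : ∀ l j : Fin 3, riemannTensor d (blockGram ε (diagGram φ)) l.succ 0 0 j.succ p = 0 := by
    intro l j
    rw [B.riemann_spatial_zero_time l j hp]
    simp only [hdW, hW _ _ p hp]
    rw [Finset.sum_congr rfl (g := fun m => δ m * δ m * (δ l * δ j * θ p ^ 2))
      (fun m _ => by ring), hsum]
    linear_combination δ l * δ j * hode p hp
  have h0t : ∀ k j : Fin 3, riemannTensor d (blockGram ε (diagGram φ)) 0 k.succ 0 j.succ p = 0 := by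
    intro k j
    rw [B.riemann_zero_time k j hp]
    simp only [hdγ, hW _ _ p hp, hγ _ _ p hp]
    rw [Finset.sum_congr rfl (g := fun m => δ m * δ m * (δ j * δ k * (H p * θ p)))
      (fun m _ => by ring), hsum]
    have h1 : d 0 H p = _ := dir_dir_diagGram C hφ i₀ i₀ hp
    have h2 : H p = _ := C.dir_diagGram hφ 0 i₀ i₀ hp
    rw [if_pos rfl] at h1 h2
    rw [h1, h2]
    linear_combination δ j * δ k * ε * Real.exp (2 * φ i₀ p) * hode p hp
  have hst : ∀ l k j : Fin 3, riemannTensor d (blockGram ε (diagGram φ)) l.succ k.succ 0 j.succ p = 0 := by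
    intro l k j
    rw [B.riemann_spatial_time l k j hp]
    simp only [hdW, hdΓ, hW _ _ p hp, hΓ _ _ _ p hp]
    rw [Finset.sum_eq_zero fun m _ => by ring]
    rw [hθ' j, hψθ]
    simp only [hδ, hθ]
    ring
  refine Fin.cases ?_ (fun i => ?_) a <;> refine Fin.cases ?_ (fun j => ?_) b
  · exact BlockMetric.riemann_self _ _ _ _
  · refine Fin.cases ?_ (fun l => ?_) e <;> refine Fin.cases ?_ (fun k => ?_) c
    · exact B.riemann_zero_zero_time j hp
    · exact h0t k j
    · exact htt l j
    · exact hst l k j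
  · rw [riemannTensor_swap, neg_eq_zero]
    refine Fin.cases ?_ (fun l => ?_) e <;> refine Fin.cases ?_ (fun k => ?_) c
    · exact B.riemann_zero_zero_time i hp
    · exact h0t k i
    · exact htt l i
    · exact hst l k i
  · refine Fin.cases ?_ (fun l => ?_) e <;> refine Fin.cases ?_ (fun k => ?_) c
    · rw [B.riemann_zero_zero i j hp]
      simp only [hW _ _ p hp, hγ _ _ p hp]
      rw [Finset.sum_eq_zero fun m _ => by ring, mul_zero]
    · rw [B.riemann_zero_spatial k i j hp]
      simp only [hdγ, hγ _ _ p hp, hΓ _ _ _ p hp]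
      rw [Finset.sum_eq_zero fun m _ => by ring, hH' i, hH' j]
      simp only [hδ]
      ring
    · rw [B.riemann_spatial_zero l i j hp]
      simp only [hdW, hW _ _ p hp, hΓ _ _ _ p hp]
      rw [Finset.sum_eq_zero fun m _ => by ring, hθ' i, hθ' j]
      simp only [hδ]
      ring
    · rw [B.riemann_spatial l k i j hp,
        B.spatial_calc.riemannTensor_eq_of_christoffel hΓ _ _ _ _ hp]
      simp only [hγ _ _ p hp, hW _ _ p hp]
      rw [Finset.sum_eq_zero fun m _ => by ring, C.dir_const_mul _ _ hψS hp,
        C.dir_const_mul _ _ hψS hp, hψ' i, hψ' j]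
      simp only [hδ]
      ring

/-- If `-ε dt² + ∑ exp (2 φᵢ) (dxⁱ)²` is flat then `∂_t² φᵢ + (∂_t φᵢ)² = 0`. -/
theorem riccati_of_riemannTensor_eq_zero {ε : ℝ} (hε : ε * ε = 1) {p : P} (hp : p ∈ Ω)
    (hflat : ∀ e c a b, riemannTensor d (blockGram ε (diagGram φ)) e c a b p = 0) (i : Fin 3) :
    d 0 (d 0 (φ i)) p + d 0 (φ i) p ^ 2 = 0 := by
  have B := blockMetric_diagGram C hφ hε
  have h1 := B.riemann_spatial_zero_time i i hp
  rw [hflat, dir_weingarten_diagGram C hφ _ _ _ hp] at h1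
  simp only [weingarten_diagGram C hφ _ _ p hp] at h1
  simp at h1
  linear_combination -h1

end VacuumExamples

/-- A solution of a linear homogeneous equation `f' = g f` that vanishes at one point of an interval
vanishes. -/
theorem eq_zero_of_hasDerivAt_mul {I : Set ℝ} (hI : IsOpen I) (hI' : IsPreconnected I) {t₀ : ℝ}
    (ht₀ : t₀ ∈ I) {f g : ℝ → ℝ} (hf : AnalyticOnNhd ℝ f I) (hg : ContinuousAt g t₀)
    (hode : ∀ t ∈ I, HasDerivAt f (g t * f t) t) (h0 : f t₀ = 0) : ∀ t ∈ I, f t = 0 := by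
  -- Continuity at the single point `t₀` bounds `g` nearby, which is the uniform Lipschitz constant
  -- required for local uniqueness. Analyticity carries the vanishing from there to the whole
  -- interval.
  have hK : ∀ᶠ t in 𝓝 t₀, ‖g t‖₊ < ‖g t₀‖₊ + 1 :=
    hg.nnnorm.eventually (gt_mem_nhds (lt_add_of_pos_right _ one_pos))
  have h1 : f =ᶠ[𝓝 t₀] 0 := by
    refine ODE_solution_unique_of_eventually (v := fun t y => g t * y) (s := fun _ => univ)
      (K := ‖g t₀‖₊ + 1) ?_ ?_ ?_ (by simpa using h0)
    · filter_upwards [hK] with t ht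
      have h2 : LipschitzWith ‖g t‖₊ (fun y => g t * y) := by
        refine LipschitzWith.of_dist_le_mul fun x y => ?_
        rw [Real.dist_eq, Real.dist_eq, ← mul_sub, abs_mul]
        rfl
      exact (h2.weaken ht.le).lipschitzOnWith
    · filter_upwards [hI.mem_nhds ht₀] with t ht using ⟨hode t ht, mem_univ _⟩
    · refine Eventually.of_forall fun t => ⟨?_, mem_univ _⟩
      simp
  exact fun t ht => hf.eqOn_zero_of_preconnected_of_eventuallyEq_zero hI' ht₀ h1 ht

/-! ### Analytic continuation and linear equations along the normal lines -/

section Fibres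

variable {D : Type*} [TopologicalSpace D] [ChartedSpace Model3 D] [IsManifold 𝓘(ℝ, Model3) ω D]
  {h : AnalyticMetric D}

omit [IsManifold 𝓘(ℝ, Model3) ω D] in
theorem AnalyticOnSet.analyticOnNhd_fiber {Ω : Set (ℝ × D)} {f : ℝ × D → ℝ}
    (hf : AnalyticOnSet Ω f) (x : D) : AnalyticOnNhd ℝ (fun t => f (t, x)) {t | (t, x) ∈ Ω} := by
  intro t ht
  have h1 : ContMDiffAt 𝓘(ℝ, ℝ) 𝓘(ℝ, ℝ) ω (fun t => f (t, x)) t :=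
    ContMDiffAt.comp t (g := f) (f := fun t => (t, x)) (hf (t, x) ht)
      (contMDiffAt_id.prodMk contMDiffAt_const)
  exact h1.contDiffAt.analyticAt

theorem AnalyticOnSet.hasDerivAt_fiber (E : GaussianFrame h) {Ω : Set (ℝ × D)} {f : ℝ × D → ℝ}
    (hf : AnalyticOnSet Ω f) {t : ℝ} {x : D} (ht : (t, x) ∈ Ω) :
    HasDerivAt (fun t => f (t, x)) (SignatureChangingSpacetime.frameDir E 0 f (t, x)) t :=
  (hf.analyticOnNhd_fiber x t ht).differentiableAt.hasDerivAt

/-- Open neighbourhoods of `{0} × D` in `ℝ × D` that meet the lines `ℝ × {x}` in intervals. -/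
structure IsNormalNeighbourhood (Ω : Set (ℝ × D)) : Prop where
  isOpen : IsOpen Ω
  zero_mem : ∀ x, ((0 : ℝ), x) ∈ Ω
  ordConnected : ∀ x, OrdConnected {t : ℝ | (t, x) ∈ Ω}

namespace IsNormalNeighbourhood

variable {Ω : Set (ℝ × D)} (N : IsNormalNeighbourhood Ω)
include N

omit [ChartedSpace Model3 D] [IsManifold 𝓘(ℝ, Model3) ω D] in
theorem isOpen_fiber (x : D) : IsOpen {t : ℝ | (t, x) ∈ Ω} :=
  N.isOpen.preimage (Continuous.prodMk_left x)

omit [ChartedSpace Model3 D] [IsManifold 𝓘(ℝ, Model3) ω D] in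
theorem isPreconnected_fiber (x : D) : IsPreconnected {t : ℝ | (t, x) ∈ Ω} :=
  (N.ordConnected x).isPreconnected

-- Each normal line meets `Ω` in an open interval around `0`. The points `s r` with small `r > 0`
-- lie in it on the side where `f` is known to vanish, and the identity theorem in `t` does the
-- rest.
omit [IsManifold 𝓘(ℝ, Model3) ω D] in
theorem eq_zero_of_sign {f : ℝ × D → ℝ} (hf : AnalyticOnSet Ω f) {s : ℝ} (hs : s ≠ 0)
    (h0 : ∀ p ∈ Ω, 0 < s * p.1 → f p = 0) : ∀ p ∈ Ω, f p = 0 := by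
  rintro ⟨t, x⟩ hp
  have h1 : ∀ᶠ r : ℝ in 𝓝[>] 0, (s * r, x) ∈ Ω := by
    have h2 : Tendsto (fun r : ℝ => s * r) (𝓝[>] 0) (𝓝 0) := by
      have h3 : Tendsto (fun r : ℝ => s * r) (𝓝 0) (𝓝 (s * 0)) := (continuous_const_mul s).tendsto 0
      rw [mul_zero] at h3
      exact h3.mono_left nhdsWithin_le_nhds
    exact h2.eventually ((N.isOpen_fiber x).mem_nhds (N.zero_mem x))
  obtain ⟨r, hr, hr0⟩ := (h1.and self_mem_nhdsWithin).exists
  have hr0 : 0 < r := hr0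
  have hpos : 0 < s * (s * r) := by
    rw [← mul_assoc]; exact mul_pos (mul_self_pos.2 hs) hr0
  refine (hf.analyticOnNhd_fiber x).eqOn_zero_of_preconnected_of_eventuallyEq_zero
    (N.isPreconnected_fiber x) (z₀ := s * r) hr ?_ hp
  have h4 : ∀ᶠ y in 𝓝 (s * r), 0 < s * y :=
    (continuous_const_mul s).continuousAt.eventually (lt_mem_nhds hpos)
  filter_upwards [h4, (N.isOpen_fiber x).mem_nhds hr] with y hy1 hy2 using h0 (y, x) hy2 hy1

theorem eq_zero_of_linear (E : GaussianFrame h) {f g : ℝ × D → ℝ} (hf : AnalyticOnSet Ω f)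
    (hg : AnalyticOnSet Ω g)
    (hode : ∀ p ∈ Ω, SignatureChangingSpacetime.frameDir E 0 f p = g p * f p)
    (h0 : ∀ x, f (0, x) = 0) : ∀ p ∈ Ω, f p = 0 := by
  rintro ⟨t, x⟩ hp
  refine eq_zero_of_hasDerivAt_mul (N.isOpen_fiber x) (N.isPreconnected_fiber x) (N.zero_mem x)
    (hf.analyticOnNhd_fiber x) (g := fun t => g (t, x))
    (hg.analyticOnNhd_fiber x 0 (N.zero_mem x)).continuousAt (fun t ht => ?_) (h0 x) t hp
  have h1 := hf.hasDerivAt_fiber E ht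
  rwa [hode (t, x) ht] at h1

end IsNormalNeighbourhood
end Fibres

/-! ### Evolution of the Weingarten map -/

section Evolution

variable {P : Type*} {Ω : Set P} {S : (P → ℝ) → Prop} {d : Fin 4 → (P → ℝ) → P → ℝ}
  {ε : ℝ} {γ : P → Matrix (Fin 3) (Fin 3) ℝ}

theorem BlockMetric.weingarten_spec (B : BlockMetric Ω S d ε γ) (i j : Fin 3) {p : P}
    (hp : p ∈ Ω) : ∑ m, γ p i m * weingarten d γ m j p = 1 / 2 * d 0 (fun q => γ q i j) p := by
  have h1 : γ p * (γ p)⁻¹ = 1 := Matrix.mul_nonsing_inv _ (isUnit_iff_ne_zero.2 (B.det_ne p hp))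
  have h2 : γ p * ((γ p)⁻¹ * Matrix.of fun k l => d 0 (fun q => γ q k l) p) =
      Matrix.of fun k l => d 0 (fun q => γ q k l) p := by rw [← mul_assoc, h1, one_mul]
  have h3 := congrFun (congrFun h2 i) j
  simp only [Matrix.mul_apply, Matrix.of_apply] at h3
  rw [← h3, Finset.mul_sum]
  refine Finset.sum_congr rfl fun m _ => ?_
  rw [weingarten]; ring

/-- Differentiating `γ W = ½ γ'` gives `γ W' = ½ γ'' - γ' W`. The two quadratic terms of the
evolution equation coincide, so it reads `½ γ'' = γ' W - k γ W` with `k = tr W`. Hence `γ (W' + k W)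
= 0`, and `γ` is invertible. -/
theorem BlockMetric.dir_weingarten_of_evolution (B : BlockMetric Ω S d ε γ)
    (hev : ∀ i j, ∀ p ∈ Ω, d 0 (d 0 (fun q => γ q j i)) p +
          (∑ l, weingarten d γ l l p) * d 0 (fun q => γ q j i) p -
          ∑ m, d 0 (fun q => γ q j m) p * weingarten d γ m i p -
          ∑ l, weingarten d γ l j p * d 0 (fun q => γ q l i) p = 0) (i j : Fin 3) {p : P}
    (hp : p ∈ Ω) : d 0 (weingarten d γ i j) p =
      -(∑ l, weingarten d γ l l p) * weingarten d γ i j p := by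
  set k := ∑ l, weingarten d γ l l p with hk
  have hW := B.weingarten_mem
  -- Both sides are entries of `2 Wᵀ γ W`, by the symmetry of `γ` and of `γ'`.
  have hswap : ∀ a b : Fin 3, ∑ l, weingarten d γ l b p * d 0 (fun q => γ q l a) p =
      ∑ m, d 0 (fun q => γ q b m) p * weingarten d γ m a p := by
    intro a b
    have e1 : ∀ l, d 0 (fun q => γ q l a) p = 2 * ∑ m, γ p l m * weingarten d γ m a p := by
      intro l; rw [B.weingarten_spec l a hp]; ring
    have e2 : ∀ m, d 0 (fun q => γ q b m) p = 2 * ∑ l, γ p m l * weingarten d γ l b p := by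
      intro m
      rw [B.weingarten_spec m b hp, B.calculus.dir_congr 0 (B.symm b m) p hp]
      ring
    simp only [e1, e2, Finset.mul_sum, Finset.sum_mul]
    rw [Finset.sum_comm]
    refine Finset.sum_congr rfl fun m _ => Finset.sum_congr rfl fun l _ => ?_
    rw [B.symm l m p hp]; ring
  have hder : ∀ a b, ∑ m, γ p a m * (d 0 (weingarten d γ m b) p + k * weingarten d γ m b p) = 0 := by
    intro a b
    have e1 : d 0 (fun q => ∑ m, γ q a m * weingarten d γ m b q) p =
        d 0 (fun q => 1 / 2 * d 0 (fun q => γ q a b) q) p :=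
      B.calculus.dir_congr 0 (fun q hq => B.weingarten_spec a b hq) p hp
    rw [B.calculus.dir_const_mul 0 _ (B.calculus.dir 0 (B.mem a b)) hp, B.calculus.dir_sum 0 _
      (fun m _ => B.calculus.mul (B.mem a m) (hW m b)) hp] at e1
    simp only [fun m => B.calculus.dir_mul 0 (B.mem a m) (hW m b) p hp,
      Finset.sum_add_distrib] at e1
    have e2 := hev b a p hp
    rw [hswap b a] at e2
    have e3 := B.weingarten_spec a b hp
    have e4 : ∑ m, γ p a m * (d 0 (weingarten d γ m b) p + k * weingarten d γ m b p) =
        ∑ m, γ p a m * d 0 (weingarten d γ m b) p + k * ∑ m, γ p a m * weingarten d γ m b p := by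
      rw [Finset.mul_sum, ← Finset.sum_add_distrib]
      exact Finset.sum_congr rfl fun m _ => by ring
    rw [e4, e3]
    linear_combination e1 + e2 / 2
  have hinv : (γ p)⁻¹ * γ p = 1 := Matrix.nonsing_inv_mul _ (isUnit_iff_ne_zero.2 (B.det_ne p hp))
  set V : Matrix (Fin 3) (Fin 3) ℝ :=
    Matrix.of fun m b => d 0 (weingarten d γ m b) p + k * weingarten d γ m b p with hV
  have hV0 : γ p * V = 0 := by
    ext a b
    simpa [Matrix.mul_apply, hV] using hder a b
  have hV1 : V = 0 := by
    rw [← one_mul V, ← hinv, mul_assoc, hV0, mul_zero]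
  have h2 := congrFun (congrFun hV1 i) j
  simp only [hV, Matrix.of_apply, Matrix.zero_apply] at h2
  linear_combination h2

end Evolution

/-! ### The slices of a signature changing spacetime and the splitting of the vacuum equations -/

section Spacetime

variable {D : Type*} [TopologicalSpace D] [ChartedSpace Model3 D] [IsManifold 𝓘(ℝ, Model3) ω D]
  {h : AnalyticMetric D}

namespace GaussianFrame

theorem eq_zero_of_sum_smul_eq_zero (E : GaussianFrame h) {x : D} {v : Fin 3 → ℝ}
    (hv : ∑ i, v i • E.field i x = 0) : v = 0 := by
  funext j
  have h1 : h.inner x (∑ i, v i • E.field i x) (E.field j x) = 0 := by rw [hv]; simp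
  rw [map_sum, sum_apply] at h1
  simpa [E.orthonormal] using h1

omit [IsManifold 𝓘(ℝ, Model3) ω D] in
/-- A function of the base point only. -/
theorem analyticOnSet_snd {f : D → ℝ} (hf : ContMDiff 𝓘(ℝ, Model3) 𝓘(ℝ, ℝ) ω f)
    (Ω : Set (ℝ × D)) : AnalyticOnSet Ω (fun p => f p.2) :=
  fun p _ => ContMDiffAt.comp p (g := f) (f := Prod.snd) (hf p.2) contMDiffAt_snd

theorem contMDiff_comp (E : GaussianFrame h) {c : BilinField D} (hc : c.IsAnalytic) (i j : Fin 3) :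
    ContMDiff 𝓘(ℝ, Model3) 𝓘(ℝ, ℝ) ω (E.comp c i j) := by
  intro x
  have h1 := ContMDiffAt.clm_bundle_apply₂ (F₁ := Model3) (F₂ := Model3) (F₃ := ℝ)
    (E₁ := fun x : D => TangentSpace 𝓘(ℝ, Model3) x)
    (E₂ := fun x : D => TangentSpace 𝓘(ℝ, Model3) x) (E₃ := Bundle.Trivial D ℝ)
    (hc x) (E.analytic i x) (E.analytic j x)
  rw [contMDiffAt_totalSpace] at h1
  exact h1.2

end GaussianFrame

namespace SignatureChangingSpacetime

/-- Components of the metrics of the slices of constant time. -/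
noncomputable def spatialGram (M : SignatureChangingSpacetime h) (E : GaussianFrame h)
    (p : ℝ × D) : Matrix (Fin 3) (Fin 3) ℝ :=
  Matrix.of fun i j => E.comp (M.spatial p.1) i j p.2

variable (M : SignatureChangingSpacetime h) (E : GaussianFrame h)

theorem isNormalNeighbourhood : IsNormalNeighbourhood M.carrier :=
  ⟨M.isOpen_carrier, M.zero_mem, M.ordConnected_fiber⟩

theorem spatialGram_mem (i j : Fin 3) :
    AnalyticOnSet M.carrier (fun p => M.spatialGram E p i j) := by
  intro p hp
  have h0 := (M.spatial_analytic).contMDiffAt (M.isOpen_carrier.mem_nhds hp)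
  have h2 : ∀ i, ContMDiffAt (𝓘(ℝ, ℝ).prod 𝓘(ℝ, Model3)) 𝓘(ℝ, Model3).tangent ω
      (fun q : ℝ × D => (⟨q.2, E.field i q.2⟩ : TangentBundle 𝓘(ℝ, Model3) D)) p := fun i =>
    ContMDiffAt.comp p (f := Prod.snd) (E.analytic i p.2) contMDiffAt_snd
  have h1 := ContMDiffAt.clm_bundle_apply₂ (F₁ := Model3) (F₂ := Model3) (F₃ := ℝ)
    (E₁ := fun x : D => TangentSpace 𝓘(ℝ, Model3) x)
    (E₂ := fun x : D => TangentSpace 𝓘(ℝ, Model3) x) (E₃ := Bundle.Trivial D ℝ)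
    h0 (h2 i) (h2 j)
  rw [contMDiffAt_totalSpace] at h1
  exact h1.2

theorem spatialGram_symm (i j : Fin 3) (p : ℝ × D) (hp : p ∈ M.carrier) :
    M.spatialGram E p i j = M.spatialGram E p j i := M.spatial_symm p.1 p.2 hp _ _

/-- A kernel vector of the Gram matrix would be the coordinate vector of a nonzero tangent vector of
length zero. -/
theorem spatialGram_det_ne (p : ℝ × D) (hp : p ∈ M.carrier) : (M.spatialGram E p).det ≠ 0 := by
  intro h0
  obtain ⟨v, hv0, hv⟩ := Matrix.exists_mulVec_eq_zero_iff.2 h0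
  set u : TangentSpace 𝓘(ℝ, Model3) p.2 := ∑ i, v i • E.field i p.2 with hu
  have hu0 : u ≠ 0 := fun h => hv0 (E.eq_zero_of_sum_smul_eq_zero h)
  have h1 := M.spatial_pos p.1 p.2 hp u hu0
  have h2 : M.spatial p.1 p.2 u u = ∑ i, v i * (M.spatialGram E p).mulVec v i := by
    conv_lhs => rw [hu]
    rw [map_sum]
    refine Finset.sum_congr rfl fun i _ => ?_
    rw [map_smul, smul_eq_mul, M.spatial_symm p.1 p.2 hp, map_sum]
    congr 1
    rw [Matrix.mulVec, dotProduct]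
    refine Finset.sum_congr rfl fun j _ => ?_
    rw [map_smul, smul_eq_mul, mul_comm]
    rfl
  rw [h2, hv] at h1
  simp at h1

theorem spatialGram_zero (x : D) : M.spatialGram E (0, x) = 1 := by
  ext i j
  simp only [spatialGram, GaussianFrame.comp, Matrix.of_apply, M.spatial_zero, E.orthonormal,
    Matrix.one_apply]

theorem blockMetric {ε : ℝ} (hε : ε * ε = 1) :
    BlockMetric M.carrier (AnalyticOnSet M.carrier) (frameDir E) ε (M.spatialGram E) where
  calculus := frameCalculus E M.isOpen_carrier
  sign := hε
  mem := M.spatialGram_mem E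
  symm := M.spatialGram_symm E
  det_ne := M.spatialGram_det_ne E

theorem gram_eq (p : ℝ × D) :
    M.gram E p = blockGram (signatureSign p.1) (M.spatialGram E) p := by
  ext a b
  refine Fin.cases ?_ (fun i => ?_) a <;> refine Fin.cases ?_ (fun j => ?_) b <;>
    simp [gram, metric, frameVec, blockGram, spatialGram, GaussianFrame.comp]

theorem signatureSign_mul {s t : ℝ} (hs : s = 1 ∨ s = -1) (h : 0 < s * t) :
    signatureSign t = s := by
  rcases hs with rfl | rfl
  · have : 0 < t := by linarith
    simp [signatureSign, this]
  · have : ¬ 0 < t := by linarith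
    simp [signatureSign, this]

/-- On each side of the hypersurface the sign in the metric can be taken to be constant. -/
theorem riemannTensor_gram_eq {s : ℝ} (hs : s = 1 ∨ s = -1) {p : ℝ × D} (hp : p ∈ M.carrier)
    (hp' : 0 < s * p.1) (e c a b : Fin 4) :
    riemannTensor (frameDir E) (M.gram E) e c a b p =
      riemannTensor (frameDir E) (blockGram s (M.spatialGram E)) e c a b p := by
  have hΩ : IsOpen (M.carrier ∩ {q | 0 < s * q.1}) :=
    M.isOpen_carrier.inter (isOpen_lt continuous_const (by fun_prop))
  refine (frameCalculus E hΩ).riemannTensor_congr (fun q hq => ?_) e c a b ⟨hp, hp'⟩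
  rw [gram_eq, signatureSign_mul hs hq.2]

theorem ricciTensor_gram_eq {s : ℝ} (hs : s = 1 ∨ s = -1) {p : ℝ × D} (hp : p ∈ M.carrier)
    (hp' : 0 < s * p.1) (a b : Fin 4) :
    ricciTensor (frameDir E) (M.gram E) a b p =
      ricciTensor (frameDir E) (blockGram s (M.spatialGram E)) a b p :=
  Finset.sum_congr rfl fun _ _ => M.riemannTensor_gram_eq E hs hp hp' _ _ _ _

theorem exists_sign {t : ℝ} (ht : t ≠ 0) : ∃ s : ℝ, (s = 1 ∨ s = -1) ∧ 0 < s * t := by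
  rcases lt_or_gt_of_ne ht with h | h
  · exact ⟨-1, Or.inr rfl, by linarith⟩
  · exact ⟨1, Or.inl rfl, by linarith⟩

variable {M E}

/-- A vacuum spacetime with constant sign `s` on all of `M` is Ricci flat on all of `M`, by
analyticity. -/
theorem IsVacuum.ricciTensor_eq_zero (hM : M.IsVacuum E) {s : ℝ} (hs : s = 1 ∨ s = -1)
    (a b : Fin 4) : ∀ p ∈ M.carrier,
      ricciTensor (frameDir E) (blockGram s (M.spatialGram E)) a b p = 0 := by
  have hs2 : s * s = 1 := by rcases hs with rfl | rfl <;> norm_num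
  have B := M.blockMetric E hs2
  refine M.isNormalNeighbourhood.eq_zero_of_sign (s := s) ?_ ?_ ?_
  · refine B.calculus.ricciTensor_mem (fun i j => ?_) (fun p hp => ?_) a b
    · refine Fin.cases ?_ (fun i => ?_) i <;> refine Fin.cases ?_ (fun j => ?_) j
      · exact B.calculus.const _
      · exact B.calculus.const _
      · exact B.calculus.const _
      · exact B.mem i j
    -- A singular matrix has the default inverse `0`, whereas the computed inverse has the entry `-s
    -- ≠ 0` in the time direction.
    · have h1 := blockGram_inv hs2 (M.spatialGram E) (B.det_ne p hp)
      intro h0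
      have h2 := Matrix.nonsing_inv_apply_not_isUnit (blockGram s (M.spatialGram E) p)
        (by rw [h0]; simp)
      rw [h1] at h2
      have h3 := congrFun (congrFun h2 0) 0
      simp [blockGram] at h3
      rw [h3] at hs2; norm_num at hs2
  · rintro rfl; norm_num at hs2
  · intro p hp hp'
    rw [← M.ricciTensor_gram_eq E hs hp hp']
    refine hM p hp ?_ a b
    intro h0
    rw [h0] at hp'; simp at hp'

/-- The signature change splits the vacuum equations: the slices are Ricci flat, and so the evolution
is that of a homogeneous spacetime. -/
theorem IsVacuum.spatial_and_evolution (hM : M.IsVacuum E) (i j : Fin 3) :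
    ∀ p ∈ M.carrier,
      ricciTensor (fun i : Fin 3 => frameDir E i.succ) (M.spatialGram E) i j p = 0 ∧
      frameDir E 0 (frameDir E 0 (fun q => M.spatialGram E q j i)) p +
          (∑ l, weingarten (frameDir E) (M.spatialGram E) l l p) *
            frameDir E 0 (fun q => M.spatialGram E q j i) p -
          ∑ m, frameDir E 0 (fun q => M.spatialGram E q j m) p *
            weingarten (frameDir E) (M.spatialGram E) m i p -
          ∑ l, weingarten (frameDir E) (M.spatialGram E) l j p *
            frameDir E 0 (fun q => M.spatialGram E q l i) p = 0 := by
  intro p hp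
  -- The equations have the form `A + ½ B = 0` and `A - ½ B = 0` at the same point, hence `A = B =
  -- 0`.
  have h1 := hM.ricciTensor_eq_zero (Or.inl rfl) i.succ j.succ p hp
  have h2 := hM.ricciTensor_eq_zero (Or.inr rfl) i.succ j.succ p hp
  rw [(M.blockMetric E (by norm_num)).ricci_succ_succ i j hp] at h1 h2
  constructor <;> linarith

variable {c : BilinField D}

theorem HasVelocity.frameDir_spatialGram (hM : M.HasVelocity c) (i j : Fin 3) (x : D) :
    frameDir E 0 (fun q => M.spatialGram E q i j) (0, x) = E.comp c i j x :=
  (hM x (E.field i x) (E.field j x)).deriv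

end SignatureChangingSpacetime
end Spacetime

/-! ### Integration of the evolution equation; the slices are diagonal -/

section Diagonalisation

variable {D : Type*} [TopologicalSpace D] [ChartedSpace Model3 D] [IsManifold 𝓘(ℝ, Model3) ω D]
  {h : AnalyticMetric D} {M : SignatureChangingSpacetime h} {E : GaussianFrame h}
  {c : BilinField D}

omit [IsManifold 𝓘(ℝ, Model3) ω D] in
theorem analyticOnSet_fst (Ω : Set (ℝ × D)) : AnalyticOnSet Ω Prod.fst :=
  fun _ _ => contMDiffAt_fst

/-- The eigenvalues `½ cᵢ` of the second fundamental form of the hypersurface. -/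
noncomputable def GaussianFrame.kappa (E : GaussianFrame h) (c : BilinField D) (i : Fin 3)
    (x : D) : ℝ := 1 / 2 * E.comp c i i x

theorem GaussianFrame.contMDiff_kappa (E : GaussianFrame h) (hc : c.IsAnalytic) (i : Fin 3) :
    ContMDiff 𝓘(ℝ, Model3) 𝓘(ℝ, ℝ) ω (E.kappa c i) :=
  contMDiff_const.mul (E.contMDiff_comp hc i i)

/-- The mean curvature `½ ∑ cᵢ` of the hypersurface. -/
noncomputable def GaussianFrame.meanKappa (E : GaussianFrame h) (c : BilinField D) (x : D) : ℝ :=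
  ∑ i, E.kappa c i x

namespace SignatureChangingSpacetime

theorem frameDir_zero_snd (E : GaussianFrame h) (f : D → ℝ) (p : ℝ × D) :
    frameDir E 0 (fun q => f q.2) p = 0 := deriv_const p.1 (f p.2)

theorem frameDir_zero_fst (E : GaussianFrame h) (p : ℝ × D) :
    frameDir E 0 Prod.fst p = 1 := deriv_id _

theorem analyticOnSet_kappa (hc : c.IsAnalytic) (i : Fin 3) (Ω : Set (ℝ × D)) :
    AnalyticOnSet Ω (fun p => E.kappa c i p.2) :=
  GaussianFrame.analyticOnSet_snd (E.contMDiff_kappa hc i) Ω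

theorem analyticOnSet_meanKappa (hc : c.IsAnalytic) (hΩ : IsOpen M.carrier) :
    AnalyticOnSet M.carrier (fun p => E.meanKappa c p.2) :=
  (frameCalculus E hΩ).sum _ fun i _ => analyticOnSet_kappa hc i M.carrier

theorem HasVelocity.weingarten_zero (hM : M.HasVelocity c) (i j : Fin 3) (x : D) :
    weingarten (frameDir E) (M.spatialGram E) i j (0, x) = 1 / 2 * E.comp c i j x := by
  rw [weingarten, M.spatialGram_zero E x, inv_one]
  simp [Matrix.one_apply, hM.frameDir_spatialGram]

theorem frameDir_one_add_meanKappa (hc : c.IsAnalytic) {f : ℝ × D → ℝ}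
    (hf : AnalyticOnSet M.carrier f) {p : ℝ × D} (hp : p ∈ M.carrier) :
    frameDir E 0 (fun q => (1 + E.meanKappa c q.2 * q.1) * f q) p =
      E.meanKappa c p.2 * f p + (1 + E.meanKappa c p.2 * p.1) * frameDir E 0 f p := by
  have C := frameCalculus E M.isOpen_carrier
  have hK : AnalyticOnSet M.carrier (fun p => E.meanKappa c p.2) :=
    analyticOnSet_meanKappa hc M.isOpen_carrier
  have h1 := C.mul hK (analyticOnSet_fst M.carrier)
  rw [C.dir_mul 0 (C.add (C.const 1) h1) hf p hp, C.dir_add 0 (C.const 1) h1 p hp,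
    C.dir_const 0 1 p hp, C.dir_mul 0 hK (analyticOnSet_fst M.carrier) p hp,
    frameDir_zero_snd E (E.meanKappa c), frameDir_zero_fst]
  ring

theorem analyticOnSet_one_add_meanKappa (hc : c.IsAnalytic) {f : ℝ × D → ℝ}
    (hf : AnalyticOnSet M.carrier f) :
    AnalyticOnSet M.carrier (fun q => (1 + E.meanKappa c q.2 * q.1) * f q) := by
  have C := frameCalculus E M.isOpen_carrier
  have hK : AnalyticOnSet M.carrier (fun p => E.meanKappa c p.2) :=
    analyticOnSet_meanKappa hc M.isOpen_carrier
  exact C.mul (C.add (C.const 1) (C.mul hK (analyticOnSet_fst M.carrier))) hf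

/-- The trace `k` of `W` satisfies `k' = -k²`, so `u = (1 + K t) k - K` solves `u' = -k u` with `u =
0` at `t = 0`, hence vanishes. Then `((1 + K t) W)' = -u W = 0`, and the initial value is `½ c`. The
product form avoids dividing by `1 + K t` before it is known to have no zeros. -/
theorem IsVacuum.weingarten_eq (hM : M.IsVacuum E) (hv : M.HasVelocity c) (hc : c.IsAnalytic) :
    ∀ p ∈ M.carrier, ∀ i j, (1 + E.meanKappa c p.2 * p.1) *
      weingarten (frameDir E) (M.spatialGram E) i j p = 1 / 2 * E.comp c i j p.2 := by
  have B := M.blockMetric E (ε := 1) (by norm_num)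
  have C := B.calculus
  have N := M.isNormalNeighbourhood
  set W := weingarten (frameDir E) (M.spatialGram E) with hW
  set k : ℝ × D → ℝ := fun p => ∑ l, W l l p with hk
  have hWm : ∀ i j, AnalyticOnSet M.carrier (W i j) := B.weingarten_mem
  have hkm : AnalyticOnSet M.carrier k := C.sum _ fun l _ => hWm l l
  have hdW : ∀ i j, ∀ p ∈ M.carrier, frameDir E 0 (W i j) p = -(k p) * W i j p := fun i j p hp =>
    B.dir_weingarten_of_evolution (fun i j p hp => (hM.spatial_and_evolution i j p hp).2) i j hp
  have hdk : ∀ p ∈ M.carrier, frameDir E 0 k p = -(k p) * k p := by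
    intro p hp
    rw [C.dir_sum 0 _ (fun l _ => hWm l l) hp]
    simp only [hdW _ _ p hp, ← Finset.mul_sum]
    rfl
  have hK : AnalyticOnSet M.carrier (fun p => E.meanKappa c p.2) :=
    analyticOnSet_meanKappa hc M.isOpen_carrier
  have hk0 : ∀ p ∈ M.carrier, (1 + E.meanKappa c p.2 * p.1) * k p - E.meanKappa c p.2 = 0 := by
    refine N.eq_zero_of_linear E (g := fun p => -(k p))
      (C.sub (analyticOnSet_one_add_meanKappa hc hkm) hK) (C.neg hkm) (fun p hp => ?_)
      (fun x => ?_)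
    · rw [C.dir_sub 0 (analyticOnSet_one_add_meanKappa hc hkm) hK hp,
        frameDir_one_add_meanKappa hc hkm hp, frameDir_zero_snd E (E.meanKappa c), hdk p hp]
      ring
    · simp only [hk, hW, hv.weingarten_zero, GaussianFrame.meanKappa, GaussianFrame.kappa]
      ring
  intro p hp i j
  have hcm : AnalyticOnSet M.carrier (fun p => 1 / 2 * E.comp c i j p.2) :=
    C.const_mul _ (GaussianFrame.analyticOnSet_snd (E.contMDiff_comp hc i j) _)
  have h1 := N.eq_zero_of_linear E (g := fun _ => 0)
    (f := fun p => (1 + E.meanKappa c p.2 * p.1) * W i j p - 1 / 2 * E.comp c i j p.2)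
    (C.sub (analyticOnSet_one_add_meanKappa hc (hWm i j)) hcm) (C.const 0) (fun p hp => ?_)
    (fun x => ?_) p hp
  · linear_combination h1
  · rw [C.dir_sub 0 (analyticOnSet_one_add_meanKappa hc (hWm i j)) hcm hp,
      frameDir_one_add_meanKappa hc (hWm i j) hp,
      frameDir_zero_snd E (fun x => 1 / 2 * E.comp c i j x), hdW i j p hp]
    linear_combination -(W i j p) * hk0 p hp
  · simp only [hW, hv.weingarten_zero]
    ring

/-- Consequences of the vacuum equations for the metrics of the slices, with logarithmic
coefficients `φᵢ`. -/
structure SlicesData (M : SignatureChangingSpacetime h) (E : GaussianFrame h) (c : BilinField D)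
    (φ : Fin 3 → ℝ × D → ℝ) : Prop where
  mem : ∀ i, AnalyticOnSet M.carrier (φ i)
  gram : ∀ p ∈ M.carrier, M.spatialGram E p = diagGram φ p
  zero : ∀ i x, φ i (0, x) = 0
  deriv : ∀ i, ∀ p ∈ M.carrier,
    (1 + E.meanKappa c p.2 * p.1) * frameDir E 0 (φ i) p = E.kappa c i p.2
  ricci : ∀ i j, ∀ p ∈ M.carrier, ricciTensor (fun i : Fin 3 => frameDir E i.succ) (diagGram φ) i j p = 0
  vacuum : ∀ a b, ∀ p ∈ M.carrier, ricciTensor (frameDir E) (blockGram 1 (diagGram φ)) a b p = 0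

/-- The Weingarten map inherits the diagonal form of `c`. Then each entry satisfies the linear
equation `γᵢⱼ' = 2 Wⱼⱼ γᵢⱼ`, so entries that vanish initially vanish for all `t`. The diagonal
entries are positive and have analytic logarithms. -/
theorem IsVacuum.exists_slicesData (hM : M.IsVacuum E) (hv : M.HasVelocity c) (hc : c.IsAnalytic)
    (hdiag : ∀ i j, i ≠ j → ∀ x, E.comp c i j x = 0) : ∃ φ, SlicesData M E c φ := by
  have B := M.blockMetric E (ε := 1) (by norm_num)
  have C := B.calculus
  have N := M.isNormalNeighbourhood
  set W := weingarten (frameDir E) (M.spatialGram E) with hW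
  have hW1 := hM.weingarten_eq hv hc
  -- At a zero of this factor every `κᵢ = (1 + K t) Wᵢᵢ` would vanish, hence also `K`, and the
  -- factor would be `1`.
  have hK0 : ∀ p ∈ M.carrier, 1 + E.meanKappa c p.2 * p.1 ≠ 0 := by
    intro p hp h0
    have h1 : E.meanKappa c p.2 = 0 := by
      rw [GaussianFrame.meanKappa]
      refine Finset.sum_eq_zero fun i _ => ?_
      rw [GaussianFrame.kappa, ← hW1 p hp i i, h0, zero_mul]
    rw [h1] at h0
    norm_num at h0
  have hWoff : ∀ i j, i ≠ j → ∀ p ∈ M.carrier, W i j p = 0 := by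
    intro i j hij p hp
    have h1 := hW1 p hp i j
    rw [hdiag i j hij, mul_zero] at h1
    exact (mul_eq_zero.1 h1).resolve_left (hK0 p hp)
  have hγ' : ∀ i j, ∀ p ∈ M.carrier, frameDir E 0 (fun q => M.spatialGram E q i j) p =
      2 * W j j p * M.spatialGram E p i j := by
    intro i j p hp
    have h1 := B.weingarten_spec i j hp
    rw [Finset.sum_eq_single j (fun m _ hm => by rw [← hW, hWoff m j hm p hp, mul_zero])
      (by simp)] at h1
    linear_combination -2 * h1
  have hoff : ∀ i j, i ≠ j → ∀ p ∈ M.carrier, M.spatialGram E p i j = 0 := fun i j hij =>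
    N.eq_zero_of_linear E (M.spatialGram_mem E i j) (C.const_mul 2 (B.weingarten_mem j j)) (hγ' i j)
      (fun x => by rw [M.spatialGram_zero E x, Matrix.one_apply_ne hij])
  have hpos : ∀ i, ∀ p ∈ M.carrier, 0 < M.spatialGram E p i i := by
    intro i p hp
    refine M.spatial_pos p.1 p.2 hp _ fun h0 => ?_
    have h1 := E.orthonormal i i p.2
    rw [h0] at h1
    simp at h1
  set φ : Fin 3 → ℝ × D → ℝ := fun i p => 1 / 2 * Real.log (M.spatialGram E p i i) with hφ
  have hφm : ∀ i, AnalyticOnSet M.carrier (φ i) := fun i =>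
    C.const_mul _ (C.log (M.spatialGram_mem E i i) (hpos i))
  have hgram : ∀ p ∈ M.carrier, M.spatialGram E p = diagGram φ p := by
    intro p hp
    ext i j
    by_cases hij : i = j
    · subst hij
      rw [diagGram, Matrix.diagonal_apply_eq]
      have h1 : 2 * φ i p = Real.log (M.spatialGram E p i i) := by rw [hφ]; ring
      rw [h1, Real.exp_log (hpos i p hp)]
    · rw [hoff i j hij p hp, diagGram, Matrix.diagonal_apply_ne _ hij]
  refine ⟨φ, hφm, hgram, fun i x => ?_, fun i p hp => ?_, fun i j p hp => ?_, fun a b p hp => ?_⟩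
  · simp [hφ, M.spatialGram_zero E x]
  · have h1 : frameDir E 0 (φ i) p = W i i p := by
      rw [C.dir_const_mul 0 _ (C.log (M.spatialGram_mem E i i) (hpos i)) hp,
        C.dir_log 0 (M.spatialGram_mem E i i) hp (hpos i p hp), hγ' i i p hp]
      have := (hpos i p hp).ne'
      field_simp
    rw [h1]
    exact hW1 p hp i i
  · rw [← B.spatial_calc.ricciTensor_congr hgram i j hp]
    exact (hM.spatial_and_evolution i j p hp).1
  · rw [← hM.ricciTensor_eq_zero (Or.inl rfl) a b p hp]
    refine C.ricciTensor_congr (fun q hq => ?_) a b hp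
    have h1 := hgram q hq
    simp only [blockGram, h1]

variable {φ : Fin 3 → ℝ × D → ℝ}

theorem SlicesData.one_add_ne_zero (hφ : SlicesData M E c φ) {p : ℝ × D} (hp : p ∈ M.carrier) :
    1 + E.meanKappa c p.2 * p.1 ≠ 0 := by
  intro h0
  have h1 : E.meanKappa c p.2 = 0 := by
    rw [GaussianFrame.meanKappa]
    refine Finset.sum_eq_zero fun i _ => ?_
    rw [← hφ.deriv i p hp, h0, zero_mul]
  rw [h1] at h0
  norm_num at h0

theorem SlicesData.deriv_deriv (hφ : SlicesData M E c φ) (hc : c.IsAnalytic) (i : Fin 3)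
    {p : ℝ × D} (hp : p ∈ M.carrier) :
    E.meanKappa c p.2 * frameDir E 0 (φ i) p +
      (1 + E.meanKappa c p.2 * p.1) * frameDir E 0 (frameDir E 0 (φ i)) p = 0 := by
  have C := frameCalculus E M.isOpen_carrier
  rw [← frameDir_one_add_meanKappa hc (C.dir 0 (hφ.mem i)) hp,
    C.dir_congr 0 (hφ.deriv i) p hp, frameDir_zero_snd E (E.kappa c i)]

end SignatureChangingSpacetime
end Diagonalisation

/-! ### Analytic functions on `D` -/

section Surface

variable {D : Type*} [TopologicalSpace D] [ChartedSpace Model3 D] [IsManifold 𝓘(ℝ, Model3) ω D]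
  {h : AnalyticMetric D}

theorem ContMDiffAt.analyticAt_chart {f : D → ℝ} {x₀ z : D}
    (hz : z ∈ (extChartAt 𝓘(ℝ, Model3) x₀).source)
    (hf : ContMDiffAt 𝓘(ℝ, Model3) 𝓘(ℝ, ℝ) ω f z) :
    AnalyticAt ℝ (fun y => f ((extChartAt 𝓘(ℝ, Model3) x₀).symm y))
      (extChartAt 𝓘(ℝ, Model3) x₀ z) := by
  set ξ := extChartAt 𝓘(ℝ, Model3) x₀ with hξ
  have h1 : ContMDiffAt 𝓘(ℝ, Model3) 𝓘(ℝ, Model3) ω ξ.symm (ξ z) :=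
    (contMDiffOn_extChartAt_symm (I := 𝓘(ℝ, Model3)) x₀).contMDiffAt
      ((isOpen_extChartAt_target x₀).mem_nhds (ξ.map_source hz))
  have h3 : ContMDiffAt 𝓘(ℝ, Model3) 𝓘(ℝ, ℝ) ω (fun y => f (ξ.symm y)) (ξ z) :=
    ContMDiffAt.comp (ξ z) (g := f) (f := ξ.symm) (by rwa [ξ.left_inv hz]) h1
  exact h3.contDiffAt.analyticAt

omit [IsManifold 𝓘(ℝ, Model3) ω D] in
/-- Neighbourhoods that are balls in a chart. -/
theorem exists_chart_ball (x : D) : ∃ r > 0,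
    Metric.ball (extChartAt 𝓘(ℝ, Model3) x x) r ⊆ (extChartAt 𝓘(ℝ, Model3) x).target ∧
    ∀ᶠ z in 𝓝 x, z ∈ (extChartAt 𝓘(ℝ, Model3) x).source ∧
      extChartAt 𝓘(ℝ, Model3) x z ∈ Metric.ball (extChartAt 𝓘(ℝ, Model3) x x) r := by
  obtain ⟨r, hr, hB⟩ := Metric.mem_nhds_iff.1 (extChartAt_target_mem_nhds (I := 𝓘(ℝ, Model3)) x)
  refine ⟨r, hr, hB, ?_⟩
  filter_upwards [extChartAt_source_mem_nhds (I := 𝓘(ℝ, Model3)) x,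
    (continuousAt_extChartAt (I := 𝓘(ℝ, Model3)) x).eventually (Metric.ball_mem_nhds _ hr)]
    with z hz1 hz2 using ⟨hz1, hz2⟩

/-- The identity theorem on a connected analytic manifold. -/
theorem eq_zero_of_eventuallyEq_zero [ConnectedSpace D] {f : D → ℝ}
    (hf : ContMDiff 𝓘(ℝ, Model3) 𝓘(ℝ, ℝ) ω f) {x₀ : D} (h0 : f =ᶠ[𝓝 x₀] 0) (x : D) : f x = 0 := by
  set U : Set D := {y | f =ᶠ[𝓝 y] 0} with hU
  have hopen : IsOpen U := isOpen_iff_mem_nhds.2 fun y hy => eventually_eventually_nhds.2 hy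
  -- Around a point of the closure, a chart ball contains the image of a point near which `f`
  -- vanishes; the identity theorem on the convex ball gives vanishing near the centre.
  have hclosed : IsClosed U := by
    refine isClosed_of_closure_subset fun y hy => ?_
    obtain ⟨r, hr, hB, hev⟩ := exists_chart_ball y
    set ξ := extChartAt 𝓘(ℝ, Model3) y with hξ
    obtain ⟨z, ⟨hzs, hzb⟩, hzU⟩ := mem_closure_iff_nhds.1 hy _ hev
    have hz0 : ∀ᶠ w in 𝓝 (ξ z), (fun w => f (ξ.symm w)) w = 0 := by
      have h1 := continuousAt_extChartAt_symm' (I := 𝓘(ℝ, Model3)) hzs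
      have h2 : Tendsto ξ.symm (𝓝 (ξ z)) (𝓝 z) := by
        have h3 := h1.tendsto
        rwa [ξ.left_inv hzs] at h3
      exact h2.eventually hzU
    have han : AnalyticOnNhd ℝ (fun w => f (ξ.symm w)) (Metric.ball (ξ y) r) := by
      intro w hw
      have h1 := (hf (ξ.symm w)).analyticAt_chart (ξ.map_target (hB hw))
      rwa [← hξ, ξ.right_inv (hB hw)] at h1
    have hzero := han.eqOn_zero_of_preconnected_of_eventuallyEq_zero
      (convex_ball (ξ y) r).isPreconnected hzb hz0
    filter_upwards [hev] with w hw
    have h5 : f (ξ.symm (ξ w)) = 0 := hzero hw.2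
    rw [ξ.left_inv hw.1] at h5
    exact h5
  have := IsClopen.eq_univ ⟨hclosed, hopen⟩ ⟨x₀, h0⟩
  have hx : x ∈ U := by rw [this]; trivial
  exact hx.self_of_nhds

namespace GaussianFrame

variable (E : GaussianFrame h)

theorem frame_expansion (x : D) (v : TangentSpace 𝓘(ℝ, Model3) x) :
    v = ∑ i, h.inner x (E.field i x) v • E.field i x := by
  have hli : LinearIndependent ℝ (fun i => E.field i x) :=
    Fintype.linearIndependent_iff.2 fun g hg => congrFun (E.eq_zero_of_sum_smul_eq_zero hg)
  have hcard : Fintype.card (Fin 3) = Module.finrank ℝ (TangentSpace 𝓘(ℝ, Model3) x) := by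
    change _ = Module.finrank ℝ Model3
    simp
  have : FiniteDimensional ℝ (TangentSpace 𝓘(ℝ, Model3) x) :=
    inferInstanceAs (FiniteDimensional ℝ Model3)
  set b := basisOfLinearIndependentOfCardEqFinrank hli hcard with hb
  have hbi : ∀ i, b i = E.field i x := fun i => by simp [hb]
  have h1 : v = ∑ i, b.repr v i • E.field i x := by
    conv_lhs => rw [← b.sum_repr v]
    simp only [hbi]
  have h2 : ∀ i, h.inner x (E.field i x) v = b.repr v i := by
    intro i
    conv_lhs => rw [h1]
    rw [map_sum]
    simp [E.orthonormal]
  simp only [h2]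
  exact h1

/-- A differential that vanishes on a frame is zero. So `f` is constant on chart balls, thus locally
constant, thus constant by connectedness. -/
theorem eq_of_dir_eq_zero [ConnectedSpace D] {f : D → ℝ}
    (hf : ContMDiff 𝓘(ℝ, Model3) 𝓘(ℝ, ℝ) ω f) (h0 : ∀ i x, E.dir i f x = 0) (x y : D) :
    f x = f y := by
  have hm : ∀ z, mfderiv 𝓘(ℝ, Model3) 𝓘(ℝ, ℝ) f z = 0 := by
    intro z
    ext v
    have h1 := E.frame_expansion z v
    rw [h1, map_sum]
    simp only [map_smul]
    exact Finset.sum_eq_zero fun i _ => by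
      have h2 : mfderiv 𝓘(ℝ, Model3) 𝓘(ℝ, ℝ) f z (E.field i z) = 0 := h0 i z
      rw [h2, smul_zero]
  have hloc : IsLocallyConstant f := by
    refine (IsLocallyConstant.iff_eventually_eq f).2 fun z => ?_
    obtain ⟨r, hr, hB, hev⟩ := exists_chart_ball z
    set ξ := extChartAt 𝓘(ℝ, Model3) z with hξ
    have hd : ∀ w ∈ Metric.ball (ξ z) r, HasFDerivAt (fun y => f (ξ.symm y)) (0 : Model3 →L[ℝ] ℝ) w := by
      intro w hw
      have hws := ξ.map_target (hB hw)
      have h1 := (hf (ξ.symm w)).analyticAt_chart hws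
      rw [← hξ, ξ.right_inv (hB hw)] at h1
      have h2 := h1.differentiableAt.hasFDerivAt
      have h3 : fderiv ℝ (fun y => f (ξ.symm y)) w = 0 := by
        have h4 := mfderiv_comp_mfderivWithin (I := 𝓘(ℝ, Model3)) (I' := 𝓘(ℝ, Model3))
          (I'' := 𝓘(ℝ, ℝ)) (g := f) (f := ξ.symm) (x := w)
          ((hf _).mdifferentiableAt (by simp)) (mdifferentiableWithinAt_extChartAt_symm (hB hw))
          (by simpa using uniqueMDiffWithinAt_univ 𝓘(ℝ, Model3))
        rw [hm, ContinuousLinearMap.zero_comp] at h4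
        simp [Function.comp_def] at h4
        exact h4
      rwa [h3] at h2
    have hconst : ∀ w ∈ Metric.ball (ξ z) r, f (ξ.symm w) = f (ξ.symm (ξ z)) := fun w hw => (convex_ball (ξ z) r).is_const_of_fderivWithin_eq_zero (𝕜 := ℝ)
      (f := fun y => f (ξ.symm y)) (fun w hw => (hd w hw).differentiableAt.differentiableWithinAt)
      (fun w hw => by
        rw [fderivWithin_of_isOpen Metric.isOpen_ball hw, (hd w hw).fderiv])
      hw (Metric.mem_ball_self hr)
    filter_upwards [hev] with w hw
    have h5 := hconst _ hw.2
    simpa only [ξ.left_inv hw.1, ξ.left_inv (mem_extChartAt_source z)] using h5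
  exact hloc.apply_eq_of_preconnectedSpace x y

theorem dir_congr_of_eventuallyEq (i : Fin 3) {f g : D → ℝ} {x : D} (hfg : f =ᶠ[𝓝 x] g) :
    E.dir i f x = E.dir i g x := by
  have h3 : mfderiv 𝓘(ℝ, Model3) 𝓘(ℝ, ℝ) f x = mfderiv 𝓘(ℝ, Model3) 𝓘(ℝ, ℝ) g x :=
    hfg.mfderiv_eq
  exact congrArg (fun L => L (E.field i x)) h3

/-- Functions on `D` with the derivatives along a Gaussian frame. -/
theorem calculus : FrameCalculus (univ : Set D) (ContMDiff 𝓘(ℝ, Model3) 𝓘(ℝ, ℝ) ω) E.dir := by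
  have C := SignatureChangingSpacetime.frameCalculus E (isOpen_univ (X := ℝ × D))
  -- Functions on `D` are the functions on `ℝ × D` independent of `t`; every rule is obtained from
  -- `ℝ × D` by restriction to `t = 0`.
  have lift : ∀ {f : D → ℝ}, ContMDiff 𝓘(ℝ, Model3) 𝓘(ℝ, ℝ) ω f →
      AnalyticOnSet (univ : Set (ℝ × D)) (fun p => f p.2) := fun hf => analyticOnSet_snd hf _
  have desc : ∀ {f : D → ℝ}, AnalyticOnSet (univ : Set (ℝ × D)) (fun p => f p.2) →
      ContMDiff 𝓘(ℝ, Model3) 𝓘(ℝ, ℝ) ω f := fun hf x =>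
    ContMDiffAt.comp x (g := fun p : ℝ × D => _) (f := fun x => ((0 : ℝ), x)) (hf (0, x) trivial)
      (contMDiffAt_const.prodMk contMDiffAt_id)
  exact
  { const := fun r => contMDiff_const
    add := fun hf hg => desc (C.add (lift hf) (lift hg))
    mul := fun hf hg => desc (C.mul (lift hf) (lift hg))
    comp := fun hf hφ => desc (C.comp (lift hf) fun p _ => hφ p.2 trivial)
    congr := fun hf hfg => desc (C.congr (lift hf) fun p _ => hfg p.2 trivial)
    dir := fun a f hf => desc (C.dir a.succ (lift hf))
    dir_congr := fun a f g hfg x _ => C.dir_congr a.succ (f := fun p => f p.2)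
      (g := fun p => g p.2) (fun p _ => hfg p.2 trivial) (0, x) trivial
    dir_const := fun a r x _ => C.dir_const a.succ r (0, x) trivial
    dir_add := fun a f g hf hg x _ => C.dir_add a.succ (lift hf) (lift hg) (0, x) trivial
    dir_mul := fun a f g hf hg x _ => C.dir_mul a.succ (lift hf) (lift hg) (0, x) trivial
    dir_comp := fun a φ f hf x _ hφ => C.dir_comp a.succ (lift hf) (0, x) trivial hφ
    dir_comm := fun a b f hf x _ => C.dir_comm a.succ b.succ (lift hf) (0, x) trivial }

end GaussianFrame
end Surface

/-! ### Expansion of the vacuum equations to second order at the hypersurface -/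

section Jets

variable {D : Type*} [TopologicalSpace D] [ChartedSpace Model3 D] [IsManifold 𝓘(ℝ, Model3) ω D]
  {h : AnalyticMetric D} {M : SignatureChangingSpacetime h} {E : GaussianFrame h}
  {c : BilinField D} {φ : Fin 3 → ℝ × D → ℝ}

namespace SignatureChangingSpacetime

/-- `F = b t + ½ b' t² + O(t³)` near the hypersurface. -/
structure HasJet (M : SignatureChangingSpacetime h) (E : GaussianFrame h) (F : ℝ × D → ℝ)
    (b b' : D → ℝ) : Prop where
  mem : AnalyticOnSet M.carrier F
  zero : ∀ x, F (0, x) = 0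
  one : ∀ x, frameDir E 0 F (0, x) = b x
  two : ∀ x, frameDir E 0 (frameDir E 0 F) (0, x) = b' x

namespace HasJet

variable {F G : ℝ × D → ℝ} {b b' e e' : D → ℝ}

theorem add (hF : HasJet M E F b b') (hG : HasJet M E G e e') :
    HasJet M E (fun p => F p + G p) (fun x => b x + e x) (fun x => b' x + e' x) := by
  have C := frameCalculus E M.isOpen_carrier
  refine ⟨C.add hF.mem hG.mem, fun x => ?_, fun x => ?_, fun x => ?_⟩
  · rw [hF.zero, hG.zero, add_zero]
  · rw [C.dir_add 0 hF.mem hG.mem _ (M.zero_mem x), hF.one, hG.one]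
  · rw [C.dir_congr 0 (C.dir_add 0 hF.mem hG.mem) _ (M.zero_mem x),
      C.dir_add 0 (C.dir 0 hF.mem) (C.dir 0 hG.mem) _ (M.zero_mem x), hF.two, hG.two]

theorem dir_mul_dir {F G : ℝ × D → ℝ} (hF : AnalyticOnSet M.carrier F)
    (hG : AnalyticOnSet M.carrier G) {p : ℝ × D} (hp : p ∈ M.carrier) :
    frameDir E 0 (frameDir E 0 (fun q => F q * G q)) p =
      frameDir E 0 (frameDir E 0 F) p * G p + 2 * (frameDir E 0 F p * frameDir E 0 G p) +
        F p * frameDir E 0 (frameDir E 0 G) p := by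
  have C := frameCalculus E M.isOpen_carrier
  have h1 := C.dir 0 hF
  have h2 := C.dir 0 hG
  rw [C.dir_congr 0 (C.dir_mul 0 hF hG) p hp, C.dir_add 0 (C.mul h1 hG) (C.mul hF h2) p hp,
    C.dir_mul 0 h1 hG p hp, C.dir_mul 0 hF h2 p hp]
  ring

/-- Both factors vanish at `t = 0`, so the product starts with the cross term of second order. -/
theorem mul (hF : HasJet M E F b b') (hG : HasJet M E G e e') :
    HasJet M E (fun p => F p * G p) (fun _ => 0) (fun x => 2 * (b x * e x)) := by
  have C := frameCalculus E M.isOpen_carrier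
  refine ⟨C.mul hF.mem hG.mem, fun x => ?_, fun x => ?_, fun x => ?_⟩
  · rw [hF.zero, zero_mul]
  · rw [C.dir_mul 0 hF.mem hG.mem _ (M.zero_mem x), hF.zero, hG.zero]
    ring
  · rw [dir_mul_dir hF.mem hG.mem (M.zero_mem x), hF.one, hG.one, hF.zero, hG.zero]
    ring

theorem const_mul (r : ℝ) (hF : HasJet M E F b b') :
    HasJet M E (fun p => r * F p) (fun x => r * b x) (fun x => r * b' x) := by
  have C := frameCalculus E M.isOpen_carrier
  refine ⟨C.const_mul r hF.mem, fun x => ?_, fun x => ?_, fun x => ?_⟩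
  · rw [hF.zero, mul_zero]
  · rw [C.dir_const_mul 0 r hF.mem (M.zero_mem x), hF.one]
  · rw [C.dir_congr 0 (fun p hp => C.dir_const_mul 0 r hF.mem hp) _ (M.zero_mem x),
      C.dir_const_mul 0 r (C.dir 0 hF.mem) (M.zero_mem x), hF.two]

theorem sub (hF : HasJet M E F b b') (hG : HasJet M E G e e') :
    HasJet M E (fun p => F p - G p) (fun x => b x - e x) (fun x => b' x - e' x) := by
  simpa [sub_eq_add_neg] using hF.add (hG.const_mul (-1))

/-- The weight is `1 - 2 b t + …`: it leaves the first order unchanged and adds `2 · (-2 b) e` to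
the second derivative. -/
theorem exp_mul (hF : HasJet M E F b b') (hG : HasJet M E G e e') :
    HasJet M E (fun p => Real.exp (-(2 * F p)) * G p) e (fun x => e' x - 4 * (b x * e x)) := by
  have C := frameCalculus E M.isOpen_carrier
  have h1 := (C.neg (C.const_mul 2 hF.mem))
  have h3 : ∀ x, frameDir E 0 (fun p => Real.exp (-(2 * F p))) (0, x) = -2 * b x := by
    intro x
    rw [C.dir_exp 0 h1 (M.zero_mem x), C.dir_neg 0 (C.const_mul 2 hF.mem) (M.zero_mem x),
      C.dir_const_mul 0 2 hF.mem (M.zero_mem x), hF.one, hF.zero]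
    simp
  refine ⟨C.mul (C.exp h1) hG.mem, fun x => ?_, fun x => ?_, fun x => ?_⟩
  · rw [hG.zero, mul_zero]
  · rw [C.dir_mul 0 (C.exp h1) hG.mem _ (M.zero_mem x), hF.zero, hG.zero, hG.one]
    simp
  · rw [dir_mul_dir (C.exp h1) hG.mem (M.zero_mem x), h3, hG.one, hG.two, hF.zero, hG.zero]
    simp
    ring

theorem dir (i : Fin 3) (hF : HasJet M E F b b') :
    HasJet M E (frameDir E i.succ F) (E.dir i b) (E.dir i b') := by
  have C := frameCalculus E M.isOpen_carrier
  have key : ∀ {f : ℝ × D → ℝ} {g : D → ℝ}, (∀ x, f (0, x) = g x) → ∀ x,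
      frameDir E i.succ f (0, x) = E.dir i g x := by
    intro f g hfg x
    rw [← funext hfg]
    rfl
  refine ⟨C.dir i.succ hF.mem, fun x => ?_, fun x => ?_, fun x => ?_⟩
  · rw [key hF.zero]
    exact E.calculus.dir_const i 0 x trivial
  · rw [C.dir_comm 0 i.succ hF.mem _ (M.zero_mem x), key hF.one]
  · rw [C.dir_congr 0 (C.dir_comm 0 i.succ hF.mem) _ (M.zero_mem x),
      C.dir_comm 0 i.succ (C.dir 0 hF.mem) _ (M.zero_mem x), key hF.two]

/-- Turns an equation valid on `M` into one equation on `D` at each of the first two orders in `t`.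
-/
theorem eq_zero (hF : HasJet M E F b b') (h0 : ∀ p ∈ M.carrier, F p = 0) (x : D) :
    b x = 0 ∧ b' x = 0 := by
  have C := frameCalculus E M.isOpen_carrier
  rw [← hF.one, ← hF.two]
  have h1 : ∀ p ∈ M.carrier, frameDir E 0 F p = 0 := fun p hp => C.dir_eq_zero 0 h0 hp
  exact ⟨h1 _ (M.zero_mem x), C.dir_eq_zero 0 h1 (M.zero_mem x)⟩

end HasJet

namespace SlicesData

variable (hφ : SlicesData M E c φ) (hc : c.IsAnalytic)
include hφ

theorem dir_zero (i : Fin 3) (x : D) : frameDir E 0 (φ i) (0, x) = E.kappa c i x := by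
  have h1 := hφ.deriv i _ (M.zero_mem x)
  simpa using h1

include hc

theorem hasJet (i : Fin 3) :
    HasJet M E (φ i) (E.kappa c i) (fun x => -(E.meanKappa c x * E.kappa c i x)) where
  mem := hφ.mem i
  zero := hφ.zero i
  one := hφ.dir_zero i
  two := fun x => by
    have h2 := hφ.deriv_deriv hc i (M.zero_mem x)
    rw [hφ.dir_zero] at h2
    simp at h2
    linear_combination h2

/-- The first two orders in `t` of the off-diagonal Ricci equation of the slices. The products of
first derivatives of the `φ`'s appear only at second order. -/
theorem jet_offdiag {i j k : Fin 3} (hij : i ≠ j) (hjk : j ≠ k) (hik : i ≠ k) (x : D) :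
    E.dir k (E.dir j (E.kappa c i)) x = 0 ∧
    E.dir k (E.dir j (fun x => -(E.meanKappa c x * E.kappa c i x))) x +
      2 * (E.dir k (E.kappa c i) x * E.dir j (E.kappa c i) x) -
      2 * (E.dir j (E.kappa c i) x * E.dir k (E.kappa c j) x) -
      2 * (E.dir k (E.kappa c i) x * E.dir j (E.kappa c k) x) = 0 := by
  have B := (blockMetric_diagGram (frameCalculus E M.isOpen_carrier) hφ.mem
    (ε := 1) (by norm_num)).spatial_calc
  have J := hφ.hasJet hc
  have h1 := (((((J i).dir j).dir k).add (((J i).dir k).mul ((J i).dir j))).sub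
    (((J i).dir j).mul ((J j).dir k))).sub (((J i).dir k).mul ((J k).dir j))
  have h2 := h1.eq_zero (fun p hp => by
    have h3 := hφ.ricci j k p hp
    rw [B.ricciTensor_diagGram_offdiag hφ.mem hij hjk hik hp] at h3
    linear_combination -h3) x
  simpa using h2

/-- The first two orders in `t` of the vanishing sectional curvature of the slices. The terms with
factor `4` come from the exponential weights. -/
theorem jet_sectional {i j k : Fin 3} (hij : i ≠ j) (hjk : j ≠ k) (hik : i ≠ k) (x : D) :
    E.dir j (E.dir j (E.kappa c i)) x + E.dir i (E.dir i (E.kappa c j)) x = 0 ∧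
    E.dir j (E.dir j (fun x => -(E.meanKappa c x * E.kappa c i x))) x +
      2 * ((E.dir j (E.kappa c i) x - E.dir j (E.kappa c j) x) * E.dir j (E.kappa c i) x) -
      4 * (E.kappa c j x * E.dir j (E.dir j (E.kappa c i)) x) +
    (E.dir i (E.dir i (fun x => -(E.meanKappa c x * E.kappa c j x))) x +
      2 * ((E.dir i (E.kappa c j) x - E.dir i (E.kappa c i) x) * E.dir i (E.kappa c j) x) -
      4 * (E.kappa c i x * E.dir i (E.dir i (E.kappa c j)) x)) +
    2 * (E.dir k (E.kappa c i) x * E.dir k (E.kappa c j) x) = 0 := by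
  have B := (blockMetric_diagGram (frameCalculus E M.isOpen_carrier) hφ.mem
    (ε := 1) (by norm_num)).spatial_calc
  have J := hφ.hasJet hc
  have hs := fun i j => (J j).exp_mul ((((J i).dir j).dir j).add
    ((((J i).dir j).sub ((J j).dir j)).mul ((J i).dir j)))
  have h1 := ((hs i j).add (hs j i)).add ((J k).exp_mul (((J i).dir k).mul ((J j).dir k)))
  have h2 := h1.eq_zero (fun p hp => B.diagSectional_eq_zero hφ.mem hij hjk hik hp
    fun i => hφ.ricci i i p hp) x
  simpa using h2

/-- The time-time Ricci equation at `t = 0`, where `∂_t φᵢ = κᵢ` and `∂_t² φᵢ = -K κᵢ`. -/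
theorem hamiltonian (x : D) : ∑ i, E.kappa c i x ^ 2 = E.meanKappa c x ^ 2 := by
  have C := frameCalculus E M.isOpen_carrier
  have B := blockMetric_diagGram C hφ.mem (ε := 1) (by norm_num)
  have h1 := B.ricci_zero_zero (M.zero_mem x)
  rw [hφ.vacuum _ _ _ (M.zero_mem x)] at h1
  simp only [dir_weingarten_diagGram C hφ.mem _ _ _ (M.zero_mem x),
    weingarten_diagGram C hφ.mem _ _ _ (M.zero_mem x), if_true, (hφ.hasJet hc _).two,
    hφ.dir_zero] at h1
  simp [Finset.sum_add_distrib, ← Finset.mul_sum] at h1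
  have h2 : ∑ i, E.kappa c i x = E.meanKappa c x := rfl
  rw [h2] at h1
  simp only [sq]
  linarith

/-- The time-space Ricci equation at `t = 0`, where the slice is the flat `h` and its Christoffel
symbols vanish in the Gaussian frame. -/
theorem momentum (j : Fin 3) (x : D) :
    E.dir j (E.kappa c j) x = ∑ l, E.dir j (E.kappa c l) x := by
  have C := frameCalculus E M.isOpen_carrier
  have B := blockMetric_diagGram C hφ.mem (ε := 1) (by norm_num)
  have hx := M.zero_mem x
  have h1 := B.ricci_zero_succ j hx
  have hd : ∀ i l : Fin 3, frameDir E i.succ (φ l) (0, x) = 0 := fun i l =>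
    (((hφ.hasJet hc l).dir i)).zero x
  have hΓ : ∀ c a b, christoffel (fun i : Fin 3 => frameDir E i.succ) (diagGram φ) c a b (0, x) = 0 := by
    intro c a b
    rw [B.spatial_calc.christoffel_diagGram hφ.mem c a b _ hx]
    simp [diagChristoffel, hd]
  have hdd : ∀ i l : Fin 3, frameDir E i.succ (frameDir E 0 (φ l)) (0, x) =
      E.dir i (E.kappa c l) x := by
    intro i l
    rw [C.dir_comm _ _ (hφ.mem l) _ hx]
    exact ((hφ.hasJet hc l).dir i).one x
  rw [hφ.vacuum _ _ _ hx] at h1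
  simp only [hΓ, dir_weingarten_diagGram C hφ.mem _ _ _ hx, hdd] at h1
  simp at h1
  linarith

end SlicesData
end SignatureChangingSpacetime
end Jets

/-! ### Constraints on the eigenvalues of the second fundamental form, and their solution -/

section Constraints

variable {D : Type*} [TopologicalSpace D] [ChartedSpace Model3 D] [IsManifold 𝓘(ℝ, Model3) ω D]
  {h : AnalyticMetric D} {M : SignatureChangingSpacetime h} {E : GaussianFrame h}
  {c : BilinField D} {φ : Fin 3 → ℝ × D → ℝ}

/-- Constraints on the eigenvalues of the second fundamental form of a hypersurface of signature
change. -/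
structure IsChangeSurface (E : GaussianFrame h) (κ : Fin 3 → D → ℝ) : Prop where
  smooth : ∀ i, ContMDiff 𝓘(ℝ, Model3) 𝓘(ℝ, ℝ) ω (κ i)
  gauss : ∀ {i j k}, i ≠ j → j ≠ k → i ≠ k → ∀ x,
    κ i x * κ j x + κ j x * κ k x + κ k x * κ i x = 0
  codazzi : ∀ {i j k}, i ≠ j → j ≠ k → i ≠ k → ∀ x, E.dir i (κ k) x = -E.dir i (κ j) x
  mixed : ∀ {i j}, i ≠ j → ∀ l x, E.dir i (E.dir j (κ l)) x = 0
  offdiag : ∀ {i j k}, i ≠ j → j ≠ k → i ≠ k → ∀ x,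
    E.dir i (κ i) x * E.dir j (κ k) x - E.dir j (κ j) x * E.dir i (κ j) x =
      -6 * (E.dir i (κ j) x * E.dir j (κ k) x)
  sectional : ∀ {i j k}, i ≠ j → j ≠ k → i ≠ k → ∀ x,
    E.dir j (E.dir j (κ j)) x * κ i x + E.dir i (E.dir i (κ i)) x * κ j x +
      4 * (E.dir j (κ j) x * E.dir j (κ i) x + E.dir i (κ i) x * E.dir i (κ j) x) +
      4 * (κ j x * E.dir j (E.dir j (κ i)) x + κ i x * E.dir i (E.dir i (κ j)) x) =
    2 * (E.dir j (κ i) x ^ 2 + E.dir i (κ j) x ^ 2 + E.dir k (κ i) x * E.dir k (κ j) x)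

namespace SignatureChangingSpacetime

/-- The momentum constraint gives the relations `codazzi` and also `Eⱼ K = Eⱼ κⱼ`. The latter
eliminates the derivatives of the mean curvature `K` from the second order jets. -/
theorem SlicesData.isChangeSurface (hφ : SlicesData M E c φ) (hc : c.IsAnalytic) :
    IsChangeSurface E (E.kappa c) := by
  have C := E.calculus
  have hm := E.contMDiff_kappa hc
  have hK : ContMDiff 𝓘(ℝ, Model3) 𝓘(ℝ, ℝ) ω (E.meanKappa c) := C.sum _ fun i _ => hm i
  have hcod : ∀ {i j k : Fin 3}, i ≠ j → j ≠ k → i ≠ k → ∀ x,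
      E.dir i (E.kappa c k) x = -E.dir i (E.kappa c j) x := by
    intro i j k hij hjk hik x
    have h1 := hφ.momentum hc i x
    rw [FrameCalculus.sum_fin_three hij hjk hik] at h1
    linarith
  have hd : ∀ j x, E.dir j (E.meanKappa c) x = E.dir j (E.kappa c j) x := by
    intro j x
    rw [hφ.momentum hc j x]
    exact C.dir_sum j _ (f := fun i => E.kappa c i) (fun i _ => hm i) trivial
  have hoff : ∀ {i j k : Fin 3}, i ≠ j → j ≠ k → i ≠ k → ∀ x,
      E.dir k (E.dir j (E.kappa c i)) x = 0 :=
    fun hij hjk hik x => (hφ.jet_offdiag hc hij hjk hik x).1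
  -- Up to sign, `κᵢ` may be replaced by `κₖ` under `Eⱼ`, which reduces to the case of three
  -- distinct indices.
  have hmix : ∀ {i j k : Fin 3}, i ≠ j → j ≠ k → i ≠ k → ∀ x,
      E.dir i (E.dir j (E.kappa c i)) x = 0 := by
    intro i j k hij hjk hik x
    have h1 : E.dir i (E.dir j (E.kappa c k)) x = -E.dir i (E.dir j (E.kappa c i)) x := by
      rw [funext (hcod hij.symm hik hjk), C.dir_neg i (C.dir j (hm i)) trivial]
    rw [hoff hjk.symm hij.symm hik.symm x] at h1
    linarith
  have hthird : ∀ {i j : Fin 3}, i ≠ j → ∃ k, j ≠ k ∧ i ≠ k := by decide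
  have hmixed : ∀ {i j : Fin 3}, i ≠ j → ∀ l x, E.dir i (E.dir j (E.kappa c l)) x = 0 := by
    intro i j hij l x
    obtain ⟨k, hjk, hik⟩ := hthird hij
    by_cases hli : l = i
    · rw [hli]; exact hmix hij hjk hik x
    by_cases hlj : l = j
    · rw [hlj, C.dir_comm i j (hm j) x trivial]
      exact hmix hij.symm hik hjk x
    · exact hoff hlj hij.symm hli x
  have hKd : ∀ i j x, E.dir j (fun x => E.meanKappa c x * E.kappa c i x) x =
      E.dir j (E.kappa c j) x * E.kappa c i x + E.meanKappa c x * E.dir j (E.kappa c i) x := by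
    intro i j x
    rw [C.dir_mul j hK (hm i) x trivial, hd]
  have hKdd : ∀ i j k x, E.dir k (E.dir j (fun x => -(E.meanKappa c x * E.kappa c i x))) x =
      -(E.dir k (E.dir j (E.kappa c j)) x * E.kappa c i x +
        E.dir j (E.kappa c j) x * E.dir k (E.kappa c i) x +
        E.dir k (E.kappa c k) x * E.dir j (E.kappa c i) x +
        E.meanKappa c x * E.dir k (E.dir j (E.kappa c i)) x) := by
    intro i j k x
    have h1 : E.dir j (fun x => -(E.meanKappa c x * E.kappa c i x)) = fun x =>
        -(E.dir j (E.kappa c j) x * E.kappa c i x + E.meanKappa c x * E.dir j (E.kappa c i) x) :=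
      funext fun x => by rw [C.dir_neg j (C.mul hK (hm i)) trivial, hKd]
    have h2 := C.mul (C.dir j (hm j)) (hm i)
    have h3 := C.mul hK (C.dir j (hm i))
    rw [h1, C.dir_neg k (C.add h2 h3) trivial, C.dir_add k h2 h3 x trivial,
      C.dir_mul k (C.dir j (hm j)) (hm i) x trivial, C.dir_mul k hK (C.dir j (hm i)) x trivial, hd]
    ring
  refine
  { smooth := E.contMDiff_kappa hc
    gauss := fun {i j k} hij hjk hik x => ?_
    codazzi := hcod
    mixed := hmixed
    offdiag := fun {i j k} hij hjk hik x => ?_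
    sectional := fun {i j k} hij hjk hik x => ?_ }
  · have h1 := hφ.hamiltonian hc x
    rw [GaussianFrame.meanKappa, FrameCalculus.sum_fin_three hij hjk hik,
      FrameCalculus.sum_fin_three hij hjk hik] at h1
    linarith
  · have h1 := (hφ.jet_offdiag hc hik.symm hij hjk.symm x).2
    rw [hKdd, hmixed hij.symm, hmixed hij.symm] at h1
    rw [hcod hij hjk hik x, hcod hij.symm hik hjk x] at h1
    rw [hcod hij.symm hik hjk x]
    linear_combination -h1
  -- The terms of second order that still contain `K` are a multiple of the first order equation
  -- `h1`.
  · obtain ⟨h1, h2⟩ := hφ.jet_sectional hc hij hjk hik x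
    rw [hKdd, hKdd] at h2
    linear_combination -h2 - E.meanKappa c x * h1

end SignatureChangingSpacetime

namespace IsChangeSurface

variable {κ : Fin 3 → D → ℝ} (H : IsChangeSurface E κ)
include H

/-- The derivative of the quadratic constraint along `Eᵢ`, with `Eᵢ κₖ = -Eᵢ κⱼ` inserted. -/
theorem dir_gauss {i j k : Fin 3} (hij : i ≠ j) (hjk : j ≠ k) (hik : i ≠ k) (x : D) :
    E.dir i (κ i) x * (κ j x + κ k x) + E.dir i (κ j) x * (κ k x - κ j x) = 0 := by
  have C := E.calculus
  have h1 : E.dir i (fun x => κ i x * κ j x + κ j x * κ k x + κ k x * κ i x) x = 0 :=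
    C.dir_eq_zero i (fun x _ => H.gauss hij hjk hik x) trivial
  have m1 := C.mul (H.smooth i) (H.smooth j)
  have m2 := C.mul (H.smooth j) (H.smooth k)
  have m3 := C.mul (H.smooth k) (H.smooth i)
  rw [C.dir_add i (C.add m1 m2) m3 x trivial, C.dir_add i m1 m2 x trivial,
    C.dir_mul i (H.smooth i) (H.smooth j) x trivial, C.dir_mul i (H.smooth j) (H.smooth k) x trivial,
    C.dir_mul i (H.smooth k) (H.smooth i) x trivial, H.codazzi hij hjk hik] at h1
  linear_combination h1

theorem dir_dir_gauss {i j k : Fin 3} (hij : i ≠ j) (hjk : j ≠ k) (hik : i ≠ k) (l : Fin 3)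
    (x : D) :
    E.dir l (E.dir i (κ i)) x * (κ j x + κ k x) +
      E.dir i (κ i) x * (E.dir l (κ j) x + E.dir l (κ k) x) +
      E.dir l (E.dir i (κ j)) x * (κ k x - κ j x) +
      E.dir i (κ j) x * (E.dir l (κ k) x - E.dir l (κ j) x) = 0 := by
  have C := E.calculus
  have h1 : E.dir l (fun x => E.dir i (κ i) x * (κ j x + κ k x) +
      E.dir i (κ j) x * (κ k x - κ j x)) x = 0 :=
    C.dir_eq_zero l (fun x _ => H.dir_gauss hij hjk hik x) trivial
  have m1 := C.add (H.smooth j) (H.smooth k)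
  have m2 := C.sub (H.smooth k) (H.smooth j)
  have m3 := C.dir i (H.smooth i)
  have m4 := C.dir i (H.smooth j)
  rw [C.dir_add l (C.mul m3 m1) (C.mul m4 m2) x trivial, C.dir_mul l m3 m1 x trivial,
    C.dir_mul l m4 m2 x trivial, C.dir_add l (H.smooth j) (H.smooth k) x trivial,
    C.dir_sub l (H.smooth k) (H.smooth j) trivial] at h1
  linear_combination h1

/-- The derivative of `dir_gauss` along `Eⱼ` loses its mixed second derivatives, and `offdiag`
replaces the remaining products; the factor is `6 - 1`. -/
theorem dir_mul_dir {i j k : Fin 3} (hij : i ≠ j) (hjk : j ≠ k) (hik : i ≠ k) (x : D) :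
    E.dir i (κ i) x * E.dir j (κ j) x = 5 * (E.dir i (κ j) x * E.dir j (κ k) x) := by
  have h1 := H.dir_dir_gauss hij hjk hik j x
  rw [H.mixed hij.symm, H.mixed hij.symm] at h1
  linear_combination h1 - H.offdiag hij hjk hik x

/-- With `u = Eᵢ κⱼ`, `v = Eⱼ κᵢ`, `r = Eᵢ κᵢ`, `s = Eⱼ κⱼ` one has `r s = -5 u v` and `r v + s u =
-6 u v`, hence `(r - u) (s - v) = 2 u v`. If `u v ≠ 0`, the quadratic constraint and its two first
derivatives therefore have only the zero solution `κᵢ = κⱼ = κₖ = 0` at `x`. There the second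
derivative of the constraint along `Eᵢ` reduces to `-2 u² = 0`, a contradiction. -/
theorem dir_mul_dir_eq_zero {i j k : Fin 3} (hij : i ≠ j) (hjk : j ≠ k) (hik : i ≠ k) (x : D) :
    E.dir i (κ j) x * E.dir j (κ k) x = 0 := by
  by_contra hne
  have hA := H.offdiag hij hjk hik x
  have hB := H.dir_mul_dir hij hjk hik x
  have hC := H.dir_gauss hij hjk hik x
  have hD := H.dir_gauss hij.symm hik hjk x
  rw [H.codazzi hij.symm hik hjk] at hA hB hne
  have hF := H.gauss hij hjk hik x
  have hii := H.dir_dir_gauss hij hjk hik i x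
  rw [H.codazzi hij hjk hik] at hii
  set u := E.dir i (κ j) x
  set v := E.dir j (κ i) x
  set r := E.dir i (κ i) x
  set s := E.dir j (κ j) x
  have hu : u ≠ 0 := fun h => hne (by rw [h, zero_mul])
  have hv : v ≠ 0 := fun h => hne (by rw [h]; ring)
  -- The derivative equations read `(r - u) κⱼ = -(r + u) κₖ` and `(s - v) κᵢ = -(s + v) κₖ`.
  -- Substituted into `(r - u) (s - v)` times the quadratic constraint they leave `2 u v κₖ² = 0`.
  have hk : κ k x = 0 := by
    have h1 : u * v * κ k x ^ 2 = 0 := by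
      linear_combination ((r - u) * (s - v) * hF - (s - v) * (κ i x + κ k x) * hC
        + 2 * u * κ k x * hD + κ k x ^ 2 * (hB + hA)) / 2
    simpa [hu, hv] using h1
  have hj : κ j x = 0 := by
    have h1 : u * v * κ j x = 0 := by
      linear_combination ((s - v) * hC - κ j x * (hA + hB) - (s - v) * (r + u) * hk) / 2
    simpa [hu, hv] using h1
  have hi : κ i x = 0 := by
    have h1 : u * v * κ i x = 0 := by
      linear_combination ((r - u) * hD - κ i x * (hA + hB) - (r - u) * (s + v) * hk) / 2
    simpa [hu, hv] using h1
  rw [hj, hk] at hii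
  have h1 : u ^ 2 = 0 := by linear_combination -hii / 2
  exact hu (by simpa using h1)

omit H in
theorem dir_eq_zero_of_eventually {f : D → ℝ} {x : D} (hf : ∀ᶠ y in 𝓝 x, f y = 0) (i : Fin 3) :
    E.dir i f x = 0 := by
  rw [E.dir_congr_of_eventuallyEq i (g := fun _ => 0) hf]
  exact E.calculus.dir_const i 0 x trivial

/-- If `Eᵢ κⱼ ≠ 0` at `x`, the vanishing products and `offdiag` make every derivative along `Eⱼ` and
`Eₖ` zero near `x`. The sectional constraint of the `j`-`k` plane then retains only `Eᵢ κⱼ · Eᵢ κₖ =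
-(Eᵢ κⱼ)²`, which must vanish. -/
theorem dir_offdiag_eq_zero {i j k : Fin 3} (hij : i ≠ j) (hjk : j ≠ k) (hik : i ≠ k) (x : D) :
    E.dir i (κ j) x = 0 := by
  by_contra hu
  have hcont : Continuous (E.dir i (κ j)) := (E.calculus.dir i (H.smooth j)).continuous
  -- A neighbourhood is needed, since the sectional constraint contains second derivatives.
  have hev : ∀ᶠ y in 𝓝 x, ∀ l, E.dir j (κ l) y = 0 ∧ E.dir k (κ l) y = 0 := by
    filter_upwards [hcont.continuousAt.eventually_ne hu] with y hy
    have h1 : E.dir j (κ k) y = 0 :=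
      (mul_eq_zero.1 (H.dir_mul_dir_eq_zero hij hjk hik y)).resolve_left hy
    have h2 : E.dir j (κ i) y = 0 := by
      rw [← neg_eq_zero, ← H.codazzi hij.symm hik hjk, h1]
    have h3 : E.dir k (κ i) y = 0 :=
      (mul_eq_zero.1 (H.dir_mul_dir_eq_zero hik.symm hij hjk.symm y)).resolve_right hy
    have h4 : E.dir k (κ j) y = 0 := by
      rw [H.codazzi hik.symm hij hjk.symm, h3, neg_zero]
    have h5 : E.dir j (κ j) y = 0 := by
      have h := H.offdiag hij hjk hik y
      rw [h1] at h
      have h' : E.dir j (κ j) y * E.dir i (κ j) y = 0 := by linarith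
      exact (mul_eq_zero.1 h').resolve_right hy
    have h6 : E.dir k (κ k) y = 0 := by
      have h := H.offdiag hik.symm hij hjk.symm y
      rw [h3] at h
      have h' : E.dir k (κ k) y * E.dir i (κ j) y = 0 := by linarith
      exact (mul_eq_zero.1 h').resolve_right hy
    intro l
    by_cases hli : l = i
    · rw [hli]; exact ⟨h2, h3⟩
    by_cases hlj : l = j
    · rw [hlj]; exact ⟨h5, h4⟩
    have hlk : l = k := by lia
    rw [hlk]; exact ⟨h1, h6⟩
  have h0 := hev.self_of_nhds
  have hj : ∀ l m, E.dir m (E.dir j (κ l)) x = 0 := fun l m =>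
    dir_eq_zero_of_eventually (hev.mono fun y hy => (hy l).1) m
  have hk : ∀ l m, E.dir m (E.dir k (κ l)) x = 0 := fun l m =>
    dir_eq_zero_of_eventually (hev.mono fun y hy => (hy l).2) m
  have h1 := H.sectional hjk hik.symm hij.symm x
  simp only [hj, hk, (h0 _).1, (h0 _).2, H.codazzi hij hjk hik] at h1
  have h2 : E.dir i (κ j) x ^ 2 = 0 := by linear_combination h1 / 2
  exact hu (by simpa using h2)

/-- Either the eigenvalues are constant or two of them vanish identically. -/
theorem const_or_vanish [ConnectedSpace D] :
    (∀ i x y, κ i x = κ i y) ∨ ∃ i, ∀ j, j ≠ i → ∀ x, E.dir j (κ i) x = 0 ∧ κ j x = 0 := by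
  have hthird : ∀ {i j : Fin 3}, i ≠ j → ∃ k, j ≠ k ∧ i ≠ k := by decide
  have hoff : ∀ {i j : Fin 3}, i ≠ j → ∀ x, E.dir i (κ j) x = 0 := by
    intro i j hij x
    obtain ⟨k, hjk, hik⟩ := hthird hij
    exact H.dir_offdiag_eq_zero hij hjk hik x
  by_cases hw : ∀ i x, E.dir i (κ i) x = 0
  · left
    intro i
    refine E.eq_of_dir_eq_zero (H.smooth i) fun j x => ?_
    by_cases hij : j = i
    · rw [hij]; exact hw i x
    · exact hoff hij x
  · right
    push Not at hw
    obtain ⟨i, x, hx⟩ := hw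
    refine ⟨i, fun j hj y => ⟨hoff hj y, ?_⟩⟩
    obtain ⟨k, hjk, hik⟩ := hthird hj.symm
    -- Where `Eᵢ κᵢ ≠ 0`, `dir_gauss` gives `κⱼ + κₖ = 0`, and the quadratic constraint becomes
    -- `-κⱼ² = 0`. The identity theorem extends the vanishing from this open set to `D`.
    refine eq_zero_of_eventuallyEq_zero (H.smooth j) (x₀ := x) ?_ y
    have hcont : Continuous (E.dir i (κ i)) := (E.calculus.dir i (H.smooth i)).continuous
    filter_upwards [hcont.continuousAt.eventually_ne hx] with z hz
    have h1 := H.dir_gauss hj.symm hjk hik z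
    rw [hoff hj.symm, zero_mul, add_zero] at h1
    have h2 := (mul_eq_zero.1 h1).resolve_left hz
    have h3 := H.gauss hj.symm hjk hik z
    have h4 : κ j z ^ 2 = 0 := by linear_combination (κ i z + κ j z) * h2 - h3
    simpa using h4

end IsChangeSurface
end Constraints

/-! ### Flat spacetimes -/

section Flatness

variable {D : Type*} [TopologicalSpace D] [ChartedSpace Model3 D] [IsManifold 𝓘(ℝ, Model3) ω D]
  {h : AnalyticMetric D} {M : SignatureChangingSpacetime h} {E : GaussianFrame h}
  {c : BilinField D} {φ : Fin 3 → ℝ × D → ℝ}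

namespace SignatureChangingSpacetime

theorem exists_pos_mem_carrier (M : SignatureChangingSpacetime h) (x : D) :
    ∃ t : ℝ, 0 < t ∧ (t, x) ∈ M.carrier := by
  have h1 : ∀ᶠ t : ℝ in 𝓝[>] 0, (t, x) ∈ M.carrier := nhdsWithin_le_nhds
    ((M.isNormalNeighbourhood.isOpen_fiber x).mem_nhds (M.zero_mem x))
  obtain ⟨t, ht, ht0⟩ := (h1.and self_mem_nhdsWithin).exists
  exact ⟨t, ht0, ht⟩

/-- The curvature of a signature changing spacetime whose slices have the diagonal metrics
`∑ exp (2 φᵢ) (dxⁱ)²`. -/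
theorem riemannTensor_gram_eq_diag (hgram : ∀ p ∈ M.carrier, M.spatialGram E p = diagGram φ p)
    {s : ℝ} (hs : s = 1 ∨ s = -1) {p : ℝ × D} (hp : p ∈ M.carrier) (hp' : 0 < s * p.1)
    (e c a b : Fin 4) : riemannTensor (frameDir E) (M.gram E) e c a b p =
      riemannTensor (frameDir E) (blockGram s (diagGram φ)) e c a b p := by
  rw [M.riemannTensor_gram_eq E hs hp hp']
  refine (frameCalculus E M.isOpen_carrier).riemannTensor_congr (fun q hq => ?_) e c a b hp
  have h1 := hgram q hq
  simp only [blockGram, h1]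

theorem isFlat_of_planar (hgram : ∀ p ∈ M.carrier, M.spatialGram E p = diagGram φ p)
    (hφ : ∀ i, AnalyticOnSet M.carrier (φ i)) (i : Fin 3)
    (hzero : ∀ j ≠ i, ∀ p ∈ M.carrier, φ j p = 0)
    (hdep : ∀ j ≠ i, ∀ p ∈ M.carrier, frameDir E j.succ (φ i) p = 0)
    (hode : ∀ p ∈ M.carrier, frameDir E 0 (frameDir E 0 (φ i)) p + frameDir E 0 (φ i) p ^ 2 = 0) :
    M.IsFlat E := by
  intro p hp hp0 e c a b
  obtain ⟨s, hs, hsp⟩ := exists_sign hp0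
  have hs2 : s * s = 1 := by rcases hs with rfl | rfl <;> norm_num
  rw [riemannTensor_gram_eq_diag hgram hs hp hsp]
  exact riemannTensor_planar (frameCalculus E M.isOpen_carrier) hφ hs2 i hzero hdep hode e c a b hp

theorem IsFlat.isVacuum (hM : M.IsFlat E) : M.IsVacuum E := fun p hp hp0 _ _ =>
  Finset.sum_eq_zero fun _ _ => hM p hp hp0 _ _ _ _

namespace SlicesData

variable (hφ : SlicesData M E c φ) (hc : c.IsAnalytic)
include hφ hc

/-- The Riccati equation at one point with `t > 0`, multiplied by `(1 + K t)²`: there `(1 + K t) φᵢ'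
= κᵢ` and `(1 + K t)² φᵢ'' = -K κᵢ`. -/
theorem kappa_sq_of_isFlat (hM : M.IsFlat E) (i : Fin 3) (x : D) :
    E.kappa c i x ^ 2 = E.meanKappa c x * E.kappa c i x := by
  obtain ⟨t, ht, hp⟩ := M.exists_pos_mem_carrier x
  have h1 := riccati_of_riemannTensor_eq_zero (frameCalculus E M.isOpen_carrier) hφ.mem
    (ε := 1) (by norm_num) hp (fun e c a b => by
      rw [← riemannTensor_gram_eq_diag hφ.gram (Or.inl rfl) hp (by simpa using ht)]
      exact hM _ hp ht.ne' e c a b) i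
  have h2 := hφ.deriv i _ hp
  have h3 := hφ.deriv_deriv hc i hp
  simp only at h2 h3
  set A := 1 + E.meanKappa c x * t
  set θ := frameDir E 0 (φ i) (t, x)
  linear_combination A ^ 2 * h1 - A * h3 + (E.meanKappa c x - E.kappa c i x - A * θ) * h2

/-- For the third index, `κₖ² = K κₖ` means `κₖ (κᵢ + κⱼ) = 0`; the quadratic constraint then leaves
only `κᵢ κⱼ`. -/
theorem kappa_mul_kappa_of_isFlat (hM : M.IsFlat E) {i j : Fin 3} (hij : i ≠ j) (x : D) :
    E.kappa c i x * E.kappa c j x = 0 := by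
  obtain ⟨k, hjk, hik⟩ : ∃ k, j ≠ k ∧ i ≠ k := by revert i j; decide
  have h1 := hφ.kappa_sq_of_isFlat hc hM k x
  have h2 := (hφ.isChangeSurface hc).gauss hij hjk hik x
  rw [GaussianFrame.meanKappa, FrameCalculus.sum_fin_three hij hjk hik] at h1
  linear_combination h2 + h1

/-- The products vanish pointwise, which alone would permit the nonvanishing index to change from
point to point. The dichotomy `const_or_vanish` fixes it: constant eigenvalues are decided at one
point, and in the other case the index is given. -/
theorem exists_vanish_of_isFlat [ConnectedSpace D] (hM : M.IsFlat E) :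
    ∃ i, ∀ j, j ≠ i → ∀ x, E.kappa c j x = 0 := by
  rcases (hφ.isChangeSurface hc).const_or_vanish with hconst | ⟨i, hi⟩
  · obtain ⟨x₀⟩ := (inferInstance : Nonempty D)
    by_cases h0 : ∀ j, E.kappa c j x₀ = 0
    · exact ⟨0, fun j _ x => by rw [hconst j x x₀, h0]⟩
    · push Not at h0
      obtain ⟨i, hi⟩ := h0
      refine ⟨i, fun j hj x => ?_⟩
      rw [hconst j x x₀]
      exact (mul_eq_zero.1 (hφ.kappa_mul_kappa_of_isFlat hc hM hj.symm x₀)).resolve_left hi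
  · exact ⟨i, fun j hj x => (hi j hj x).2⟩

/-- With `K = κᵢ` the other `φⱼ` are constant in `t`, hence zero, and `(1 + κᵢ t) φᵢ' = κᵢ` implies
`φᵢ'' + (φᵢ')² = 0`. The momentum constraint gives `Eⱼ κᵢ = 0`, so `φᵢ` depends on `t` and `xⁱ`
only. This is the planar flat metric. -/
theorem isFlat_of_vanish {i : Fin 3} (hi : ∀ j, j ≠ i → ∀ x, E.kappa c j x = 0) :
    M.IsFlat E := by
  have C := frameCalculus E M.isOpen_carrier
  have N := M.isNormalNeighbourhood
  have hK : ∀ x, E.meanKappa c x = E.kappa c i x := fun x => by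
    rw [GaussianFrame.meanKappa, Finset.sum_eq_single i (fun j _ hj => hi j hj x) (by simp)]
  have hdK : ∀ j ≠ i, ∀ x, E.dir j (E.kappa c i) x = 0 := by
    intro j hj x
    have h1 := hφ.momentum hc j x
    have h2 : ∀ l ≠ i, E.dir j (E.kappa c l) x = 0 := fun l hl =>
      E.calculus.dir_eq_zero j (r := 0) (fun y _ => hi l hl y) trivial
    rwa [Finset.sum_eq_single i (fun l _ hl => h2 l hl) (by simp), h2 j hj, eq_comm] at h1
  refine isFlat_of_planar hφ.gram hφ.mem i ?_ ?_ ?_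
  · intro j hj
    refine N.eq_zero_of_linear E (hφ.mem j) (C.const 0) (fun p hp => ?_) (hφ.zero j)
    have h1 := hφ.deriv j p hp
    rw [hi j hj] at h1
    rw [zero_mul]
    exact (mul_eq_zero.1 h1).resolve_left (hφ.one_add_ne_zero hp)
  · intro j hj
    -- The time derivative of `Eⱼ φᵢ` is `Eⱼ (κᵢ / (1 + κᵢ t)) = 0`, and the initial value is zero.
    refine N.eq_zero_of_linear E (C.dir j.succ (hφ.mem i)) (C.const 0) (fun p hp => ?_)
      (fun x => ((hφ.hasJet hc i).dir j).zero x)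
    have hθ := C.dir 0 (hφ.mem i)
    have hA : AnalyticOnSet M.carrier (fun p => 1 + E.kappa c i p.2 * p.1) :=
      C.add (C.const 1) (C.mul (analyticOnSet_kappa hc i _) (analyticOnSet_fst _))
    have hdA : frameDir E j.succ (fun p => 1 + E.kappa c i p.2 * p.1) p = 0 := by
      rw [C.dir_add _ (C.const 1) (C.mul (analyticOnSet_kappa hc i _) (analyticOnSet_fst _)) p hp,
        C.dir_const _ _ p hp, C.dir_mul _ (analyticOnSet_kappa hc i _) (analyticOnSet_fst _) p hp]
      have h1 : frameDir E j.succ (fun p => E.kappa c i p.2) p = 0 := hdK j hj p.2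
      have h2 : frameDir E j.succ Prod.fst p = 0 := E.calculus.dir_const j p.1 p.2 trivial
      rw [h1, h2]
      ring
    have h1 : frameDir E j.succ (fun p => (1 + E.kappa c i p.2 * p.1) * frameDir E 0 (φ i) p) p =
        frameDir E j.succ (fun p => E.kappa c i p.2) p := by
      refine C.dir_congr _ (fun q hq => ?_) p hp
      have h := hφ.deriv i q hq
      rwa [hK] at h
    have h3 : frameDir E j.succ (fun p => E.kappa c i p.2) p = 0 := hdK j hj p.2
    rw [C.dir_mul _ hA hθ p hp, hdA, h3, zero_mul, zero_add] at h1
    have h4 := hφ.one_add_ne_zero hp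
    rw [hK] at h4
    rw [zero_mul, C.dir_comm _ _ (hφ.mem i) p hp]
    exact (mul_eq_zero.1 h1).resolve_left h4
  · intro p hp
    have h1 := hφ.deriv i p hp
    have h2 := hφ.deriv_deriv hc i hp
    have h3 := hφ.one_add_ne_zero hp
    rw [hK] at h1 h2 h3
    have h4 : (1 + E.kappa c i p.2 * p.1) *
        (frameDir E 0 (frameDir E 0 (φ i)) p + frameDir E 0 (φ i) p ^ 2) = 0 := by
      linear_combination h2 + frameDir E 0 (φ i) p * h1
    exact (mul_eq_zero.1 h4).resolve_left h3

end SlicesData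
end SignatureChangingSpacetime
end Flatness

/-! ### Analyticity of diagonal bilinear forms -/

theorem ContMDiffAt.sum_bilin_self {H X A C W ι : Type*} [NormedAddCommGroup W] [NormedSpace ℝ W]
    [TopologicalSpace H] {I : ModelWithCorners ℝ W H} [TopologicalSpace X] [ChartedSpace H X]
    [NormedAddCommGroup A] [NormedSpace ℝ A] [NormedAddCommGroup C] [NormedSpace ℝ C] [Fintype ι]
    (B : A →L[ℝ] A →L[ℝ] C) {a : ι → X → ℝ} {L : ι → X → A}
    {p : X} (ha : ∀ i, ContMDiffAt I 𝓘(ℝ, ℝ) ω (a i) p)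
    (hL : ∀ i, ContMDiffAt I 𝓘(ℝ, A) ω (L i) p) :
    ContMDiffAt I 𝓘(ℝ, C) ω (fun q => ∑ i, a i q • B (L i q) (L i q)) p := by
  refine ContMDiffAt.sum fun i _ => (ha i).smul ?_
  have h1 : ContMDiffAt I 𝓘(ℝ, A →L[ℝ] A →L[ℝ] C) ω (fun _ : X => B) p := contMDiffAt_const
  exact (h1.clm_apply (hL i)).clm_apply (hL i)

section DiagonalForms

variable {D : Type*} [TopologicalSpace D] [ChartedSpace Model3 D] [IsManifold 𝓘(ℝ, Model3) ω D]
  {h : AnalyticMetric D} (E : GaussianFrame h)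

namespace GaussianFrame

/-- The dual frame. -/
noncomputable def coframe (i : Fin 3) (x : D) : TangentSpace 𝓘(ℝ, Model3) x →L[ℝ] ℝ :=
  h.inner x (E.field i x)

theorem contMDiffAt_coframe (i : Fin 3) (p : ℝ × D) :
    ContMDiffAt (𝓘(ℝ, ℝ).prod 𝓘(ℝ, Model3)) (𝓘(ℝ, Model3).prod 𝓘(ℝ, Model3 →L[ℝ] ℝ)) ω
      (fun q : ℝ × D => (TotalSpace.mk' (Model3 →L[ℝ] ℝ) q.2 (E.coframe i q.2) :
        TotalSpace (Model3 →L[ℝ] ℝ) (fun x : D => TangentSpace 𝓘(ℝ, Model3) x →L[ℝ] ℝ))) p := by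
  have h1 : ContMDiffAt (𝓘(ℝ, ℝ).prod 𝓘(ℝ, Model3)) 𝓘(ℝ, Model3).tangent ω
      (fun q : ℝ × D => (⟨q.2, E.field i q.2⟩ : TangentBundle 𝓘(ℝ, Model3) D)) p :=
    ContMDiffAt.comp p (f := Prod.snd) (E.analytic i p.2) contMDiffAt_snd
  have h2 : ContMDiffAt (𝓘(ℝ, ℝ).prod 𝓘(ℝ, Model3))
      (𝓘(ℝ, Model3).prod 𝓘(ℝ, Model3 →L[ℝ] Model3 →L[ℝ] ℝ)) ω
      (fun q : ℝ × D => (TotalSpace.mk' (Model3 →L[ℝ] Model3 →L[ℝ] ℝ) q.2 (h.inner q.2) :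
        TotalSpace (Model3 →L[ℝ] Model3 →L[ℝ] ℝ)
          (fun x : D => TangentSpace 𝓘(ℝ, Model3) x →L[ℝ] TangentSpace 𝓘(ℝ, Model3) x →L[ℝ] ℝ))) p :=
    ContMDiffAt.comp p (f := Prod.snd) (h.contMDiff p.2) contMDiffAt_snd
  exact ContMDiffAt.clm_bundle_apply (F₁ := Model3) (F₂ := Model3 →L[ℝ] ℝ)
    (E₁ := fun x : D => TangentSpace 𝓘(ℝ, Model3) x)
    (E₂ := fun x : D => TangentSpace 𝓘(ℝ, Model3) x →L[ℝ] ℝ) h2 h1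

/-- The bilinear form `∑ aᵢ (dxⁱ)²`. -/
noncomputable def diagForm (a : Fin 3 → ℝ) (x : D) :
    TangentSpace 𝓘(ℝ, Model3) x →L[ℝ] TangentSpace 𝓘(ℝ, Model3) x →L[ℝ] ℝ :=
  ∑ i, a i • (E.coframe i x).smulRight (E.coframe i x)

theorem diagForm_apply (a : Fin 3 → ℝ) (x : D) (u v : TangentSpace 𝓘(ℝ, Model3) x) :
    E.diagForm a x u v = ∑ i, a i * (E.coframe i x u * E.coframe i x v) := by
  simp [diagForm]

-- In a trivialization the form is `∑ aᵢ B(Lᵢ, Lᵢ)`, with the constant bilinear map `B` that sends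
-- two covectors to their tensor product and with `Lᵢ` the analytic coordinates of the dual frame,
-- so `ContMDiffAt.sum_bilin_self` applies.
set_option synthInstance.maxHeartbeats 200000 in
theorem contMDiffAt_diagForm {a : Fin 3 → ℝ × D → ℝ} {p : ℝ × D}
    (ha : ∀ i, ContMDiffAt (𝓘(ℝ, ℝ).prod 𝓘(ℝ, Model3)) 𝓘(ℝ, ℝ) ω (a i) p) :
    ContMDiffAt (𝓘(ℝ, ℝ).prod 𝓘(ℝ, Model3))
      (𝓘(ℝ, Model3).prod 𝓘(ℝ, Model3 →L[ℝ] Model3 →L[ℝ] ℝ)) ω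
      (fun q : ℝ × D => (TotalSpace.mk' (Model3 →L[ℝ] Model3 →L[ℝ] ℝ) q.2
        (E.diagForm (fun i => a i q) q.2) :
        TotalSpace (Model3 →L[ℝ] Model3 →L[ℝ] ℝ)
          (fun x : D => TangentSpace 𝓘(ℝ, Model3) x →L[ℝ] TangentSpace 𝓘(ℝ, Model3) x →L[ℝ] ℝ))) p := by
  rw [contMDiffAt_hom_bundle]
  refine ⟨contMDiffAt_snd, ?_⟩
  have hL : ∀ i, ContMDiffAt (𝓘(ℝ, ℝ).prod 𝓘(ℝ, Model3)) 𝓘(ℝ, Model3 →L[ℝ] ℝ) ω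
      (fun q : ℝ × D => (trivializationAt (Model3 →L[ℝ] ℝ)
        (fun x : D => TangentSpace 𝓘(ℝ, Model3) x →L[ℝ] ℝ) p.2 ⟨q.2, E.coframe i q.2⟩).2) p :=
    fun i => (contMDiffAt_totalSpace.1 (E.contMDiffAt_coframe i p)).2
  refine (ContMDiffAt.sum_bilin_self (A := Model3 →L[ℝ] ℝ)
    (C := Model3 →L[ℝ] Model3 →L[ℝ] ℝ)
    (ContinuousLinearMap.smulRightL ℝ Model3 (Model3 →L[ℝ] ℝ)) ha hL).congr_of_eventuallyEq ?_
  have hbase : ∀ᶠ q : ℝ × D in 𝓝 p, q.2 ∈ (trivializationAt (Model3 →L[ℝ] ℝ)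
      (fun x : D => TangentSpace 𝓘(ℝ, Model3) x →L[ℝ] ℝ) p.2).baseSet :=
    continuous_snd.continuousAt.eventually
      ((trivializationAt (Model3 →L[ℝ] ℝ)
        (fun x : D => TangentSpace 𝓘(ℝ, Model3) x →L[ℝ] ℝ) p.2).open_baseSet.mem_nhds
        (mem_baseSet_trivializationAt _ _ _))
  filter_upwards [hbase] with q hq
  have h1 : ∀ i, (trivializationAt (Model3 →L[ℝ] ℝ)
      (fun x : D => TangentSpace 𝓘(ℝ, Model3) x →L[ℝ] ℝ) p.2).continuousLinearMapAt ℝ q.2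
        (E.coframe i q.2) = (trivializationAt (Model3 →L[ℝ] ℝ)
      (fun x : D => TangentSpace 𝓘(ℝ, Model3) x →L[ℝ] ℝ) p.2 ⟨q.2, E.coframe i q.2⟩).2 := fun i => by
    exact Trivialization.continuousLinearMapAt_apply_of_mem ℝ _ hq _
  -- The coordinates of a covector are its composition with the inverse trivialization of the
  -- tangent bundle.
  have h2 : ∀ i v, E.coframe i q.2 ((trivializationAt Model3
      (fun x : D => TangentSpace 𝓘(ℝ, Model3) x) p.2).symmL ℝ q.2 v) =
      (trivializationAt (Model3 →L[ℝ] ℝ)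
        (fun x : D => TangentSpace 𝓘(ℝ, Model3) x →L[ℝ] ℝ) p.2 ⟨q.2, E.coframe i q.2⟩).2 v :=
    fun i v => by
      rw [hom_trivializationAt_apply]
      simp [ContinuousLinearMap.inCoordinates]
  refine ContinuousLinearMap.ext fun v => ?_
  simp only [ContinuousLinearMap.inCoordinates, ContinuousLinearMap.comp_apply, diagForm,
    sum_apply, smul_apply, ContinuousLinearMap.smulRight_apply,
    map_sum, map_smul, h1, h2]
  rfl

end GaussianFrame
end DiagonalForms

/-! ### Spacetimes with the slices `∑ (1 + f t) ^ (2 rᵢ) (dxⁱ)²` -/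

section Existence

variable {D : Type*} [TopologicalSpace D] [ChartedSpace Model3 D] [IsManifold 𝓘(ℝ, Model3) ω D]
  {h : AnalyticMetric D} (E : GaussianFrame h) {c : BilinField D}

namespace GaussianFrame

theorem coframe_field (i j : Fin 3) (x : D) :
    E.coframe i x (E.field j x) = if i = j then 1 else 0 := E.orthonormal i j x

theorem apply_eq_sum (hdiag : ∀ i j, i ≠ j → ∀ x, E.comp c i j x = 0) (x : D)
    (u v : TangentSpace 𝓘(ℝ, Model3) x) :
    c x u v = ∑ i, E.comp c i i x * (E.coframe i x u * E.coframe i x v) := by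
  have h1 : c x u v = ∑ i, ∑ j, E.coframe i x u * (E.coframe j x v * E.comp c i j x) := by
    conv_lhs => rw [E.frame_expansion x u, E.frame_expansion x v]
    simp only [map_sum, map_smul, sum_apply, smul_apply, smul_eq_mul, Finset.mul_sum]
    rw [Finset.sum_comm]
    refine Finset.sum_congr rfl fun i _ => Finset.sum_congr rfl fun j _ => ?_
    simp only [coframe, comp]
    ring
  rw [h1]
  refine Finset.sum_congr rfl fun i _ => ?_
  rw [Finset.sum_eq_single i (fun j _ hj => by rw [hdiag i j hj.symm]; ring) (by simp)]
  ring

end GaussianFrame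

/-- The spacetime whose slices have the metrics `∑ exp (2 φᵢ) (dxⁱ)²`. -/
noncomputable def diagSpacetime {Ω : Set (ℝ × D)} (N : IsNormalNeighbourhood Ω)
    {φ : Fin 3 → ℝ × D → ℝ} (hφ : ∀ i, AnalyticOnSet Ω (φ i)) (h0 : ∀ i x, φ i (0, x) = 0) :
    SignatureChangingSpacetime h where
  carrier := Ω
  isOpen_carrier := N.isOpen
  zero_mem := N.zero_mem
  ordConnected_fiber := N.ordConnected
  spatial t x := E.diagForm (fun i => Real.exp (2 * φ i (t, x))) x
  spatial_symm t x _ u v := by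
    simp only [E.diagForm_apply, mul_comm (E.coframe _ x u)]
  spatial_pos t x _ u hu := by
    rw [E.diagForm_apply]
    have h1 : ∃ i, E.coframe i x u ≠ 0 := by
      by_contra! h2
      refine hu ?_
      rw [E.frame_expansion x u]
      exact Finset.sum_eq_zero fun i _ => by
        have h3 : h.inner x (E.field i x) u = 0 := h2 i
        rw [h3, zero_smul]
    obtain ⟨i, hi⟩ := h1
    exact Finset.sum_pos' (fun j _ => mul_nonneg (Real.exp_pos _).le (mul_self_nonneg _))
      ⟨i, Finset.mem_univ i, mul_pos (Real.exp_pos _) (mul_self_pos.2 hi)⟩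
  spatial_analytic p hp := by
    have C := SignatureChangingSpacetime.frameCalculus E N.isOpen
    exact (E.contMDiffAt_diagForm fun i => C.exp (C.const_mul 2 (hφ i)) p hp).contMDiffWithinAt
  spatial_zero x := by
    ext u v
    have h1 := E.apply_eq_sum (c := h.inner) (fun i j hij x => by
      rw [GaussianFrame.comp, E.orthonormal, if_neg hij]) x u v
    rw [E.diagForm_apply, h1]
    refine Finset.sum_congr rfl fun i _ => ?_
    rw [GaussianFrame.comp, E.orthonormal, if_pos rfl, h0]
    simp

namespace SignatureChangingSpacetime

variable {E} {Ω : Set (ℝ × D)} (N : IsNormalNeighbourhood Ω)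
    {φ : Fin 3 → ℝ × D → ℝ} (hφ : ∀ i, AnalyticOnSet Ω (φ i)) (h0 : ∀ i x, φ i (0, x) = 0)

theorem spatialGram_diagSpacetime (p : ℝ × D) :
    (diagSpacetime E N hφ h0).spatialGram E p = diagGram φ p := by
  ext i j
  have h1 : (diagSpacetime E N hφ h0).spatialGram E p i j =
    E.diagForm (fun i => Real.exp (2 * φ i p)) p.2 (E.field i p.2) (E.field j p.2) := rfl
  rw [h1, E.diagForm_apply]
  simp only [E.coframe_field, diagGram, Matrix.diagonal_apply]
  by_cases hij : i = j
  · subst hij; simp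
  · simp [hij, Ne.symm hij]

theorem hasVelocity_diagSpacetime (hdiag : ∀ i j, i ≠ j → ∀ x, E.comp c i j x = 0)
    (hd : ∀ i x, frameDir E 0 (φ i) (0, x) = E.kappa c i x) :
    (diagSpacetime E N hφ h0).HasVelocity c := by
  intro x u v
  have h1 : (fun t => (diagSpacetime E N hφ h0).spatial t x u v) = fun t =>
      ∑ i, Real.exp (2 * φ i (t, x)) * (E.coframe i x u * E.coframe i x v) :=
    funext fun t => E.diagForm_apply _ x u v
  rw [h1, E.apply_eq_sum hdiag x u v]
  refine HasDerivAt.fun_sum fun i _ => ?_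
  have h2 := (hφ i).hasDerivAt_fiber E (N.zero_mem x)
  rw [hd] at h2
  have h3 := ((h2.const_mul 2).exp).mul_const (E.coframe i x u * E.coframe i x v)
  -- The factor `2` in the exponent compensates `κᵢ = ½ cᵢ`.
  have h4 : Real.exp (2 * φ i (0, x)) * (2 * E.kappa c i x) = E.comp c i i x := by
    rw [h0, GaussianFrame.kappa, mul_zero, Real.exp_zero]
    ring
  rwa [h4] at h3

end SignatureChangingSpacetime

/-- The points of `ℝ × D` at which `1 + f t` is positive. -/
def positiveRegion (f : D → ℝ) : Set (ℝ × D) := {p | 0 < 1 + f p.2 * p.1}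

-- On each normal line `1 + f t` is affine in `t` with the value `1` at `0`, so it is positive on an
-- interval around `0`.
omit [ChartedSpace Model3 D] [IsManifold 𝓘(ℝ, Model3) ω D] in
theorem isNormalNeighbourhood_positiveRegion {f : D → ℝ} (hf : Continuous f) :
    IsNormalNeighbourhood (positiveRegion f) where
  isOpen := isOpen_lt continuous_const (by fun_prop)
  zero_mem x := by simp [positiveRegion]
  ordConnected x := by
    refine ⟨fun a ha b hb t ht => ?_⟩
    simp only [positiveRegion, mem_ofPred_eq] at ha hb ⊢
    rcases le_total 0 (f x) with h1 | h1
    · have := mul_le_mul_of_nonneg_left ht.1 h1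
      linarith
    · have := mul_le_mul_of_nonpos_left ht.2 h1
      linarith

/-- The functions `φᵢ = rᵢ log (1 + f t)`. -/
noncomputable def powerExponent (r : Fin 3 → ℝ) (f : D → ℝ) (i : Fin 3) (p : ℝ × D) : ℝ :=
  r i * Real.log (1 + f p.2 * p.1)

namespace SignatureChangingSpacetime

variable {E} {f : D → ℝ} (hf : ContMDiff 𝓘(ℝ, Model3) 𝓘(ℝ, ℝ) ω f) (r : Fin 3 → ℝ)
include hf

omit [TopologicalSpace D] [ChartedSpace Model3 D] [IsManifold 𝓘(ℝ, Model3) ω D] hf in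
theorem powerExponent_zero (r : Fin 3 → ℝ) (i : Fin 3) (x : D) :
    powerExponent r f i (0, x) = 0 := by simp [powerExponent]

theorem analyticOnSet_one_add_mul (E : GaussianFrame h) :
    AnalyticOnSet (positiveRegion f) (fun p => 1 + f p.2 * p.1) := by
  have C := frameCalculus E (isNormalNeighbourhood_positiveRegion hf.continuous).isOpen
  exact C.add (C.const 1) (C.mul (GaussianFrame.analyticOnSet_snd hf _) (analyticOnSet_fst _))

theorem frameDir_one_add_mul (a : Fin 4) {p : ℝ × D} (hp : p ∈ positiveRegion f) :
    frameDir E a (fun p => 1 + f p.2 * p.1) p =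
      frameDir E a (fun p => f p.2) p * p.1 + f p.2 * frameDir E a Prod.fst p := by
  have C := frameCalculus E (isNormalNeighbourhood_positiveRegion hf.continuous).isOpen
  have hf' := GaussianFrame.analyticOnSet_snd hf (positiveRegion f)
  rw [C.dir_add a (C.const 1) (C.mul hf' (analyticOnSet_fst _)) p hp, C.dir_const a 1 p hp,
    C.dir_mul a hf' (analyticOnSet_fst _) p hp, zero_add]

theorem powerExponent_mem (E : GaussianFrame h) (i : Fin 3) :
    AnalyticOnSet (positiveRegion f) (powerExponent r f i) := by
  have C := frameCalculus E (isNormalNeighbourhood_positiveRegion hf.continuous).isOpen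
  exact C.const_mul _ (C.log (analyticOnSet_one_add_mul hf E) fun p hp => hp)

theorem frameDir_powerExponent (a : Fin 4) (i : Fin 3) {p : ℝ × D} (hp : p ∈ positiveRegion f) :
    (1 + f p.2 * p.1) * frameDir E a (powerExponent r f i) p =
      r i * (frameDir E a (fun p => f p.2) p * p.1 + f p.2 * frameDir E a Prod.fst p) := by
  have C := frameCalculus E (isNormalNeighbourhood_positiveRegion hf.continuous).isOpen
  have h1 := analyticOnSet_one_add_mul hf E
  have h2 : frameDir E a (powerExponent r f i) p =
      r i * frameDir E a (fun p => Real.log (1 + f p.2 * p.1)) p :=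
    C.dir_const_mul a _ (C.log h1 fun p hp => hp) hp
  have h3 : (1 + f p.2 * p.1) ≠ 0 := ne_of_gt hp
  rw [h2, C.dir_log a h1 hp hp, frameDir_one_add_mul hf a hp]
  field_simp

theorem frameDir_zero_powerExponent (i : Fin 3) {p : ℝ × D} (hp : p ∈ positiveRegion f) :
    (1 + f p.2 * p.1) * frameDir E 0 (powerExponent r f i) p = r i * f p.2 := by
  rw [frameDir_powerExponent hf r 0 i hp, frameDir_zero_snd E f, frameDir_zero_fst]
  ring

theorem frameDir_succ_powerExponent (i j : Fin 3) (hj : ∀ x, E.dir j f x = 0) {p : ℝ × D}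
    (hp : p ∈ positiveRegion f) : frameDir E j.succ (powerExponent r f i) p = 0 := by
  have h1 := frameDir_powerExponent (E := E) hf r j.succ i hp
  have h2 : frameDir E j.succ (fun p => f p.2) p = 0 := hj p.2
  have h3 : frameDir E j.succ Prod.fst p = 0 := E.calculus.dir_const j p.1 p.2 trivial
  rw [h2, h3] at h1
  have h4 : (1 + f p.2 * p.1) ≠ 0 := ne_of_gt hp
  simpa [h4] using h1

theorem frameDir_zero_zero_powerExponent (i : Fin 3) {p : ℝ × D} (hp : p ∈ positiveRegion f) :
    (1 + f p.2 * p.1) ^ 2 * frameDir E 0 (frameDir E 0 (powerExponent r f i)) p =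
      -(r i * f p.2 ^ 2) := by
  have C := frameCalculus E (isNormalNeighbourhood_positiveRegion hf.continuous).isOpen
  have h1 := C.dir_congr 0 (fun p hp => frameDir_zero_powerExponent (E := E) hf r i hp) p hp
  rw [C.dir_mul 0 (analyticOnSet_one_add_mul hf E) (C.dir 0 (powerExponent_mem hf r E i)) p hp,
    frameDir_one_add_mul hf 0 hp, frameDir_zero_fst, frameDir_zero_snd E f,
    frameDir_zero_snd E (fun x => r i * f x)] at h1
  linear_combination (1 + f p.2 * p.1) * h1 - f p.2 * frameDir_zero_powerExponent (E := E) hf r i hp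

/-- The spacetime with the slices `∑ (1 + f t) ^ (2 rᵢ) (dxⁱ)²`. -/
noncomputable def powerSpacetime (E : GaussianFrame h) : SignatureChangingSpacetime h :=
  diagSpacetime E (isNormalNeighbourhood_positiveRegion hf.continuous)
    (powerExponent_mem hf r E) (powerExponent_zero r)

theorem hasVelocity_powerSpacetime (hdiag : ∀ i j, i ≠ j → ∀ x, E.comp c i j x = 0)
    (hr : ∀ i x, E.kappa c i x = r i * f x) : (powerSpacetime hf r E).HasVelocity c := by
  refine hasVelocity_diagSpacetime _ _ _ hdiag fun i x => ?_
  have h1 := frameDir_zero_powerExponent (E := E) hf r i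
    ((isNormalNeighbourhood_positiveRegion hf.continuous).zero_mem x)
  rw [hr]
  simpa using h1

/-- The Kasner metric with exponents `rᵢ`. The Kasner conditions `∑ rᵢ = ∑ rᵢ² = 1` are multiplied
by powers of `f`, so that they impose nothing when `f = 0` and the static case is included. -/
theorem isVacuum_powerSpacetime_of_const (hconst : ∀ j x, E.dir j f x = 0)
    (hsum : ∀ x, (∑ i, r i) * f x = f x) (hsq : ∀ x, (∑ i, r i ^ 2) * f x ^ 2 = f x ^ 2) :
    (powerSpacetime hf r E).IsVacuum E := by
  intro p hp hp0 a b
  obtain ⟨s, hs, hsp⟩ := exists_sign hp0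
  have hs2 : s * s = 1 := by rcases hs with rfl | rfl <;> norm_num
  have C := frameCalculus E (isNormalNeighbourhood_positiveRegion hf.continuous).isOpen
  have hθ : ∀ q ∈ positiveRegion f, ∀ i,
      frameDir E 0 (powerExponent r f i) q = r i * (f q.2 / (1 + f q.2 * q.1)) := by
    intro q hq i
    have h1 := frameDir_zero_powerExponent (E := E) hf r i hq
    have h2 : (1 + f q.2 * q.1) ≠ 0 := ne_of_gt hq
    field_simp
    linear_combination h1
  have key : ricciTensor (frameDir E) ((powerSpacetime hf r E).gram E) a b p =
      ricciTensor (frameDir E) (blockGram s (diagGram (powerExponent r f))) a b p :=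
    Finset.sum_congr rfl fun _ _ => riemannTensor_gram_eq_diag
      (fun q _ => spatialGram_diagSpacetime _ _ _ q) hs hp hsp _ _ _ _
  rw [key]
  refine ricciTensor_kasner C (powerExponent_mem hf r E) hs2
    (fun i j p hp => frameDir_succ_powerExponent hf r i j (hconst j) hp) (fun i q hq => ?_)
    (fun q hq => ?_) a b hp
  · have h1 := frameDir_zero_zero_powerExponent (E := E) hf r i hq
    have h2 : (1 + f q.2 * q.1) ≠ 0 := ne_of_gt hq
    simp only [hθ q hq, ← Finset.sum_mul]
    have h3 := hsum q.2
    field_simp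
    linear_combination h1 + r i * f q.2 * h3
  · have h2 : (1 + f q.2 * q.1) ≠ 0 := ne_of_gt hq
    simp only [hθ q hq, ← Finset.sum_mul, mul_pow]
    have h3 := hsum q.2
    have h4 := hsq q.2
    field_simp
    linear_combination h4 - ((∑ i, r i) * f q.2 + f q.2) * h3

/-- For a single exponent `1` the function `e^φ = 1 + f t` is affine in `t`, which is the condition
for the planar metric to be flat. -/
theorem isFlat_powerSpacetime {i : Fin 3} (hdir : ∀ j ≠ i, ∀ x, E.dir j f x = 0) :
    (powerSpacetime hf (Pi.single i 1) E).IsFlat E := by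
  refine isFlat_of_planar (φ := powerExponent (Pi.single i 1) f)
    (fun q _ => spatialGram_diagSpacetime _ _ _ q) (powerExponent_mem hf _ E) i ?_ ?_ ?_
  · intro j hj p _
    simp [powerExponent, hj]
  · intro j hj p hp
    exact frameDir_succ_powerExponent hf _ i j (hdir j hj) hp
  · intro p hp
    have h1 := frameDir_zero_zero_powerExponent (E := E) hf (Pi.single i 1) i hp
    have h2 := frameDir_zero_powerExponent (E := E) hf (Pi.single i 1) i hp
    have h3 : (1 + f p.2 * p.1) ^ 2 ≠ 0 := pow_ne_zero _ (ne_of_gt hp)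
    rw [Pi.single_eq_same] at h1 h2
    refine (mul_eq_zero.1 (?_ : (1 + f p.2 * p.1) ^ 2 * _ = 0)).resolve_left h3
    linear_combination h1 +
      ((1 + f p.2 * p.1) * frameDir E 0 (powerExponent (Pi.single i 1) f i) p + f p.2) * h2

end SignatureChangingSpacetime
end Existence

/-! ### The existence theorem for given eigenvalues -/

section Classification

variable {D : Type*} [TopologicalSpace D] [ChartedSpace Model3 D] [IsManifold 𝓘(ℝ, Model3) ω D]
  {h : AnalyticMetric D} {E : GaussianFrame h} {c : BilinField D}

theorem GaussianFrame.comp_eq_kappa (E : GaussianFrame h) (c : BilinField D) (i : Fin 3) :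
    E.comp c i i = fun x => 2 * E.kappa c i x :=
  funext fun x => by rw [GaussianFrame.kappa]; ring

namespace SignatureChangingSpacetime

theorem exists_isVacuum_of_vanish (hc : c.IsAnalytic)
    (hdiag : ∀ i j, i ≠ j → ∀ x, E.comp c i j x = 0) {i : Fin 3}
    (hi : ∀ j, j ≠ i → ∀ x, E.dir j (E.kappa c i) x = 0 ∧ E.kappa c j x = 0) :
    ∃ M : SignatureChangingSpacetime h, M.IsVacuum E ∧ M.HasVelocity c := by
  refine ⟨powerSpacetime (E.contMDiff_kappa hc i) (Pi.single i 1) E,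
    (isFlat_powerSpacetime _ fun j hj x => (hi j hj x).1).isVacuum,
    hasVelocity_powerSpacetime _ _ hdiag fun j x => ?_⟩
  by_cases hj : j = i
  · subst hj; simp
  · simp [hj, (hi j hj x).2]

/-- The Kasner exponents are `κᵢ / K`; the quadratic constraint is their Kasner condition. -/
theorem exists_isVacuum_of_const [ConnectedSpace D]
    (hdiag : ∀ i j, i ≠ j → ∀ x, E.comp c i j x = 0)
    (hquad : ∀ x, ∑ i, E.kappa c i x ^ 2 = E.meanKappa c x ^ 2)
    (hconst : ∀ i x y, E.kappa c i x = E.kappa c i y) :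
    ∃ M : SignatureChangingSpacetime h, M.IsVacuum E ∧ M.HasVelocity c := by
  obtain ⟨x₀⟩ := (inferInstance : Nonempty D)
  set k : Fin 3 → ℝ := fun i => E.kappa c i x₀ with hk
  set K : ℝ := ∑ i, k i with hK
  have hq : ∑ i, k i ^ 2 = K ^ 2 := hquad x₀
  -- If `K = 0`, the constraint is `∑ kᵢ² = 0`, so all `kᵢ` vanish and the identity survives the
  -- convention for division by zero.
  have hr : ∀ i, k i = k i / K * K := by
    intro i
    by_cases h0 : K = 0
    · have h1 : k i ^ 2 = 0 := by
        rw [h0] at hq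
        have h2 := (Finset.sum_eq_zero_iff_of_nonneg fun j _ => sq_nonneg (k j)).1
          (hq.trans (by norm_num)) i (Finset.mem_univ i)
        exact h2
      rw [h0, mul_zero]
      simpa using h1
    · field_simp
  refine ⟨powerSpacetime (f := fun _ => K) contMDiff_const (fun i => k i / K) E,
    isVacuum_powerSpacetime_of_const _ _ (fun j x => E.calculus.dir_const j K x trivial)
      (fun _ => ?_) (fun _ => ?_),
    hasVelocity_powerSpacetime _ _ hdiag fun i x => (hconst i x x₀).trans (hr i)⟩
  · rw [Finset.sum_mul, hK]
    exact Finset.sum_congr rfl fun i _ => (hr i).symm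
  · rw [Finset.sum_mul]
    exact (Finset.sum_congr rfl fun i _ => by rw [← mul_pow, ← hr i]).trans hq

end SignatureChangingSpacetime
end Classification

theorem theoremt22 {D : Type*} [TopologicalSpace D] [T2Space D] [SecondCountableTopology D]
    [ConnectedSpace D] [ChartedSpace Model3 D] [IsManifold 𝓘(ℝ, Model3) ω D]
    (h : AnalyticMetric D) (E : GaussianFrame h) (hflat : E.SurfaceIsFlat)
    (c : BilinField D) (hc : c.IsAnalytic) (hsymm : ∀ x u v, c x u v = c x v u)
    (hdiag : ∀ i j, i ≠ j → ∀ x, E.comp c i j x = 0) :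
    ((∃ M : SignatureChangingSpacetime h, M.IsVacuum E ∧ M.HasVelocity c) ↔
      (∀ x, E.comp c 0 0 x * E.comp c 1 1 x + E.comp c 1 1 x * E.comp c 2 2 x +
          E.comp c 2 2 x * E.comp c 0 0 x = 0) ∧
        ((∀ i x y, E.comp c i i x = E.comp c i i y) ∨
          (∃ i, ∀ j, j ≠ i → ∀ x, E.dir j (E.comp c i i) x = 0 ∧ E.comp c j j x = 0))) ∧
    (∀ M : SignatureChangingSpacetime h, M.IsVacuum E → M.HasVelocity c →
      (M.IsFlat E ↔ ∃ i, ∀ j, j ≠ i → ∀ x, E.comp c j j x = 0)) := by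

  have hκ := E.comp_eq_kappa c
  have hz : ∀ i x, E.comp c i i x = 0 ↔ E.kappa c i x = 0 := fun i x => by simp [hκ]
  have hdz : ∀ i j x, E.dir j (E.comp c i i) x = 0 ↔ E.dir j (E.kappa c i) x = 0 := fun i j x => by
    rw [hκ, E.calculus.dir_const_mul j 2 (E.contMDiff_kappa hc i) trivial]
    simp
  have he : ∀ i x y, E.comp c i i x = E.comp c i i y ↔ E.kappa c i x = E.kappa c i y :=
    fun i x y => by simp [hκ]
  simp only [hz, hdz, he]
  refine ⟨⟨?_, ?_⟩, fun M hM hv => ?_⟩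
  · rintro ⟨M, hM, hv⟩
    obtain ⟨φ, hφ⟩ := hM.exists_slicesData hv hc hdiag
    have H := hφ.isChangeSurface hc
    refine ⟨fun x => ?_, H.const_or_vanish⟩
    have h1 := H.gauss (i := 0) (j := 1) (k := 2) (by decide) (by decide) (by decide) x
    simp only [hκ]
    linear_combination 4 * h1
  · rintro ⟨hquad, hconst | ⟨i, hi⟩⟩
    · refine SignatureChangingSpacetime.exists_isVacuum_of_const hdiag (fun x => ?_) hconst
      have h1 := hquad x
      simp only [hκ] at h1
      simp only [GaussianFrame.meanKappa, Fin.sum_univ_three]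
      linear_combination -h1 / 2
    · exact SignatureChangingSpacetime.exists_isVacuum_of_vanish hc hdiag hi
  · obtain ⟨φ, hφ⟩ := hM.exists_slicesData hv hc hdiag
    exact ⟨fun hF => hφ.exists_vanish_of_isFlat hc hF,
      fun ⟨_, hi⟩ => hφ.isFlat_of_vanish hc hi⟩
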